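/- Let $G=(V,E)$ be a finite non-empty undirected simple graph and let $d,r>0$ be integers. For $v\in V$ let $N_r(v)$ be the set of vertices $u\neq v$ at distance at most $r$ from $v$ in $G$. A set $S\subseteq V$ is a $(d,r)$-dominating set of $G$ if $|N_r(v)\cap S|\ge d$ for every $v\in V\setminus S$. The problem $(d,r)$-Domination asks, given $G$, $d$ and $r$, for a $(d,r)$-dominating set of $G$ of minimum size. The modular-width $\mathrm{mw}(G)$ is the minimum width of a construction of $G$ (up to isomorphism) by the following operations: creation of an isolated vertex; disjoint union of two graphs; complete join of two graphs; substitution of the $\ell\ge 2$ vertices of an outline graph $H$ by graphs $G_1,\dots,G_\ell$ (every vertex of $G_i$ is joined to every vertex of $G_j$ exactly when $ij\in E(H)$, for $i\ne j$). The width of a construction is the maximum number of vertices of an outline graph used in it, and $2$ if no substitution is used. Algorithms are programs for a random access machine with finitely many registers and arrays of natural numbers, whose elementary operations (addition, truncated subtraction, test for zero, reading and writing a register or an array cell) have unit cost; $G$ is given by its number of vertices and its adjacency matrix. **Theorem.** After a preprocessing of $(G,r)$, which does not depend on $d$ and takes time polynomial in $|V(G)|$, $(d,r)$-Domination can be solved,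 for every $d>0$, in time $O\bigl(|V(G)|\cdot d\cdot (d+1)^{\mathrm{mw}(G)}\bigr)$. That is, there are two fixed programs and constants $C,c$ such that, for all $G$ and $r$, the first one, on input $(G,r)$, halts within $C\,|V(G)|^{c}$ steps, and for every $d$ the second one, started from the resulting memory and given $d$, outputs a minimum $(d,r)$-dominating set of $G$ within $C\,|V(G)|\,d\,(d+1)^{\mathrm{mw}(G)}$ steps. Consequently there are one program and constants $C,c$ such that the program, on every input $(G,d,r)$, outputs a minimum $(d,r)$-dominating set of $G$ within $C\bigl(|V(G)|^{c}+|V(G)|\,d\,(d+1)^{\mathrm{mw}(G)}\bigr)$ steps; and the problem is fixed-parameter tractable with respect to $\mathrm{mw}(G)+d$: the running time of this program is also at most $f(\mathrm{mw}(G)+d)\cdot|V(G)|^{c'}$ for a computable function $f$ and a constant $c'$. -/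

import Mathlib

namespace DRDomination

/-! ### `(d, r)`-dominating sets -/

/-- `N_r(v)`: the vertices other than `v` at distance at most `r` from `v`.  The extended distance
is used, so that vertices in different components are at distance `⊤`. -/
def ball {V : Type*} (G : SimpleGraph V) (r : ℕ) (v : V) : Set V :=
  {u | u ≠ v ∧ G.edist v u ≤ (r : ℕ∞)}

/-- `S` is a `(d, r)`-dominating set of `G`. -/
def IsDominating {V : Type*} (G : SimpleGraph V) (d r : ℕ) (S : Finset V) : Prop :=
  ∀ v, v ∉ S → d ≤ (ball G r v ∩ (S : Set V)).ncard

/-- `S` is a `(d, r)`-dominating set of `G` of minimum size. -/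
def IsMinDominating {V : Type*} (G : SimpleGraph V) (d r : ℕ) (S : Finset V) : Prop :=
  IsDominating G d r S ∧ ∀ T : Finset V, IsDominating G d r T → S.card ≤ T.card

/-! ### Modular-width -/

/-- Sequences of the four graph operations, arranged as parse trees: an isolated vertex, the
disjoint union and the complete join of two graphs, and the substitution of the `l ≥ 2` vertices of
an outline graph `H` by `l` graphs. -/
inductive ParseTree : Type
  | vertex : ParseTree
  | union (A B : ParseTree) : ParseTree
  | join (A B : ParseTree) : ParseTree
  | subst (l : ℕ) (hl : 2 ≤ l) (H : SimpleGraph (Fin l)) (A : Fin l → ParseTree) : ParseTree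

namespace ParseTree

/-- The vertex type of the graph constructed by a parse tree. -/
def Vert : ParseTree → Type
  | vertex => Unit
  | union A B => A.Vert ⊕ B.Vert
  | join A B => A.Vert ⊕ B.Vert
  | subst l _ _ A => Σ i : Fin l, (A i).Vert

/-- Adjacency in the graph constructed by a parse tree. -/
def Adj : (T : ParseTree) → T.Vert → T.Vert → Prop
  | vertex, _, _ => False
  | union A _, .inl u, .inl v => A.Adj u v
  | union _ B, .inr u, .inr v => B.Adj u v
  | union _ _, .inl _, .inr _ => False
  | union _ _, .inr _, .inl _ => False
  | join A _, .inl u, .inl v => A.Adj u v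
  | join _ B, .inr u, .inr v => B.Adj u v
  | join _ _, .inl _, .inr _ => True
  | join _ _, .inr _, .inl _ => True
  | subst _ _ H A, ⟨i, u⟩, ⟨j, v⟩ => H.Adj i j ∨ ∃ h : i = j, (A j).Adj (h ▸ u) v

/-- The width: the maximum size of an outline graph used in a substitution, and `2` if there is no
substitution (outline graphs have at least two vertices, so taking the maximum with `2` changes
nothing if there is one). -/
def width : ParseTree → ℕ
  | vertex => 2
  | union A B => max A.width B.width
  | join A B => max A.width B.width
  | subst l _ _ A => max l (Finset.univ.sup fun i => (A i).width)

/-- The parse tree constructs the graph `G`, up to isomorphism. -/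
def Constructs {V : Type*} (T : ParseTree) (G : SimpleGraph V) : Prop :=
  ∃ e : T.Vert ≃ V, ∀ u v, T.Adj u v ↔ G.Adj (e u) (e v)

end ParseTree

/-- The modular-width of `G`: the minimum width of a parse tree that constructs `G`
(every finite non-empty graph has a parse tree). -/
noncomputable def modularWidth {V : Type*} (G : SimpleGraph V) : ℕ :=
  sInf {w | ∃ T : ParseTree, T.Constructs G ∧ T.width = w}

/-! ### Unit-cost random access machine -/

/-- The memory: registers and arrays (of unbounded length), all holding natural numbers. -/
structure Mem where
  reg : ℕ → ℕ
  arr : ℕ → ℕ → ℕ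

/-- Write a value into a register. -/
def Mem.setReg (s : Mem) (x k : ℕ) : Mem :=
  { s with reg := Function.update s.reg x k }

/-- Write a value into an array cell. -/
def Mem.setArr (s : Mem) (a i k : ℕ) : Mem :=
  { s with arr := Function.update s.arr a (Function.update (s.arr a) i k) }

/-- Expressions.  Addition and truncated subtraction are the only arithmetic operations. -/
inductive Expr : Type
  | const (k : ℕ) : Expr
  | reg (x : ℕ) : Expr
  | get (a : ℕ) (e : Expr) : Expr
  | add (e₁ e₂ : Expr) : Expr
  | sub (e₁ e₂ : Expr) : Expr

/-- The value of an expression. -/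
def Expr.val (s : Mem) : Expr → ℕ
  | .const k => k
  | .reg x => s.reg x
  | .get a e => s.arr a (e.val s)
  | .add e₁ e₂ => e₁.val s + e₂.val s
  | .sub e₁ e₂ => e₁.val s - e₂.val s

/-- The number of elementary operations performed when an expression is evaluated. -/
def Expr.cost : Expr → ℕ
  | .const _ => 1
  | .reg _ => 1
  | .get _ e => e.cost + 1
  | .add e₁ e₂ => e₁.cost + e₂.cost + 1
  | .sub e₁ e₂ => e₁.cost + e₂.cost + 1

/-- Programs: assignment to a register, to an array cell, sequencing, branching on whether an
expression is non-zero, and iteration while an expression is non-zero. -/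
inductive Cmd : Type
  | skip : Cmd
  | assign (x : ℕ) (e : Expr) : Cmd
  | write (a : ℕ) (i e : Expr) : Cmd
  | seq (p q : Cmd) : Cmd
  | cond (b : Expr) (p q : Cmd) : Cmd
  | loop (b : Expr) (p : Cmd) : Cmd

/-- `Runs p s t s'`: started in memory `s`, the program `p` halts after exactly `t` elementary
steps, and leaves the memory `s'`. -/
inductive Runs : Cmd → Mem → ℕ → Mem → Prop
  | skip (s : Mem) : Runs .skip s 1 s
  | assign (s : Mem) (x : ℕ) (e : Expr) :
      Runs (.assign x e) s (e.cost + 1) (s.setReg x (e.val s))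
  | write (s : Mem) (a : ℕ) (i e : Expr) :
      Runs (.write a i e) s (i.cost + e.cost + 1) (s.setArr a (i.val s) (e.val s))
  | seq {p q : Cmd} {s s' s'' : Mem} {t t' : ℕ} :
      Runs p s t s' → Runs q s' t' s'' → Runs (.seq p q) s (t + t') s''
  | cond_true {b : Expr} {p q : Cmd} {s s' : Mem} {t : ℕ} :
      b.val s ≠ 0 → Runs p s t s' → Runs (.cond b p q) s (b.cost + 1 + t) s'
  | cond_false {b : Expr} {p q : Cmd} {s s' : Mem} {t : ℕ} :
      b.val s = 0 → Runs q s t s' → Runs (.cond b p q) s (b.cost + 1 + t) s'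
  | loop_done {b : Expr} {p : Cmd} {s : Mem} :
      b.val s = 0 → Runs (.loop b p) s (b.cost + 1) s
  | loop_step {b : Expr} {p : Cmd} {s s' s'' : Mem} {t t' : ℕ} :
      b.val s ≠ 0 → Runs p s t s' → Runs (.loop b p) s' t' s'' →
        Runs (.loop b p) s (b.cost + 1 + t + t') s''

/-! ### Input and output -/

/-- The register that holds the demand. -/
def demandReg : ℕ := 2

open Classical in
/-- The initial memory on input `(G, d, r)`: register `0` holds the number `n` of vertices,
register `1` the radius, register `demandReg` the demand, array `0` the adjacency matrix of `G`
row by row; everything else is `0`. -/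
noncomputable def input {n : ℕ} (G : SimpleGraph (Fin n)) (d r : ℕ) : Mem where
  reg x := if x = 0 then n else if x = 1 then r else if x = demandReg then d else 0
  arr a k := if a = 0 ∧ ∃ u v : Fin n, G.Adj u v ∧ k = u.val * n + v.val then 1 else 0

/-- The set of vertices that is written in array `1`. -/
def output (n : ℕ) (s : Mem) : Finset (Fin n) :=
  Finset.univ.filter fun v => s.arr 1 v.val ≠ 0

end DRDomination

namespace DRDomination

/-! ### Program logic -/

/-! A set is `(d, r)`-dominating exactly when every vertex outside it has `d` neighbours inside it
in the `r`-th power of the graph (`isDominating_iff`), so the algorithm works with the power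
throughout. The power is not wider than the graph. `Dec` keeps only what matters of a parse tree: a
recursive splitting into at most `w` classes such that two different classes are completely joined
or not joined at all. A walk that leaves a class can start at any vertex of this class without
becoming longer, so the classes stay uniform in the power. A class with a neighbour outside becomes
a clique if `r ≥ 2`, and a clique can be taken apart vertex by vertex (`Dec.pow`).

The parse tree is not part of the input, so a decomposition of the power has to be found. Since
`Dec` passes to subsets (`Dec.subset`), every node can be split without regard to an optimal tree.
If the node has a bipartition into two joined or two separated parts, this is used. Otherwise two
overlapping proper modules have a proper union (`IsModule.union`), so lying in a common proper
module is an equivalence relation. The first genuine split of any decomposition refines its classes,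
hence there are at most `w` of them (`Dec.exists_proper`, `card_labels_le`). Both tests are closure
computations. Every inner node has at least two children, so there are fewer than `2 * n` nodes.

The dynamic program computes, for every node `X` and every demand `q ≤ d`, the least number of
vertices of `X` that give each unchosen vertex of `X` at least `q` chosen neighbours inside `X`. For
a vertex in one child, the contribution of another child depends only on the number of vertices
chosen there, and numbers above `d` count like `d` (`card_neighbours`, `sub_sum_min`). A row of the
table therefore guesses a number between `0` and `d` for every child. It determines the remaining
demand of every child, and a child costs the maximum of the guessed number and its own value for
that demand. The maximum is right because adding vertices never destroys a solution, so every number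
between the value and the size of the child can be realised (`solved_of_recorded`). The machine has
no multiplication or division, but a row arises from an earlier one by raising one digit, which
costs a constant number of steps per entry (`rowNum_succ`, `rowSum_succ`). A node with `l` children
thus takes `O((l + 1) * (d + 1) ^ (l + 1))` steps for all demands together, and summing over the
tree gives the bound (`Ready.sum_le`).

The solution is built from the root to the leaves. Each child receives its recorded demand and
number, and any surplus is handed out greedily up to the sizes of the children.
`localDom_of_distributed` shows that the numbers at the leaves then form a dominating set of the
optimal size.

Programs are verified through `Ends`, a total-correctness triple that also speaks of the number of
steps. For the preprocessing the steps are not counted: every loop runs up to a register that is not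
written inside, which already gives a polynomial bound (`Bounded.time`), and determinism combines
this bound with correctness. -/

theorem Runs.det {c : Cmd} {s : Mem} {t t' : ℕ} {s₁ s₂ : Mem} (h₁ : Runs c s t s₁)
    (h₂ : Runs c s t' s₂) : t = t' ∧ s₁ = s₂ := by
  induction h₁ generalizing t' s₂ with
  | skip | assign | write => cases h₂; exact ⟨rfl, rfl⟩
  | seq _ _ ih₁ ih₂ =>
    cases h₂ with
    | seq a b =>
      obtain ⟨rfl, rfl⟩ := ih₁ a
      obtain ⟨rfl, rfl⟩ := ih₂ b
      exact ⟨rfl, rfl⟩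
  | cond_true h _ ih =>
    cases h₂ with
    | cond_true _ a => obtain ⟨rfl, rfl⟩ := ih a; exact ⟨rfl, rfl⟩
    | cond_false h' _ => exact absurd h' h
  | cond_false h _ ih =>
    cases h₂ with
    | cond_true h' _ => exact absurd h h'
    | cond_false _ a => obtain ⟨rfl, rfl⟩ := ih a; exact ⟨rfl, rfl⟩
  | loop_done h =>
    cases h₂ with
    | loop_done => exact ⟨rfl, rfl⟩
    | loop_step h' _ _ => exact absurd h h'
  | loop_step h _ _ ih₁ ih₂ =>
    cases h₂ with
    | loop_done h' => exact absurd h' h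
    | loop_step _ a b =>
      obtain ⟨rfl, rfl⟩ := ih₁ a
      obtain ⟨rfl, rfl⟩ := ih₂ b
      exact ⟨rfl, rfl⟩

/-- `Ends c s Q`: started in `s`, the program `c` halts, and the number of steps and the final
memory satisfy `Q`. -/
def Ends (c : Cmd) (s : Mem) (Q : ℕ → Mem → Prop) : Prop :=
  ∃ t s', Runs c s t s' ∧ Q t s'

/-- The registers a program may write. -/
def Cmd.regs : Cmd → List ℕ
  | .skip => []
  | .assign x _ => [x]
  | .write _ _ _ => []
  | .seq p q => p.regs ++ q.regs
  | .cond _ p q => p.regs ++ q.regs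
  | .loop _ p => p.regs

/-- The arrays a program may write. -/
def Cmd.arrs : Cmd → List ℕ
  | .skip => []
  | .assign _ _ => []
  | .write a _ _ => [a]
  | .seq p q => p.arrs ++ q.arrs
  | .cond _ p q => p.arrs ++ q.arrs
  | .loop _ p => p.arrs

/-- Two memories agree outside the registers `R` and the arrays `A`. -/
structure Agree (R A : List ℕ) (s s' : Mem) : Prop where
  reg : ∀ x, x ∉ R → s'.reg x = s.reg x
  arr : ∀ a, a ∉ A → s'.arr a = s.arr a

theorem Agree.refl {R A : List ℕ} (s : Mem) : Agree R A s s := ⟨fun _ _ => rfl, fun _ _ => rfl⟩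

theorem Agree.trans {R A R' A' R'' A'' : List ℕ} {s s' s'' : Mem} (h : Agree R A s s')
    (h' : Agree R' A' s' s'') (hR : R ⊆ R'') (hR' : R' ⊆ R'') (hA : A ⊆ A'') (hA' : A' ⊆ A'') :
    Agree R'' A'' s s'' :=
  ⟨fun x hx => (h'.reg x fun k => hx (hR' k)).trans (h.reg x fun k => hx (hR k)),
   fun x hx => (h'.arr x fun k => hx (hA' k)).trans (h.arr x fun k => hx (hA k))⟩

theorem Agree.mono {R A R' A' : List ℕ} {s s' : Mem} (h : Agree R A s s') (hR : R ⊆ R')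
    (hA : A ⊆ A') : Agree R' A' s s' :=
  h.trans (Agree.refl (R := R) (A := A) _) hR hR hA hA

theorem Agree.append {R A R' A' : List ℕ} {s s' s'' : Mem} (h : Agree R A s s')
    (h' : Agree R' A' s' s'') : Agree (R ++ R') (A ++ A') s s'' :=
  h.trans h' (by simp) (by simp) (by simp) (by simp)

@[simp] theorem Mem.setReg_reg (s : Mem) (x k y : ℕ) :
    (s.setReg x k).reg y = if y = x then k else s.reg y := by
  simp [Mem.setReg, Function.update_apply]

@[simp] theorem Mem.setReg_arr (s : Mem) (x k : ℕ) : (s.setReg x k).arr = s.arr := rfl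

@[simp] theorem Mem.setArr_reg (s : Mem) (a i k : ℕ) : (s.setArr a i k).reg = s.reg := rfl

@[simp] theorem Mem.setArr_arr (s : Mem) (a i k b : ℕ) :
    (s.setArr a i k).arr b = if b = a then Function.update (s.arr a) i k else s.arr b := by
  simp only [Mem.setArr, Function.update_apply]

theorem Runs.agree {c : Cmd} {s : Mem} {t : ℕ} {s' : Mem} (h : Runs c s t s') :
    Agree c.regs c.arrs s s' := by
  induction h with
  | skip => exact Agree.refl _
  | assign s x e => exact ⟨fun y hy => by simp_all [Cmd.regs], fun _ _ => rfl⟩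
  | write s a i e => exact ⟨fun _ _ => rfl, fun y hy => by simp_all [Cmd.arrs]⟩
  | seq _ _ ih₁ ih₂ => exact ih₁.append ih₂
  | cond_true _ _ ih => exact ih.mono (by simp [Cmd.regs]) (by simp [Cmd.arrs])
  | cond_false _ _ ih => exact ih.mono (by simp [Cmd.regs]) (by simp [Cmd.arrs])
  | loop_done => exact Agree.refl _
  | loop_step _ _ _ ih₁ ih₂ =>
    exact ih₁.trans ih₂ (by simp [Cmd.regs]) (by simp [Cmd.regs]) (by simp [Cmd.arrs])
      (by simp [Cmd.arrs])

/-! ### Rules for the individual commands and for framing. -/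

namespace Ends

variable {c p q : Cmd} {s : Mem} {Q Q' : ℕ → Mem → Prop}

theorem mono (h : Ends c s Q) (hQ : ∀ t s', Q t s' → Q' t s') : Ends c s Q' := by
  obtain ⟨t, s', hr, hq⟩ := h
  exact ⟨t, s', hr, hQ _ _ hq⟩

/-- The frame rule: whatever a program does not syntactically write is unchanged. Specifications of
subprograms therefore only mention what they compute, and the rest is recovered from `Agree`. -/
theorem conseq (h : Ends c s Q) (hQ : ∀ t s', Agree c.regs c.arrs s s' → Q t s' → Q' t s') :
    Ends c s Q' := by
  obtain ⟨t, s', hr, hq⟩ := h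
  exact ⟨t, s', hr, hQ _ _ hr.agree hq⟩

theorem skip_iff : Ends .skip s Q ↔ Q 1 s :=
  ⟨fun ⟨_, _, hr, h⟩ => by cases hr; exact h, fun h => ⟨_, _, .skip _, h⟩⟩

theorem assign_iff {x : ℕ} {e : Expr} :
    Ends (.assign x e) s Q ↔ Q (e.cost + 1) (s.setReg x (e.val s)) :=
  ⟨fun ⟨_, _, hr, h⟩ => by cases hr; exact h, fun h => ⟨_, _, .assign _ _ _, h⟩⟩

theorem write_iff {a : ℕ} {i e : Expr} :
    Ends (.write a i e) s Q ↔ Q (i.cost + e.cost + 1) (s.setArr a (i.val s) (e.val s)) :=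
  ⟨fun ⟨_, _, hr, h⟩ => by cases hr; exact h, fun h => ⟨_, _, .write _ _ _ _, h⟩⟩

theorem seq_iff :
    Ends (.seq p q) s Q ↔ Ends p s fun t s' => Ends q s' fun t' s'' => Q (t + t') s'' := by
  constructor
  · rintro ⟨_, _, hr, h⟩
    cases hr with
    | seq a b => exact ⟨_, _, a, _, _, b, h⟩
  · rintro ⟨_, _, a, _, _, b, h⟩
    exact ⟨_, _, .seq a b, h⟩

theorem cond_iff {b : Expr} : Ends (.cond b p q) s Q ↔
    (b.val s ≠ 0 → Ends p s fun t s' => Q (b.cost + 1 + t) s') ∧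
    (b.val s = 0 → Ends q s fun t s' => Q (b.cost + 1 + t) s') := by
  constructor
  · rintro ⟨_, _, hr, h⟩
    cases hr with
    | cond_true hb a => exact ⟨fun _ => ⟨_, _, a, h⟩, fun h' => absurd h' hb⟩
    | cond_false hb a => exact ⟨fun h' => absurd hb h', fun _ => ⟨_, _, a, h⟩⟩
  · rintro ⟨h₁, h₂⟩
    by_cases hb : b.val s = 0
    · obtain ⟨_, _, a, h⟩ := h₂ hb
      exact ⟨_, _, .cond_false hb a, h⟩
    · obtain ⟨_, _, a, h⟩ := h₁ hb
      exact ⟨_, _, .cond_true hb a, h⟩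

end Ends

/-- `for x in [0, y): p`, where `y` is a register. -/
def forLoop (x y : ℕ) (p : Cmd) : Cmd :=
  .seq (.assign x (.const 0))
    (.loop (.sub (.reg y) (.reg x)) (.seq p (.assign x (.add (.reg x) (.const 1)))))

namespace Ends

variable {p : Cmd} {s : Mem} {Q : ℕ → Mem → Prop} {x y : ℕ}

/-- The loop rule, with an invariant that may speak of the number of steps so far. -/
theorem forLoop_timed (I : ℕ → ℕ → Mem → Prop)
    (h0 : I 0 2 (s.setReg x 0))
    (hs : ∀ i t s', i < s.reg y → s'.reg x = i → Agree (x :: p.regs) p.arrs s s' → I i t s' →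
      Ends p s' fun t' s'' => I (i + 1) (t + t' + 8) (s''.setReg x (i + 1)))
    (hQ : ∀ t s', s'.reg x = s.reg y → Agree (x :: p.regs) p.arrs s s' → I (s.reg y) t s' →
      Q (t + 4) s')
    (hxy : x ≠ y := by decide) (hx : x ∉ p.regs := by decide) (hy : y ∉ p.regs := by decide) :
    Ends (forLoop x y p) s Q := by
  -- Induction on the number `k` of iterations that remain, because `Runs` unfolds a loop from its
  -- first iteration.
  have key : ∀ k i t s', i + k = s.reg y → s'.reg x = i → Agree (x :: p.regs) p.arrs s s' →
      I i t s' → Ends (.loop (.sub (.reg y) (.reg x))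
        (.seq p (.assign x (.add (.reg x) (.const 1))))) s' fun t' s'' => Q (t + t') s'' := by
    intro k
    induction k with
    | zero =>
      intro i t s' hik hi hA hI
      have hy' : s'.reg y = s.reg y := hA.reg y (by simp [hxy.symm, hy])
      refine ⟨_, _, .loop_done (by simp [Expr.val]; omega), ?_⟩
      obtain rfl : i = s.reg y := by omega
      simpa [Expr.cost] using hQ t s' hi hA hI
    | succ k ih =>
      intro i t s' hik hi hA hI
      have hy' : s'.reg y = s.reg y := hA.reg y (by simp [hxy.symm, hy])
      obtain ⟨t₁, s₁, hr₁, hI₁⟩ := hs i t s' (by omega) hi hA hI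
      have hA₁ := hr₁.agree
      have hx₁ : s₁.reg x = i := (hA₁.reg x hx).trans hi
      obtain ⟨t₂, s₂, hr₂, hQ₂⟩ := ih (i + 1) _ (s₁.setReg x (i + 1)) (by omega) (by simp)
        (hA.trans (hA₁.trans (R' := [x]) (A' := []) (s'' := s₁.setReg x (i + 1))
          ⟨fun z hz => by simp at hz; simp [hz], fun _ _ => rfl⟩
          (R'' := x :: p.regs) (A'' := p.arrs) (by simp) (by simp) (by simp) (by simp))
          (by simp) (by simp) (by simp) (by simp)) hI₁
      have hr₃ : Runs (.seq p (.assign x (.add (.reg x) (.const 1)))) s' (t₁ + 4)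
          (s₁.setReg x (i + 1)) := by
        have := Runs.assign s₁ x (.add (.reg x) (.const 1))
        simp only [Expr.val, hx₁, Expr.cost] at this
        exact .seq hr₁ this
      -- Besides its body an iteration pays 4 for the test and 4 for the increment, hence the
      -- constant 8. Clearing the counter costs 2 and the final failing test 4.
      refine ⟨_, _, .loop_step (by simp [Expr.val]; omega) hr₃ hr₂, ?_⟩
      convert hQ₂ using 1
      simp [Expr.cost]
      omega
  rw [forLoop, seq_iff, assign_iff]
  refine key (s.reg y) 0 2 _ (by omega) (by simp [Expr.val]) ⟨?_, fun _ _ => rfl⟩ (by simpa [Expr.val] using h0)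
  intro z hz
  simp at hz
  simp [hz.1]

/-- The loop rule without step count. -/
theorem forLoop (I : ℕ → Mem → Prop)
    (h0 : I 0 (s.setReg x 0))
    (hs : ∀ i s', i < s.reg y → s'.reg x = i → Agree (x :: p.regs) p.arrs s s' → I i s' →
      Ends p s' fun _ s'' => I (i + 1) (s''.setReg x (i + 1)))
    (hQ : ∀ t s', s'.reg x = s.reg y → Agree (x :: p.regs) p.arrs s s' → I (s.reg y) s' → Q t s')
    (hxy : x ≠ y := by decide) (hx : x ∉ p.regs := by decide) (hy : y ∉ p.regs := by decide) :
    Ends (forLoop x y p) s Q :=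
  forLoop_timed (fun i _ => I i) h0 (fun i _ s' => hs i s') (fun _ s' => hQ _ s') hxy hx hy

/-- The loop rule with a bound for the number of steps of every iteration. -/
theorem forLoop_le (I : ℕ → Mem → Prop) (T : ℕ → ℕ)
    (h0 : I 0 (s.setReg x 0))
    (hs : ∀ i s', i < s.reg y → s'.reg x = i → Agree (x :: p.regs) p.arrs s s' → I i s' →
      Ends p s' fun t s'' => t ≤ T i ∧ I (i + 1) (s''.setReg x (i + 1)))
    (hQ : ∀ t s', s'.reg x = s.reg y → Agree (x :: p.regs) p.arrs s s' → I (s.reg y) s' →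
      t ≤ 6 + ∑ i ∈ Finset.range (s.reg y), (T i + 8) → Q t s')
    (hxy : x ≠ y := by decide) (hx : x ∉ p.regs := by decide) (hy : y ∉ p.regs := by decide) :
    Ends (DRDomination.forLoop x y p) s Q := by
  refine forLoop_timed (fun i t s' => I i s' ∧ t ≤ 2 + ∑ j ∈ Finset.range i, (T j + 8))
    ⟨h0, by simp⟩ (fun i t s' hi hx hA hI => ?_) (fun t s' hx hA hI => ?_) hxy hx hy
  · refine (hs i s' hi hx hA hI.1).mono fun t' s'' h => ⟨h.2, ?_⟩
    rw [Finset.sum_range_succ]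
    have := hI.2
    omega
  · exact hQ _ s' hx hA hI.1 (by have := hI.2; omega)

end Ends

/-! ### Boolean expressions -/

open Classical in
/-- The bit of a proposition. -/
noncomputable def bit (P : Prop) : ℕ := if P then 1 else 0

@[simp] theorem bit_eq_zero {P : Prop} : bit P = 0 ↔ ¬ P := by
  unfold bit; split_ifs <;> simp_all

theorem bit_of_true {P : Prop} (h : P) : bit P = 1 := if_pos h

theorem bit_of_false {P : Prop} (h : ¬ P) : bit P = 0 := if_neg h

theorem bit_congr {P Q : Prop} (h : P ↔ Q) : bit P = bit Q := congrArg bit (propext h)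

theorem bit_le_one (P : Prop) : bit P ≤ 1 := by
  unfold bit; split_ifs <;> simp

theorem bit_inj {P Q : Prop} : bit P = bit Q ↔ (P ↔ Q) := by
  unfold bit; split_ifs <;> simp_all

namespace Expr

/-- The bit `e = 0`. -/
def isZero (e : Expr) : Expr := .sub (.const 1) e
/-- The bit `e ≠ 0 ∧ f ≠ 0`. -/
def and (e f : Expr) : Expr := isZero (.add (isZero e) (isZero f))
/-- Non-zero when the values differ. -/
def ne (e f : Expr) : Expr := .add (.sub e f) (.sub f e)
/-- The bit `e = f`. -/
def eq (e f : Expr) : Expr := isZero (ne e f)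
/-- The maximum. -/
def max (e f : Expr) : Expr := .add e (.sub f e)
/-- The minimum. -/
def min (e f : Expr) : Expr := .sub e (.sub e f)

variable (s : Mem) (e f : Expr)

@[simp] theorem val_const (k : ℕ) : (const k).val s = k := rfl
@[simp] theorem val_reg (x : ℕ) : (reg x).val s = s.reg x := rfl
@[simp] theorem val_get (a : ℕ) : (get a e).val s = s.arr a (e.val s) := rfl
@[simp] theorem val_add : (add e f).val s = e.val s + f.val s := rfl
@[simp] theorem val_sub : (sub e f).val s = e.val s - f.val s := rfl

@[simp] theorem val_isZero : (isZero e).val s = bit (e.val s = 0) := by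
  simp only [isZero, val_sub, val_const, bit]; split_ifs <;> omega

@[simp] theorem val_and : (and e f).val s = bit (e.val s ≠ 0 ∧ f.val s ≠ 0) := by
  simp only [and, val_isZero, val_add]; refine bit_congr ?_; simp

@[simp] theorem val_ne_eq_zero : (ne e f).val s = 0 ↔ e.val s = f.val s := by
  simp only [ne, val_add, val_sub]; omega

@[simp] theorem val_eq : (eq e f).val s = bit (e.val s = f.val s) := by
  simp only [eq, val_isZero, val_ne_eq_zero]

@[simp] theorem val_max : (max e f).val s = Max.max (e.val s) (f.val s) := by
  simp only [max, val_add, val_sub]; omega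

@[simp] theorem val_min : (min e f).val s = Min.min (e.val s) (f.val s) := by
  simp only [min, val_sub]; omega

end Expr

/-- `z := 1` if `b` is non-zero for some value of `x` below `y`, and `z := 0` otherwise. -/
def anyLoop (z x y : ℕ) (b : Expr) : Cmd :=
  .seq (.assign z (.const 0)) (forLoop x y (.cond b (.assign z (.const 1)) .skip))

/-- A bounded existential quantifier as a loop. The test has to reflect `P` only in memories that
differ from the initial one in `z` and `x`, so it may read everything else. -/
theorem Ends.anyLoop {z x y : ℕ} {b : Expr} {s : Mem} {Q : ℕ → Mem → Prop} (P : ℕ → Prop)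
    (hb : ∀ i s', i < s.reg y → s'.reg x = i → Agree [z, x] [] s s' → (b.val s' ≠ 0 ↔ P i))
    (hQ : ∀ t s', Agree [z, x] [] s s' → s'.reg z = bit (∃ i < s.reg y, P i) → Q t s')
    (hxy : x ≠ y := by decide) (hxz : x ≠ z := by decide) (hyz : y ≠ z := by decide) :
    Ends (anyLoop z x y b) s Q := by
  rw [DRDomination.anyLoop, Ends.seq_iff, Ends.assign_iff]
  simp only [Expr.val]
  have hAg : ∀ {s'}, Agree [x, z] [] (s.setReg z 0) s' → Agree [z, x] [] s s' := fun h =>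
    Agree.trans (R := [z]) (A := []) (s' := s.setReg z 0) ⟨fun w hw => by simp_all, fun _ _ => rfl⟩
      h (by simp) (by simp) (by simp) (by simp)
  refine Ends.forLoop (fun i s' => s'.reg z = bit (∃ j < i, P j)) ?_ ?_ ?_ hxy ?_ ?_
  · simp [hxz.symm, bit_of_false]
  · intro i s' hi hx hA hI
    simp only [Mem.setReg_reg, if_neg hyz] at hi
    have := hb i s' hi hx (hAg hA)
    simp only [Ends.cond_iff, Ends.assign_iff, Ends.skip_iff, this, Expr.val, Mem.setReg_reg,
      if_neg hxz.symm, if_true]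
    have e : (∃ j < i + 1, P j) ↔ (∃ j < i, P j) ∨ P i := by
      constructor
      · rintro ⟨j, hj, h⟩
        rcases Nat.lt_succ_iff_lt_or_eq.1 hj with h' | rfl
        · exact .inl ⟨j, h', h⟩
        · exact .inr h
      · rintro (⟨j, hj, h⟩ | h)
        · exact ⟨j, by omega, h⟩
        · exact ⟨i, by omega, h⟩
    constructor
    · intro h; simp only [e, h, or_true, bit_of_true]
    · intro h
      have : ¬ P i := fun h' => this.2 h' h
      simp only [e, this, or_false, hI]
  · intro t s' hx hA hI
    simp only [Mem.setReg_reg, if_neg hyz] at hI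
    exact hQ _ _ (hAg hA) hI
  · simp [Cmd.regs, hxz]
  · simp [Cmd.regs, hyz]

/-! ### Programs with polynomially bounded running time -/

/-- Programs in which every loop runs up to a register from `Y`, and these are never written. -/
inductive Bounded (Y : List ℕ) : Cmd → Prop
  | skip : Bounded Y .skip
  | assign {x : ℕ} {e : Expr} (hx : x ∉ Y) : Bounded Y (.assign x e)
  | write {a : ℕ} {i e : Expr} : Bounded Y (.write a i e)
  | seq {p q : Cmd} (hp : Bounded Y p) (hq : Bounded Y q) : Bounded Y (.seq p q)
  | cond {b : Expr} {p q : Cmd} (hp : Bounded Y p) (hq : Bounded Y q) : Bounded Y (.cond b p q)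
  | iterate {x y : ℕ} {p : Cmd} (hy : y ∈ Y) (hx : x ∉ Y) (hxp : x ∉ p.regs) (hp : Bounded Y p) :
      Bounded Y (forLoop x y p)

theorem Bounded.any {Y : List ℕ} {z x y : ℕ} {b : Expr} (hy : y ∈ Y) (hx : x ∉ Y) (hz : z ∉ Y)
    (hxz : x ≠ z) : Bounded Y (anyLoop z x y b) :=
  .seq (.assign hz) (.iterate hy hx (by simp [Cmd.regs, hxz]) (.cond (.assign hz) .skip))

theorem Bounded.not_mem {Y : List ℕ} {c : Cmd} (h : Bounded Y c) {y : ℕ} (hy : y ∈ Y) :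
    y ∉ c.regs := by
  induction h with
  | skip | write => simp [Cmd.regs]
  | assign hx => simp only [Cmd.regs, List.mem_singleton]; rintro rfl; exact hx hy
  | seq _ _ h₁ h₂ | cond _ _ h₁ h₂ => simp [Cmd.regs, h₁, h₂]
  | @iterate x _ _ _ hx _ _ h₁ =>
    have : y ≠ x := by rintro rfl; exact hx hy
    simp [forLoop, Cmd.regs, h₁, this]

/-- Structural induction: a body that costs at most `K * b ^ D` and is repeated at most `b` times
costs one more power of `b`. The bounds on the registers in `Y` persist since these registers are
never written. -/
theorem Bounded.time {Y : List ℕ} {c : Cmd} (h : Bounded Y c) :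
    ∃ K D : ℕ, ∀ (b : ℕ) (s : Mem), 1 ≤ b → (∀ y ∈ Y, s.reg y ≤ b) →
      Ends c s fun t _ => t ≤ K * b ^ D := by
  have le_pow : ∀ {b D : ℕ} (k : ℕ), 1 ≤ b → k ≤ k * b ^ D := fun k hb =>
    Nat.le_mul_of_pos_right _ (Nat.pow_pos hb)
  have keep : ∀ {c : Cmd} {s s' : Mem} {b : ℕ}, Bounded Y c → Agree c.regs c.arrs s s' →
      (∀ y ∈ Y, s.reg y ≤ b) → ∀ y ∈ Y, s'.reg y ≤ b := fun hc hA hs y hy => by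
    rw [hA.reg y (hc.not_mem hy)]; exact hs y hy
  have le_K : ∀ {K K' D D' b : ℕ}, 1 ≤ b →
      K * b ^ D + K' * b ^ D' ≤ (K + K') * b ^ (D + D') := fun {K K' D D' b} hb => by
    rw [add_mul]
    exact Nat.add_le_add (Nat.mul_le_mul_left _ (Nat.pow_le_pow_right hb (by omega)))
      (Nat.mul_le_mul_left _ (Nat.pow_le_pow_right hb (by omega)))
  induction h with
  | skip => exact ⟨1, 0, fun b s hb hs => Ends.skip_iff.2 (by simp)⟩
  | @assign x e hx => exact ⟨e.cost + 1, 0, fun b s hb hs => Ends.assign_iff.2 (by simp)⟩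
  | @write a i e => exact ⟨i.cost + e.cost + 1, 0, fun b s hb hs => Ends.write_iff.2 (by simp)⟩
  | seq hp hq ih₁ ih₂ =>
    obtain ⟨K₁, D₁, h₁⟩ := ih₁
    obtain ⟨K₂, D₂, h₂⟩ := ih₂
    refine ⟨K₁ + K₂, D₁ + D₂, fun b s hb hs => Ends.seq_iff.2 ?_⟩
    refine (h₁ b s hb hs).conseq fun t s' hA ht => (h₂ b s' hb (keep hp hA hs)).mono ?_
    intro t' _ ht'
    exact (Nat.add_le_add ht ht').trans (le_K hb)
  | @cond e p q hp hq ih₁ ih₂ =>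
    obtain ⟨K₁, D₁, h₁⟩ := ih₁
    obtain ⟨K₂, D₂, h₂⟩ := ih₂
    refine ⟨(e.cost + 1) + (K₁ + K₂), D₁ + D₂, fun b s hb hs => Ends.cond_iff.2 ⟨?_, ?_⟩⟩
    · refine fun _ => (h₁ b s hb hs).mono fun t _ ht => ?_
      rw [add_mul]
      exact Nat.add_le_add (le_pow _ hb) ((ht.trans (Nat.le_add_right _ _)).trans (le_K hb))
    · refine fun _ => (h₂ b s hb hs).mono fun t _ ht => ?_
      rw [add_mul]
      exact Nat.add_le_add (le_pow _ hb) ((ht.trans (Nat.le_add_left _ _)).trans (le_K hb))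
  | @iterate x y p hy hx hxp hp ih =>
    obtain ⟨K, D, h⟩ := ih
    refine ⟨6 + (K + 8), D + 1, fun b s hb hs => ?_⟩
    refine Ends.forLoop_le (fun _ _ => True) (fun _ => K * b ^ D) trivial ?_ ?_ ?_ hxp
      (hp.not_mem hy)
    · intro i s' _ _ hA _
      refine (h b s' hb fun z hz => ?_).mono fun t _ ht => ⟨ht, trivial⟩
      rw [hA.reg z]
      · exact hs z hz
      · simp only [List.mem_cons, not_or]
        exact ⟨by rintro rfl; exact hx hz, hp.not_mem hz⟩
    · intro t s' _ _ _ ht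
      refine ht.trans ?_
      simp only [Finset.sum_const, Finset.card_range, smul_eq_mul]
      rw [add_mul]
      refine Nat.add_le_add (le_pow _ hb) ?_
      calc s.reg y * (K * b ^ D + 8) ≤ b * ((K + 8) * b ^ D) := by
            refine Nat.mul_le_mul (hs y hy) ?_
            rw [add_mul]
            exact Nat.add_le_add_left (le_pow _ hb) _
        _ = (K + 8) * b ^ (D + 1) := by ring
    · rintro rfl; exact hx hy

/-- A program that is correct and has polynomially bounded running time. -/
theorem Ends.and_time {c : Cmd} {s : Mem} {Q Q' : ℕ → Mem → Prop} (h : Ends c s Q)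
    (h' : Ends c s Q') : Ends c s fun t s' => Q t s' ∧ Q' t s' := by
  obtain ⟨t, s₁, hr, hq⟩ := h
  obtain ⟨t', s₂, hr', hq'⟩ := h'
  -- Determinism identifies the runs behind two separately proved specifications.
  obtain ⟨rfl, rfl⟩ := hr.det hr'
  exact ⟨t, s₁, hr, hq, hq'⟩


/-! ### Decompositions into uniform classes -/

/-- Different classes of the colouring `col` of `X` are completely joined or not joined at all. -/
def Uniform {V ι : Type*} (A : V → V → Prop) (X : Set V) (col : V → ι) : Prop :=
  ∀ x ∈ X, ∀ x' ∈ X, ∀ y ∈ X, ∀ y' ∈ X, col x = col x' → col y = col y' → col x ≠ col y →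
    (A x y ↔ A x' y')

/-- The vertex set `X` can be decomposed recursively into at most `w` uniform classes. -/
inductive Dec {V : Type*} (w : ℕ) (A : V → V → Prop) : Set V → Prop
  | small {X : Set V} (h : X.Subsingleton) : Dec w A X
  | node {X : Set V} {l : ℕ} (hl : l ≤ w) (col : V → Fin l) (hu : Uniform A X col)
      (h : ∀ i, Dec w A {x ∈ X | col x = i}) : Dec w A X

/-! ### Closure properties of decompositions. -/

namespace Dec

variable {V : Type*} {w : ℕ} {A : V → V → Prop} {X Y : Set V}

/-- A uniform colouring stays uniform on a subset, so the same recursion works. This is what frees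
the algorithm to choose its own splits: every vertex set it meets is still decomposable with width
`w`. -/
theorem subset (h : Dec w A X) (hYX : Y ⊆ X) : Dec w A Y := by
  induction h generalizing Y with
  | small h => exact .small (h.anti hYX)
  | node hl col hu _ ih =>
    refine .node hl col (fun x hx x' hx' y hy y' hy' => hu x (hYX hx) x' (hYX hx') y (hYX hy) y'
      (hYX hy')) fun i => ih i fun x hx => ⟨hYX hx.1, hx.2⟩

/-- Split off one vertex at a time: it is joined to all the others, so two colours suffice. -/
theorem clique (hw : 2 ≤ w) (hX : X.Finite) (h : ∀ x ∈ X, ∀ y ∈ X, x ≠ y → A x y) :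
    Dec w A X := by
  classical
  induction X, hX using Set.Finite.induction_on with
  | empty => exact .small Set.subsingleton_empty
  | @insert a X ha _ ih =>
    refine .node hw (fun x => if x = a then 0 else 1) ?_ fun i => ?_
    · intro x hx x' hx' y hy y' hy' hxx hyy hxy
      refine iff_of_true (h x hx y hy fun e => hxy (by rw [e])) (h x' hx' y' hy' fun e => hxy ?_)
      rw [hxx, hyy, e]
    · have ih' := ih fun x hx y hy => h x (Set.mem_insert_of_mem _ hx) y (Set.mem_insert_of_mem _ hy)
      by_cases hi : i = 0
      · refine .small fun x hx y hy => ?_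
        obtain ⟨_, hx⟩ := hx
        obtain ⟨_, hy⟩ := hy
        by_contra hne
        by_cases h1 : x = a <;> by_cases h2 : y = a <;> simp_all
      · refine ih'.subset fun x hx => ?_
        obtain ⟨hx1, hx2⟩ := hx
        rcases hx1 with rfl | hx1
        · simp at hx2; exact absurd hx2.symm hi
        · exact hx1

end Dec

/-! ### From parse trees to decompositions. -/

theorem ParseTree.two_le_width (T : ParseTree) : 2 ≤ T.width := by
  induction T with
  | vertex => exact le_rfl
  | union A B ih _ => exact ih.trans (le_max_left _ _)
  | join A B ih _ => exact ih.trans (le_max_left _ _)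
  | subst l hl H A _ => exact hl.trans (le_max_left _ _)

/-- The two sides are the colour classes. The union of two graphs is the case where `b` is false,
the join the case where `b` is true. -/
theorem Dec.sum {V α β : Type*} {A : V → V → Prop} {w : ℕ} (hw : 2 ≤ w) {e : α ⊕ β → V}
    (he : Function.Injective e) (b : Prop) (h : ∀ x y, A (e (.inl x)) (e (.inr y)) ↔ b)
    (h' : ∀ x y, A (e (.inr y)) (e (.inl x)) ↔ b) (hS : Dec w A (Set.range fun a => e (.inl a)))
    (hT : Dec w A (Set.range fun a => e (.inr a))) : Dec w A (Set.range e) := by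
  classical
  refine .node hw (fun x => if ∃ a, e (.inl a) = x then 0 else 1) ?_ fun i => ?_
  · rintro _ ⟨x, rfl⟩ _ ⟨x', rfl⟩ _ ⟨y, rfl⟩ _ ⟨y', rfl⟩
    rcases x with x | x <;> rcases x' with x' | x' <;> rcases y with y | y <;>
      rcases y' with y' | y' <;> simp [he.eq_iff, h, h']
  · by_cases hi : i = 0
    · refine hS.subset ?_
      rintro _ ⟨⟨x | x, rfl⟩, hx⟩
      · exact ⟨x, rfl⟩
      · simp [he.eq_iff, hi] at hx
    · refine hT.subset ?_
      rintro _ ⟨⟨x | x, rfl⟩, hx⟩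
      · simp [he.eq_iff] at hx; exact absurd hx.symm hi
      · exact ⟨x, rfl⟩

theorem Dec.sigma {V : Type*} {A : V → V → Prop} {w l : ℕ} (hl : l ≤ w) {B : Fin l → Type*}
    {e : (Σ i, B i) → V} (he : Function.Injective e) {H : SimpleGraph (Fin l)}
    (h : ∀ i j x y, i ≠ j → (A (e ⟨i, x⟩) (e ⟨j, y⟩) ↔ H.Adj i j))
    (hS : ∀ i, Dec w A (Set.range fun a => e ⟨i, a⟩)) : Dec w A (Set.range e) := by
  classical
  rcases Nat.eq_zero_or_pos l with rfl | hl0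
  · refine .small ?_
    rintro _ ⟨⟨i, _⟩, _⟩
    exact i.elim0
  have col : ∃ col : V → Fin l, ∀ i a, col (e ⟨i, a⟩) = i := by
    refine ⟨fun x => if h : ∃ p, e p = x then h.choose.1 else ⟨0, hl0⟩, fun i a => ?_⟩
    have hp : ∃ p, e p = e ⟨i, a⟩ := ⟨_, rfl⟩
    simp only [dif_pos hp]
    rw [he hp.choose_spec]
  obtain ⟨col, hcol⟩ := col
  refine .node hl col ?_ fun i => ?_
  · rintro _ ⟨⟨i, x⟩, rfl⟩ _ ⟨⟨i', x'⟩, rfl⟩ _ ⟨⟨j, y⟩, rfl⟩ _ ⟨⟨j', y'⟩, rfl⟩ hxx hyy hxy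
    rw [hcol, hcol] at hxx hyy hxy
    subst hxx hyy
    rw [h _ _ _ _ hxy, h _ _ _ _ hxy]
  · refine (hS i).subset ?_
    rintro _ ⟨⟨⟨j, x⟩, rfl⟩, hx⟩
    rw [hcol] at hx
    subst hx
    exact ⟨x, rfl⟩

/-- The embedding `e` places all subtrees in one vertex type with one relation, so that the
induction hypotheses speak of subsets of the range of `e`. -/
theorem ParseTree.dec {V : Type*} {A : V → V → Prop} {w : ℕ} (T : ParseTree) (hw : T.width ≤ w)
    (e : T.Vert → V) (he : Function.Injective e) (h : ∀ u v, T.Adj u v ↔ A (e u) (e v)) :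
    Dec w A (Set.range e) := by
  induction T with
  | vertex =>
    refine .small ?_
    rintro _ ⟨u, rfl⟩ _ ⟨v, rfl⟩
    exact congrArg e (Subsingleton.elim (α := Unit) u v)
  | union S T ihS ihT =>
    refine Dec.sum ((two_le_width _).trans hw) (α := S.Vert) (β := T.Vert) (e := e) he False
      (fun x y => (h (Sum.inl x) (Sum.inr y)).symm) (fun x y => (h (Sum.inr y) (Sum.inl x)).symm)
      (ihS ((le_max_left _ _).trans hw) _ (fun a b hab => Sum.inl_injective (he hab))
        fun u v => h (Sum.inl u) (Sum.inl v))
      (ihT ((le_max_right _ _).trans hw) _ (fun a b hab => Sum.inr_injective (he hab))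
        fun u v => h (Sum.inr u) (Sum.inr v))
  | join S T ihS ihT =>
    refine Dec.sum ((two_le_width _).trans hw) (α := S.Vert) (β := T.Vert) (e := e) he True
      (fun x y => (h (Sum.inl x) (Sum.inr y)).symm) (fun x y => (h (Sum.inr y) (Sum.inl x)).symm)
      (ihS ((le_max_left _ _).trans hw) _ (fun a b hab => Sum.inl_injective (he hab))
        fun u v => h (Sum.inl u) (Sum.inl v))
      (ihT ((le_max_right _ _).trans hw) _ (fun a b hab => Sum.inr_injective (he hab))
        fun u v => h (Sum.inr u) (Sum.inr v))
  | subst l hl H S ih =>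
    have hAdj : ∀ i j x y, (A (e (⟨i, x⟩ : Σ i, (S i).Vert)) (e (⟨j, y⟩ : Σ i, (S i).Vert)) ↔
        H.Adj i j ∨ ∃ h : i = j, (S j).Adj (h ▸ x) y) :=
      fun i j x y => (h (⟨i, x⟩ : Σ i, (S i).Vert) (⟨j, y⟩ : Σ i, (S i).Vert)).symm
    refine Dec.sigma ((le_max_left _ _).trans hw) (B := fun i => (S i).Vert) (e := e) he (H := H)
      (fun i j x y hij => ?_) fun i => ih i ?_ _ (fun a b hab => ?_) fun u v => ?_
    · simp [hAdj, hij]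
    · exact (Finset.le_sup (f := fun i => (S i).width) (Finset.mem_univ i)).trans
        ((le_max_right _ _).trans hw)
    · exact sigma_mk_injective (β := fun i => (S i).Vert) (he hab)
    · simp [hAdj]

/-- Every non-empty finite graph has a parse tree. -/
theorem exists_constructs {n : ℕ} (hn : 0 < n) (G : SimpleGraph (Fin n)) :
    ∃ T : ParseTree, T.Constructs G := by
  rcases Nat.lt_or_ge n 2 with h | h
  · obtain rfl : n = 1 := by omega
    refine ⟨.vertex, ⟨fun _ => 0, fun _ => (), fun _ => rfl, fun _ => Subsingleton.elim _ _⟩, ?_⟩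
    intro u v
    exact iff_of_false (fun h => h) (fun h => G.irrefl h)
  -- The graph is its own outline graph, with a single vertex substituted for each vertex. Outline
  -- graphs need two vertices, which is why `n = 1` is treated separately.
  · refine ⟨.subst n h G fun _ => .vertex, ⟨fun p => p.1, fun i => ⟨i, ()⟩, fun _ => rfl,
      fun _ => rfl⟩, ?_⟩
    rintro ⟨i, _⟩ ⟨j, _⟩
    exact ⟨fun h => h.elim id fun ⟨_, h⟩ => h.elim, .inl⟩

theorem exists_width_eq {n : ℕ} (hn : 0 < n) (G : SimpleGraph (Fin n)) :
    ∃ T : ParseTree, T.Constructs G ∧ T.width = modularWidth G := by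
  obtain ⟨T, hT⟩ := exists_constructs hn G
  exact Nat.sInf_mem (s := {w | ∃ T : ParseTree, T.Constructs G ∧ T.width = w}) ⟨_, T, hT, rfl⟩

theorem two_le_modularWidth {n : ℕ} (hn : 0 < n) (G : SimpleGraph (Fin n)) :
    2 ≤ modularWidth G := by
  obtain ⟨T, -, hT⟩ := exists_width_eq hn G
  exact hT ▸ T.two_le_width

theorem dec_univ {n : ℕ} (hn : 0 < n) (G : SimpleGraph (Fin n)) :
    Dec (modularWidth G) G.Adj Set.univ := by
  obtain ⟨T, ⟨e, he⟩, hT⟩ := exists_width_eq hn G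
  exact (T.dec hT.le e e.injective he).subset (by simp)

/-! ### Powers of a graph -/

/-- Adjacency in the `r`-th power. -/
def PowAdj {V : Type*} (G : SimpleGraph V) (r : ℕ) (u v : V) : Prop :=
  u ≠ v ∧ G.edist u v ≤ (r : ℕ∞)

theorem PowAdj.symm {V : Type*} {G : SimpleGraph V} {r : ℕ} {u v : V} (h : PowAdj G r u v) :
    PowAdj G r v u := ⟨h.1.symm, by rw [SimpleGraph.edist_comm]; exact h.2⟩

theorem edist_le_iff {V : Type*} {G : SimpleGraph V} {u v : V} {r : ℕ} :
    G.edist u v ≤ (r : ℕ∞) ↔ ∃ p : G.Walk u v, p.length ≤ r := by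
  constructor
  · intro h
    have hne : G.edist u v ≠ ⊤ := ne_top_of_le_ne_top (ENat.natCast_ne_top r) h
    obtain ⟨p, hp⟩ := SimpleGraph.exists_walk_of_edist_ne_top hne
    exact ⟨p, by rw [← hp] at h; exact_mod_cast h⟩
  · rintro ⟨p, hp⟩
    exact (SimpleGraph.edist_le p).trans (by exact_mod_cast hp)

/-- A walk that leaves a class `{x ∈ X | col x = i}` may start anywhere in this class. -/
theorem exists_walk_of_uniform {V ι : Type*} {G : SimpleGraph V} {X : Set V} {col : V → ι}
    (hu : Uniform G.Adj X col) (hX : ∀ x ∈ X, ∀ y, G.Adj x y → y ∈ X) {u v : V} (p : G.Walk u v) :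
    ∀ u' ∈ X, u ∈ X → col u' = col u → col v ≠ col u → ∃ q : G.Walk u' v, q.length ≤ p.length := by
  induction p with
  | nil => intro u' _ _ _ h; exact absurd rfl h
  | @cons u y v huy p ih =>
    intro u' hu' hu'' hc hv
    by_cases hy : col y = col u
    -- The first step stays in the class: drop it and move the start of the remaining walk to `u'`.
    · obtain ⟨q, hq⟩ := ih u' hu' (hX _ hu'' _ huy) (hc.trans hy.symm) (by rwa [hy])
      exact ⟨q, by simp; omega⟩
    · have : G.Adj u' y :=
        (hu u hu'' u' hu' y (hX _ hu'' _ huy) y (hX _ hu'' _ huy) hc.symm rfl (Ne.symm hy)).1 huy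
      exact ⟨.cons this p, by simp⟩

/-- Because `X` is closed under adjacency, walks do not leave it and `exists_walk_of_uniform`
applies at both ends, so the colouring is uniform for the power as well. A class that is closed
under adjacency is handled by induction. In any other class one vertex has a neighbour outside, and
by uniformity this neighbour is common to the whole class: for `r ≥ 2` the class is a clique of the
power, and for `r = 1` the power is the graph itself. -/
theorem Dec.pow {n w r : ℕ} (hw : 2 ≤ w) (hr : 0 < r) {G : SimpleGraph (Fin n)} {X : Set (Fin n)}
    (h : Dec w G.Adj X) (hX : ∀ x ∈ X, ∀ y, G.Adj x y → y ∈ X) : Dec w (PowAdj G r) X := by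
  induction h with
  | small h => exact .small h
  | @node X l hl col hu hcl ih =>
    have half : ∀ x ∈ X, ∀ x' ∈ X, ∀ y, col x = col x' → col x ≠ col y → PowAdj G r x y →
        PowAdj G r x' y := by
      intro x hx x' hx' y hxx hxy h
      refine ⟨fun e => hxy (by rw [hxx, e]), ?_⟩
      obtain ⟨p, hp⟩ := edist_le_iff.1 h.2
      obtain ⟨q, hq⟩ := exists_walk_of_uniform hu hX p x' hx' hx hxx.symm hxy.symm
      exact edist_le_iff.2 ⟨q, hq.trans hp⟩
    have full : ∀ x ∈ X, ∀ x' ∈ X, ∀ y ∈ X, ∀ y' ∈ X, col x = col x' → col y = col y' →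
        col x ≠ col y → PowAdj G r x y → PowAdj G r x' y' := by
      intro x hx x' hx' y hy y' hy' hxx hyy hxy h
      have h1 := half x hx x' hx' y hxx hxy h
      exact (half y hy y' hy' x' hyy (by rw [← hxx]; exact hxy.symm) h1.symm).symm
    refine .node hl col ?_ fun i => ?_
    · intro x hx x' hx' y hy y' hy' hxx hyy hxy
      refine ⟨full x hx x' hx' y hy y' hy' hxx hyy hxy,
        full x' hx' x hx y' hy' y hy hxx.symm hyy.symm ?_⟩
      rw [← hxx, ← hyy]; exact hxy
    · by_cases hcl' : ∀ x ∈ {x ∈ X | col x = i}, ∀ y, G.Adj x y → y ∈ {x ∈ X | col x = i}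
      · exact ih i hcl'
      · push Not at hcl'
        obtain ⟨x, ⟨hx, hxi⟩, y, hxy, hy⟩ := hcl'
        have hyX := hX x hx y hxy
        have hyi : col y ≠ i := fun e => hy ⟨hyX, e⟩
        have hadj : ∀ u ∈ X, col u = i → G.Adj u y := fun u hu' hui =>
          (hu x hx u hu' y hyX y hyX (hxi.trans hui.symm) rfl (by rw [hxi]; exact hyi.symm)).1 hxy
        rcases Nat.lt_or_ge r 2 with hr2 | hr2
        · have e : PowAdj G r = G.Adj := by
            obtain rfl : r = 1 := by omega
            funext u v
            refine propext ⟨fun ⟨hne, h⟩ => ?_, fun h => ⟨h.ne, ?_⟩⟩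
            · obtain ⟨p, hp⟩ := edist_le_iff.1 h
              have : p.length ≠ 0 := fun h0 => hne (SimpleGraph.Walk.eq_of_length_eq_zero h0)
              exact SimpleGraph.Walk.adj_of_length_eq_one (p := p) (by omega)
            · exact edist_le_iff.2 ⟨h.toWalk, by simp⟩
          rw [e]; exact hcl i
        · refine .clique hw (Set.toFinite _) ?_
          rintro u ⟨hu1, hu2⟩ v ⟨hv1, hv2⟩ hne
          refine ⟨hne, edist_le_iff.2 ⟨.cons (hadj u hu1 hu2) (.cons (hadj v hv1 hv2).symm .nil), ?_⟩⟩
          simpa using hr2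

theorem dec_powAdj {n r : ℕ} (hn : 0 < n) (hr : 0 < r) (G : SimpleGraph (Fin n)) :
    Dec (modularWidth G) (PowAdj G r) Set.univ :=
  (dec_univ hn G).pow (two_le_modularWidth hn G) hr (by simp)

/-- In a graph with `n` vertices the `n`-th power is the largest one. -/
theorem exists_walk_length_le_min {n r k : ℕ} (hk : n ≤ k) {G : SimpleGraph (Fin n)} {u v : Fin n} :
    (∃ p : G.Walk u v, p.length ≤ min r k) ↔ G.edist u v ≤ (r : ℕ∞) := by
  classical
  rw [edist_le_iff]
  constructor
  · rintro ⟨p, hp⟩; exact ⟨p, hp.trans (min_le_left _ _)⟩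
  · rintro ⟨p, hp⟩
    -- A path repeats no vertex, so it has fewer than `n` edges.
    refine ⟨p.toPath, le_min ((SimpleGraph.Walk.length_bypass_le_length p).trans hp) ?_⟩
    have := p.toPath.2.length_lt
    simp at this
    omega

/-! ### Modules -/

section Modules

variable {V : Type*} {A : V → V → Prop} {M X Y : Set V}

/-- `X` is closed in `M` for the reference `ref`: the vertices of `M` outside `X` are adjacent to
the vertices of `X` as prescribed by `ref`. -/
def IsClosedFor (A : V → V → Prop) (M : Set V) (ref : V → Prop) (X : Set V) : Prop :=
  ∀ x ∈ M, x ∉ X → ∀ u ∈ X, (A x u ↔ ref x)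

/-- `X` is a module of the subgraph induced by `M`. -/
def IsModule (A : V → V → Prop) (M X : Set V) : Prop :=
  X ⊆ M ∧ ∀ x ∈ M, x ∉ X → ∀ u ∈ X, ∀ v ∈ X, (A x u ↔ A x v)

theorem IsClosedFor.isModule {ref : V → Prop} (h : IsClosedFor A M ref X) (hX : X ⊆ M) :
    IsModule A M X :=
  ⟨hX, fun x hx hxX u hu v hv => (h x hx hxX u hu).trans (h x hx hxX v hv).symm⟩

theorem IsModule.isClosedFor {y : V} (h : IsModule A M X) (hy : y ∈ X) :
    IsClosedFor A M (fun x => A x y) X := fun x hx hxX u hu => h.2 x hx hxX u hu y hy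

/-- `M` has no decomposition into two parts which are completely joined or not joined at all. -/
def NoBipartition (A : V → V → Prop) (M : Set V) : Prop :=
  ∀ (b : Prop) (X : Set V), X ⊆ M → X.Nonempty → IsClosedFor A M (fun _ => b) X → X = M

/-- By symmetry of `A` the complement of a closed set is closed for the same constant, so only the
side containing `v` has to be examined. -/
theorem noBipartition_of_mem (hA : ∀ x y, A x y → A y x) {v : V} (hv : v ∈ M)
    (h : ∀ (b : Prop) (X : Set V), X ⊆ M → v ∈ X → IsClosedFor A M (fun _ => b) X → X = M) :
    NoBipartition A M := by
  intro b X hX hne hc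
  by_cases hvX : v ∈ X
  · exact h b X hX hvX hc
  · exfalso
    have : M \ X = M := by
      refine h b _ Set.sdiff_subset ⟨hv, hvX⟩ fun x hx hxX u hu => ?_
      have hx' : x ∈ X := by_contra fun h => hxX ⟨hx, h⟩
      have := hc u hu.1 hu.2 x hx'
      exact ⟨fun h => this.1 (hA _ _ h), fun h => hA _ _ (this.2 h)⟩
    obtain ⟨x, hx⟩ := hne
    exact (this.symm ▸ hX hx : x ∈ M \ X).2 hx

/-- The point is that the union is proper. If `X ∪ Y = M`, then vertices outside `Y` lie in `X` and
vertices outside `X` lie in `Y`. Moving one end inside `Y` and the other inside `X` shows that all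
pairs between `M \ Y` and `Y` behave like the single pair `x0`, `y0`, which is a bipartition. -/
theorem IsModule.union (hA : ∀ x y, A x y → A y x) (hM : NoBipartition A M) (hX : IsModule A M X)
    (hY : IsModule A M Y) (hXM : X ≠ M) (hYM : Y ≠ M) (hXY : (X ∩ Y).Nonempty) :
    IsModule A M (X ∪ Y) ∧ X ∪ Y ≠ M := by
  have hA' : ∀ x y, A x y ↔ A y x := fun x y => ⟨hA x y, hA y x⟩
  obtain ⟨z, hzX, hzY⟩ := hXY
  constructor
  · refine ⟨Set.union_subset hX.1 hY.1, fun x hx hxX u hu v hv => ?_⟩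
    have hx1 : x ∉ X := fun h => hxX (.inl h)
    have hx2 : x ∉ Y := fun h => hxX (.inr h)
    have key : ∀ u ∈ X ∪ Y, (A x u ↔ A x z) := by
      rintro u (hu | hu)
      · exact hX.2 x hx hx1 u hu z hzX
      · exact hY.2 x hx hx2 u hu z hzY
    exact (key u hu).trans (key v hv).symm
  · intro hU
    have hx0 : ∃ x ∈ M, x ∉ Y := by
      by_contra h; push Not at h; exact hYM (hY.1.antisymm h)
    have hy0 : ∃ x ∈ M, x ∉ X := by
      by_contra h; push Not at h; exact hXM (hX.1.antisymm h)
    have hmem : ∀ x ∈ M, x ∉ Y → x ∈ X := fun x hx h => by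
      rw [← hU] at hx; exact hx.resolve_right h
    obtain ⟨x0, hx0, hx0Y⟩ := hx0
    obtain ⟨y0, hy0, hy0X⟩ := hy0
    have hy0Y : y0 ∈ Y := by rw [← hU] at hy0; exact hy0.resolve_left hy0X
    refine hYM (hM (A x0 y0) Y hY.1 ⟨z, hzY⟩ fun x hx hxY u hu => ?_)
    rw [hY.2 x hx hxY u hu y0 hy0Y, hA' x, hA' x0]
    exact hX.2 y0 hy0 hy0X x (hmem x hx hxY) x0 (hmem x0 hx0 hx0Y)

/-- Two vertices lie in a proper module of `M`. -/
def SameModule (A : V → V → Prop) (M : Set V) (x y : V) : Prop :=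
  ∃ X, IsModule A M X ∧ X ≠ M ∧ x ∈ X ∧ y ∈ X

theorem SameModule.symm {x y : V} (h : SameModule A M x y) : SameModule A M y x := by
  obtain ⟨X, h1, h2, h3, h4⟩ := h
  exact ⟨X, h1, h2, h4, h3⟩

theorem SameModule.trans (hA : ∀ x y, A x y → A y x) (hM : NoBipartition A M) {x y z : V}
    (h : SameModule A M x y) (h' : SameModule A M y z) : SameModule A M x z := by
  obtain ⟨X, h1, h2, h3, h4⟩ := h
  obtain ⟨Y, h1', h2', h3', h4'⟩ := h'
  obtain ⟨h5, h6⟩ := h1.union hA hM h1' h2 h2' ⟨y, h4, h3'⟩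
  exact ⟨_, h5, h6, .inl h3, .inr h4'⟩

theorem sameModule_self {x : V} (hx : x ∈ M) (hM : M.Nontrivial) : SameModule A M x x := by
  refine ⟨{x}, ⟨by simpa using hx, fun y hy hyX u hu v hv => ?_⟩, ?_, rfl, rfl⟩
  · rw [Set.mem_singleton_iff.1 hu, Set.mem_singleton_iff.1 hv]
  · rintro rfl; exact Set.not_nontrivial_singleton hM

/-- A maximal proper module through `x` absorbs, by `IsModule.union`, every vertex that shares a
proper module with `x`. If these were all vertices, it would not be proper. This guarantees that a
node is split into at least two classes. -/
theorem exists_not_sameModule (hA : ∀ x y, A x y → A y x) (hM : NoBipartition A M) (hf : M.Finite)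
    (hn : M.Nontrivial) {x : V} (hx : x ∈ M) : ∃ y ∈ M, ¬ SameModule A M x y := by
  by_contra hall
  push Not at hall
  have hfin : {X : Set V | IsModule A M X ∧ X ≠ M ∧ x ∈ X}.Finite :=
    hf.finite_subsets.subset fun X hX => hX.1.1
  have hne : {X : Set V | IsModule A M X ∧ X ≠ M ∧ x ∈ X}.Nonempty := by
    obtain ⟨X, h1, h2, h3, h4⟩ := sameModule_self (A := A) hx hn
    exact ⟨X, h1, h2, h3⟩
  obtain ⟨X, ⟨h1, h2, h3⟩, hmax⟩ := hfin.exists_maximal hne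
  refine h2 (h1.1.antisymm fun y hy => ?_)
  obtain ⟨Y, k1, k2, k3, k4⟩ := hall y hy
  obtain ⟨h5, h6⟩ := h1.union hA hM k1 h2 k2 ⟨x, h3, k3⟩
  exact hmax ⟨h5, h6, .inl h3⟩ Set.subset_union_left (.inr k4)

theorem SameModule.uniform (hA : ∀ x y, A x y → A y x) {ι : Type*} {lab : V → ι}
    (hlab : ∀ x ∈ M, ∀ y ∈ M, lab x = lab y ↔ SameModule A M x y) : Uniform A M lab := by
  have hA' : ∀ x y, A x y ↔ A y x := fun x y => ⟨hA x y, hA y x⟩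
  have key : ∀ x ∈ M, ∀ x' ∈ M, ∀ y ∈ M, lab x = lab x' → lab x ≠ lab y → (A y x ↔ A y x') := by
    intro x hx x' hx' y hy hxx hxy
    obtain ⟨X, h1, h2, h3, h4⟩ := (hlab x hx x' hx').1 hxx
    exact h1.2 y hy (fun h => hxy ((hlab x hx y hy).2 ⟨X, h1, h2, h3, h⟩)) x h3 x' h4
  intro x hx x' hx' y hy y' hy' hxx hyy hxy
  rw [hA' x y, key x hx x' hx' y hy hxx hxy, hA' y x']
  exact key y hy y' hy' x' hx' hyy (by rw [← hxx]; exact hxy.symm)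

/-- Descend past the nodes that put the whole set into one class. At the first genuine split every
non-empty colour class is a proper module, so the at most `w` colours refine the relation
`SameModule`. -/
theorem Dec.exists_proper {w : ℕ} (h : Dec w A M) (hn : M.Nontrivial) :
    ∃ (l : ℕ) (col : V → Fin l), l ≤ w ∧
      ∀ x ∈ M, ∀ y ∈ M, col x = col y → SameModule A M x y := by
  induction h with
  | small h => exact absurd h (Set.not_subsingleton_iff.2 hn)
  | @node X l hl col hu _ ih =>
    by_cases hi : ∃ i, {x ∈ X | col x = i} = X
    · obtain ⟨i, hi⟩ := hi
      have := ih i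
      rw [hi] at this
      exact this hn
    · push Not at hi
      refine ⟨l, col, hl, fun x hx y hy hxy => ⟨{z ∈ X | col z = col x}, ⟨fun z hz => hz.1, ?_⟩,
        hi _, ⟨hx, rfl⟩, ⟨hy, hxy.symm⟩⟩⟩
      intro z hz hzX u hu' v hv'
      exact hu z hz z hz u hu'.1 v hv'.1 rfl (hu'.2.trans hv'.2.symm)
        fun e => hzX ⟨hz, e.trans hu'.2⟩

end Modules


/-! ### Filling arrays -/

theorem Ends.fill {n x a : ℕ} {e : Expr} {s : Mem} {Q : ℕ → Mem → Prop} (f : Fin n → ℕ)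
    (h0 : s.reg 0 = n)
    (he : ∀ (i : Fin n) s', s'.reg x = i.val → Agree [x] [a] s s' → e.val s' = f i)
    (hQ : ∀ t s', Agree [x] [a] s s' → (∀ i : Fin n, s'.arr a i = f i) → Q t s')
    (hx : x ≠ 0 := by decide) : Ends (DRDomination.forLoop x 0 (.write a (.reg x) e)) s Q := by
  refine Ends.forLoop (fun i s' => ∀ j : Fin n, j < i → s'.arr a j = f j) ?_ ?_ ?_ hx
    (by simp [Cmd.regs]) (by simp [Cmd.regs])
  · intro j hj; simp at hj
  · intro i s' hi hx hA hI
    rw [Ends.write_iff]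
    intro j hj
    have := he ⟨i, h0 ▸ hi⟩ s' hx hA
    simp only [Expr.val_reg, hx, this, Mem.setReg_arr, Mem.setArr_arr, if_true]
    by_cases h : (j : ℕ) = i
    · subst h; simp
    · rw [Function.update_of_ne h]; exact hI j (by omega)
  · intro t s' _ hA hI
    exact hQ t s' hA fun i => hI i (by rw [h0]; exact i.2)

theorem index_inj {n : ℕ} {u v u' v' : Fin n} (h : (u : ℕ) * n + v = u' * n + v') :
    u = u' ∧ v = v' := by
  have hn : 0 < n := u.pos
  have h1 : ((u : ℕ) * n + v) / n = u := by
    rw [mul_comm, Nat.mul_add_div hn, Nat.div_eq_of_lt v.2, add_zero]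
  have h2 : ((u' : ℕ) * n + v') / n = u' := by
    rw [mul_comm, Nat.mul_add_div hn, Nat.div_eq_of_lt v'.2, add_zero]
  have h3 : (u : ℕ) = u' := by rw [← h1, h, h2]
  refine ⟨Fin.ext h3, Fin.ext ?_⟩
  rw [h3] at h; omega

/-- The body may use scratch memory, but in array `a` it must change exactly the cell of the current
pair. Injectivity of `u * n + v` then protects the cells already filled. -/
theorem Ends.fill₂ {n x y a : ℕ} {p : Cmd} {s : Mem} {Q : ℕ → Mem → Prop}
    (f : Fin n → Fin n → ℕ) (h0 : s.reg 0 = n)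
    (h : ∀ (u v : Fin n) s', s'.reg x = u.val → s'.reg y = v.val → Agree (x :: y :: p.regs) p.arrs s s' →
      Ends p s' fun _ s'' => s''.arr a = Function.update (s'.arr a) (u * n + v) (f u v))
    (hQ : ∀ t s', Agree (x :: y :: p.regs) p.arrs s s' →
      (∀ u v : Fin n, s'.arr a (u * n + v) = f u v) → Q t s')
    (hx : x ≠ 0 := by decide) (hy : y ≠ 0 := by decide) (hxy : x ≠ y := by decide)
    (hxp : x ∉ p.regs := by decide) (hyp : y ∉ p.regs := by decide)
    (h0p : 0 ∉ p.regs := by decide) :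
    Ends (DRDomination.forLoop x 0 (DRDomination.forLoop y 0 p)) s Q := by
  have hR : (DRDomination.forLoop y 0 p).regs ⊆ y :: p.regs := by simp [DRDomination.forLoop, Cmd.regs]
  have hArr : (DRDomination.forLoop y 0 p).arrs ⊆ p.arrs := by simp [DRDomination.forLoop, Cmd.arrs]
  refine Ends.forLoop (fun i s' => ∀ u v : Fin n, u < i → s'.arr a (u * n + v) = f u v)
    ?_ ?_ ?_ hx ?_ ?_
  · intro u v hu; simp at hu
  · intro i s' hi hxi hA hI
    have hA' : Agree (x :: y :: p.regs) p.arrs s s' := hA.mono (by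
      intro z hz
      rcases List.mem_cons.1 hz with rfl | hz
      · simp
      · exact List.mem_cons_of_mem _ (hR hz)) hArr
    have h0' : s'.reg 0 = n := (hA'.reg 0 (by simp [hx.symm, hy.symm, h0p])).trans h0
    refine Ends.forLoop (fun j s'' => ∀ u v : Fin n, (u < i ∨ u.val = i ∧ v < j) →
      s''.arr a (u * n + v) = f u v) ?_ ?_ ?_ hy hyp h0p
    · intro u v huv; exact hI u v (by omega)
    · intro j s'' hj hyj hA₂ hJ
      have hA₃ : Agree (x :: y :: p.regs) p.arrs s s'' :=
        hA'.trans hA₂ (by simp) (by simp) (by simp) (by simp)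
      rw [h0'] at hj
      have hxx : s''.reg x = i := (hA₂.reg x (by simp [hxy, hxp])).trans hxi
      refine (h ⟨i, h0 ▸ hi⟩ ⟨j, hj⟩ s'' hxx hyj hA₃).mono fun _ s₃ h₃ u v huv => ?_
      rw [Mem.setReg_arr, h₃]
      by_cases he : (u : ℕ) * n + v = i * n + j
      · have := index_inj (u' := ⟨i, h0 ▸ hi⟩) (v' := ⟨j, hj⟩) he
        rw [this.1, this.2, Function.update_self]
      · rw [Function.update_of_ne he]
        refine hJ u v ?_
        rcases huv with huv | ⟨rfl, hv⟩
        · exact .inl huv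
        · refine .inr ⟨rfl, ?_⟩
          have : (v : ℕ) ≠ j := fun e => he (by rw [e])
          omega
    · intro t s'' _ hA₂ hJ u v huv
      exact hJ u v (by rw [h0']; have := v.2; omega)
  · intro t s' _ hA hI
    refine hQ t s' (hA.mono ?_ hArr) fun u v => hI u v (by rw [h0]; exact u.2)
    intro z hz
    rcases List.mem_cons.1 hz with rfl | hz
    · simp
    · exact List.mem_cons_of_mem _ (hR hz)
  · intro hh
    rcases List.mem_cons.1 (hR hh) with h | h
    · exact hxy h
    · exact hxp h
  · intro hh
    rcases List.mem_cons.1 (hR hh) with h | h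
    · exact hy h.symm
    · exact h0p h

/-! ### The power of the graph -/

/-- Array `2` holds the row offsets of `n × n` matrices. -/
def HasRows (n : ℕ) (s : Mem) : Prop :=
  s.reg 0 = n ∧ ∀ u : Fin n, s.arr 2 u = u * n

/-- Array `a` holds the matrix of the relation `R`. -/
def HasMatrix {n : ℕ} (a : ℕ) (R : Fin n → Fin n → Prop) (s : Mem) : Prop :=
  ∀ u v : Fin n, s.arr a (u * n + v) = bit (R u v)

/-- The entry of the matrix in array `a` whose position is given by two registers. -/
def Expr.entry (a x y : ℕ) : Expr := .get a (.add (.get 2 (.reg x)) (.reg y))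

theorem Expr.val_entry {n a x y : ℕ} {s : Mem} (h : HasRows n s) {u v : Fin n} (hu : s.reg x = u)
    (hv : s.reg y = v) : (Expr.entry a x y).val s = s.arr a (u * n + v) := by
  simp [Expr.entry, hu, hv, h.2]

/-- Computes the row offsets. -/
def rowProg : Cmd :=
  .seq (.assign 5 (.const 0))
    (forLoop 8 0 (.seq (.write 2 (.reg 8) (.reg 5)) (.assign 5 (.add (.reg 5) (.reg 0)))))

theorem rowProg_spec {n : ℕ} {s : Mem} (h : s.reg 0 = n) :
    Ends rowProg s fun _ s' => HasRows n s' := by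
  rw [rowProg, Ends.seq_iff, Ends.assign_iff]
  refine Ends.forLoop (fun i s' => s'.reg 5 = i * n ∧ ∀ u : Fin n, u < i → s'.arr 2 u = u * n)
    ?_ ?_ ?_
  · simp
  · intro i s' hi hx hA hI
    have h0 : s'.reg 0 = n := (hA.reg 0 (by decide)).trans (by simpa using h)
    simp only [Ends.seq_iff, Ends.write_iff, Ends.assign_iff]
    simp only [Expr.val_reg, Expr.val_add, Mem.setReg_reg, Mem.setReg_arr, Mem.setArr_reg,
      Mem.setArr_arr, hx, hI.1, h0]
    refine ⟨by simp; ring, fun u hu => ?_⟩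
    by_cases he : (u : ℕ) = i
    · simp [he]
    · simp only [if_true]
      rw [Function.update_of_ne he]; exact hI.2 u (by omega)
  · intro t s' _ hA hI
    have h0 : s'.reg 0 = n := (hA.reg 0 (by decide)).trans (by simpa using h)
    refine ⟨h0, fun u => hI.2 u ?_⟩
    have := u.2
    simp [h]

/-- One round: array `3` holds the relation "distance at most `k`", and it is extended to `k + 1`,
where array `0` holds the adjacency matrix. -/
def powRound : Cmd :=
  .seq
    (forLoop 8 0 (forLoop 9 0 (.seq
      (anyLoop 10 15 0 (.and (.entry 3 8 15) (.add (.entry 0 15 9) (.eq (.reg 15) (.reg 9)))))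
      (.write 4 (.add (.get 2 (.reg 8)) (.reg 9)) (.reg 10)))))
    (forLoop 8 0 (forLoop 9 0 (.write 3 (.add (.get 2 (.reg 8)) (.reg 9)) (.entry 4 8 9))))

theorem HasRows.congr {n : ℕ} {R A : List ℕ} {s s' : Mem} (h : HasRows n s) (hA : Agree R A s s')
    (h0 : 0 ∉ R := by decide) (h2 : 2 ∉ A := by decide) : HasRows n s' :=
  ⟨(hA.reg 0 h0).trans h.1, fun u => by rw [hA.arr 2 h2]; exact h.2 u⟩

theorem HasMatrix.congr {n a : ℕ} {P : Fin n → Fin n → Prop} {R A : List ℕ} {s s' : Mem}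
    (h : HasMatrix a P s) (hA : Agree R A s s') (ha : a ∉ A := by decide) : HasMatrix a P s' :=
  fun u v => by rw [hA.arr a ha]; exact h u v

/-- The new matrix is collected in array `4` and copied back afterwards, since all its entries are
computed from the old relation. -/
theorem powRound_spec {n : ℕ} {R A : Fin n → Fin n → Prop} {s : Mem} (h : HasRows n s)
    (hR : HasMatrix 3 R s) (hA : HasMatrix 0 A s) :
    Ends powRound s fun _ s' => HasMatrix 3 (fun u v => ∃ y, R u y ∧ (A y v ∨ y = v)) s' := by
  rw [powRound, Ends.seq_iff]
  refine Ends.fill₂ (n := n) (a := 4) (fun u v => bit (∃ y, R u y ∧ (A y v ∨ y = v)))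
    h.1 ?_ ?_
  · intro u v s' hu hv hag
    have h' := h.congr hag
    have hR' := hR.congr hag
    have hA' := hA.congr hag
    rw [Ends.seq_iff]
    refine Ends.anyLoop (fun i => ∃ y : Fin n, y = i ∧ R u y ∧ (A y v ∨ y = v)) ?_ ?_
    · intro i s'' hi hx hag'
      rw [h'.1] at hi
      have h'' := h'.congr hag'
      have hu' : s''.reg 8 = u := (hag'.reg 8 (by decide)).trans hu
      have hv' : s''.reg 9 = v := (hag'.reg 9 (by decide)).trans hv
      have hx' : s''.reg 15 = (⟨i, hi⟩ : Fin n) := hx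
      simp only [Expr.val_and, Expr.val_add, Expr.val_eq, Expr.val_entry h'' hu' hx',
        Expr.val_entry h'' hx' hv', Expr.val_reg, hv', (hR'.congr hag') u ⟨i, hi⟩,
        (hA'.congr hag') ⟨i, hi⟩ v]
      have he : i = v ↔ (⟨i, hi⟩ : Fin n) = v := by simp [Fin.ext_iff]
      rw [hx, he]
      simp only [ne_eq, bit_eq_zero, not_not, Nat.add_eq_zero_iff]
      constructor
      · rintro ⟨h1, h2⟩
        exact ⟨⟨i, hi⟩, rfl, h1, by tauto⟩
      · rintro ⟨y, rfl, h1, h2⟩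
        exact ⟨h1, by tauto⟩
    · intro t s'' hag' hz
      rw [Ends.write_iff]
      have h'' := h'.congr hag'
      have hu' : s''.reg 8 = u := (hag'.reg 8 (by decide)).trans hu
      have hv' : s''.reg 9 = v := (hag'.reg 9 (by decide)).trans hv
      simp only [Expr.val_add, Expr.val_get, Expr.val_reg, hu', hv', h''.2, hz, h'.1,
        Mem.setArr_arr, if_true, hag'.arr 4 (by decide)]
      congr 1
      refine bit_congr ⟨?_, ?_⟩
      · rintro ⟨_, _, y, rfl, h⟩; exact ⟨y, h⟩
      · rintro ⟨y, h⟩; exact ⟨y, y.2, y, rfl, h⟩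
  · intro t s' hag h4
    have h' := h.congr hag
    refine Ends.fill₂ (n := n) (a := 3) (fun u v => bit (∃ y, R u y ∧ (A y v ∨ y = v)))
      h'.1 ?_ ?_
    · intro u v s'' hu hv hag'
      have h'' := h'.congr hag'
      rw [Ends.write_iff]
      simp only [Expr.val_add, Expr.val_get, Expr.val_reg, hu, hv, h''.2, Mem.setArr_arr, if_true,
        Expr.val_entry h'' hu hv, hag'.arr 4 (by decide), h4]
    · intro t s'' _ h3
      exact h3

/-- Computes the matrix of the power of the graph into array `3`. -/
def powProg : Cmd :=
  .seq (forLoop 8 0 (.write 3 (.add (.get 2 (.reg 8)) (.reg 8)) (.const 1)))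
    (.seq (forLoop 6 0 (.cond (.sub (.reg 1) (.reg 6)) powRound .skip))
      (forLoop 8 0 (.write 3 (.add (.get 2 (.reg 8)) (.reg 8)) (.const 0))))

theorem diag_spec {n k : ℕ} {s : Mem} {Q : ℕ → Mem → Prop} (h : HasRows n s)
    (hQ : ∀ t s', Agree [8] [3] s s' → (∀ u v : Fin n,
      s'.arr 3 (u * n + v) = if u = v then k else s.arr 3 (u * n + v)) → Q t s') :
    Ends (forLoop 8 0 (.write 3 (.add (.get 2 (.reg 8)) (.reg 8)) (.const k))) s Q := by
  refine Ends.forLoop (fun i s' => ∀ u v : Fin n, s'.arr 3 (u * n + v) =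
    if u = v ∧ u < i then k else s.arr 3 (u * n + v)) ?_ ?_ ?_ (by decide) (by simp [Cmd.regs])
    (by simp [Cmd.regs])
  · simp
  · intro i s' hi hx hA hI
    rw [h.1] at hi
    have h' := h.congr (R := [8]) (A := [3]) hA
    have hrow : s'.arr 2 i = i * n := h'.2 ⟨i, hi⟩
    rw [Ends.write_iff]
    intro u v
    simp only [Expr.val_add, Expr.val_get, Expr.val_reg, hx, hrow, Mem.setReg_arr, Mem.setArr_arr,
      if_true, Expr.val_const]
    by_cases he : (u : ℕ) * n + v = i * n + i
    · obtain ⟨h1, h2⟩ := index_inj (u' := ⟨i, hi⟩) (v' := ⟨i, hi⟩) he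
      simp [h1, h2]
    · rw [Function.update_of_ne he, hI]
      refine if_congr ?_ rfl rfl
      refine and_congr_right fun huv => ?_
      have : (u : ℕ) ≠ i := fun e => he (by rw [← huv, e])
      omega
  · intro t s' _ hA hI
    refine hQ t s' hA fun u v => ?_
    have := u.2
    rw [hI, h.1]
    simp

/-- After `i` rounds array `3` describes walks of length at most `min r i`. The diagonal is set at
the start, for the walks of length zero, and cleared at the end. Although `r` may be arbitrarily
large, `n` rounds suffice by `exists_walk_length_le_min`. -/
theorem powProg_spec {n r : ℕ} {G : SimpleGraph (Fin n)} {s : Mem} (h : HasRows n s)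
    (hr : s.reg 1 = r) (hG : HasMatrix 0 G.Adj s) (h3 : ∀ i, s.arr 3 i = 0) :
    Ends powProg s fun _ s' => HasMatrix 3 (PowAdj G r) s' := by
  rw [powProg, Ends.seq_iff]
  refine diag_spec h fun t s₁ hA₁ h₁ => ?_
  have hr₁ := h.congr hA₁
  have hG₁ := hG.congr hA₁
  rw [Ends.seq_iff]
  refine Ends.forLoop (fun i s' => HasMatrix 3 (fun u v => ∃ p : G.Walk u v, p.length ≤ min r i) s')
    ?_ ?_ ?_
  · intro u v
    simp only [Mem.setReg_arr, h₁, h3]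
    split_ifs with huv
    · exact (bit_of_true (huv ▸ ⟨.nil, by simp⟩)).symm
    · refine (bit_of_false ?_).symm
      rintro ⟨p, hp⟩
      exact huv (SimpleGraph.Walk.eq_of_length_eq_zero (p := p) (by simpa using hp))
  · intro i s' hi hx hA hI
    have h' := hr₁.congr hA
    have hG' := hG₁.congr hA
    have hr' : s'.reg 1 = r := (hA.reg 1 (by decide)).trans ((hA₁.reg 1 (by decide)).trans hr)
    rw [Ends.cond_iff]
    simp only [Expr.val_sub, Expr.val_reg, hx, hr', Ends.skip_iff]
    constructor
    · intro hlt
      refine (powRound_spec h' hI hG').mono fun _ s'' h'' u v => ?_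
      rw [Mem.setReg_arr, h'']
      refine bit_congr ?_
      constructor
      · rintro ⟨y, ⟨p, hp⟩, hy | rfl⟩
        · exact ⟨p.concat hy, by rw [SimpleGraph.Walk.length_concat]; omega⟩
        · exact ⟨p, by omega⟩
      · rintro ⟨p, hp⟩
        by_cases h0 : p.length ≤ min r i
        · exact ⟨v, ⟨p, h0⟩, .inr rfl⟩
        -- Here the walk has length exactly `i + 1`, and its last edge is the extension made in this
        -- round.
        · have hp0 : ¬ p.Nil := fun hn => by
            rw [← SimpleGraph.Walk.length_eq_zero_iff] at hn; omega
          refine ⟨p.penultimate, ⟨p.dropLast, ?_⟩, .inl (p.adj_penultimate hp0)⟩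
          have : p.dropLast.length = p.length - 1 := by simp
          omega
    · intro hge
      rw [show min r (i + 1) = min r i by omega]
      exact hI
  · intro t s' _ hA hI
    refine diag_spec (hr₁.congr hA) fun t s'' hA' h'' u v => ?_
    rw [h'', hI]
    have := exists_walk_length_le_min (n := n) (r := r) (k := n) le_rfl (G := G) (u := u) (v := v)
    rw [hr₁.1, bit_congr this]
    split_ifs with huv
    · exact (bit_of_false fun h => h.1 huv).symm
    · exact bit_congr ⟨fun h => ⟨huv, h⟩, fun h => h.2⟩


/-! ### Closures -/

/-- The memory while the node in register `6` is processed: `M` is the vertex set of this node. -/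
structure NodeCtx {n : ℕ} (A : Fin n → Fin n → Prop) (M : Set (Fin n)) (s : Mem) : Prop where
  rows : HasRows n s
  mat : HasMatrix 3 A s
  mem : ∀ x : Fin n, s.arr 5 x = s.reg 6 ↔ x ∈ M

theorem NodeCtx.congr {n : ℕ} {A : Fin n → Fin n → Prop} {M : Set (Fin n)} {R B : List ℕ}
    {s s' : Mem} (h : NodeCtx A M s) (hA : Agree R B s s') (h0 : 0 ∉ R := by decide)
    (h6 : 6 ∉ R := by decide) (h2 : 2 ∉ B := by decide) (h3 : 3 ∉ B := by decide)
    (h5 : 5 ∉ B := by decide) : NodeCtx A M s' :=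
  ⟨h.rows.congr hA h0 h2, h.mat.congr hA h3, fun x => by
    rw [hA.arr 5 h5, hA.reg 6 h6]; exact h.mem x⟩

/-- Adds to the set in array `6` the vertices that violate closedness for the reference in
array `14`. -/
def closureStep : Cmd :=
  forLoop 8 0 (.seq
    (anyLoop 10 9 0 (.and (.get 6 (.reg 9)) (.ne (.entry 3 8 9) (.get 14 (.reg 8)))))
    (.cond (.and (.eq (.get 5 (.reg 8)) (.reg 6)) (.reg 10)) (.write 6 (.reg 8) (.const 1)) .skip))

variable {n : ℕ} {A : Fin n → Fin n → Prop} {M X : Set (Fin n)} {ref : Fin n → Prop} {s : Mem}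

/-- The set grows while it is being scanned, so the outcome is not described exactly. It suffices
that every vertex violating closedness of the old `X` is added, and that nothing outside the closed
supersets of `X` is. -/
theorem closureStep_spec (hc : NodeCtx A M s) (href : ∀ x : Fin n, s.arr 14 x = bit (ref x))
    (hX : ∀ x : Fin n, s.arr 6 x ≠ 0 ↔ x ∈ X) (hXM : X ⊆ M) :
    Ends closureStep s fun _ s' => ∃ X', X ⊆ X' ∧ X' ⊆ M ∧
      (∀ Y, X ⊆ Y → IsClosedFor A M ref Y → X' ⊆ Y) ∧
      (∀ x ∈ M, ∀ u ∈ X, ¬ (A x u ↔ ref x) → x ∈ X') ∧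
      ∀ x : Fin n, s'.arr 6 x ≠ 0 ↔ x ∈ X' := by
  refine Ends.forLoop (fun i s' => ∃ X', X ⊆ X' ∧ X' ⊆ M ∧
      (∀ Y, X ⊆ Y → IsClosedFor A M ref Y → X' ⊆ Y) ∧
      (∀ x ∈ M, x.val < i → ∀ u ∈ X, ¬ (A x u ↔ ref x) → x ∈ X') ∧
      ∀ x : Fin n, s'.arr 6 x ≠ 0 ↔ x ∈ X') ?_ ?_ ?_
  · exact ⟨X, subset_rfl, hXM, fun _ h _ => h, by simp, hX⟩
  · rintro i s' hi hx hag ⟨X', h1, h2, h3, h4, h5⟩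
    rw [hc.rows.1] at hi
    have hc' := hc.congr hag
    have href' : ∀ x : Fin n, s'.arr 14 x = bit (ref x) := fun x => by
      rw [hag.arr 14 (by decide)]; exact href x
    rw [Ends.seq_iff]
    refine Ends.anyLoop (fun j => ∃ u : Fin n, u = j ∧ u ∈ X' ∧ ¬ (A ⟨i, hi⟩ u ↔ ref ⟨i, hi⟩)) ?_ ?_
    · intro j s'' hj hy hag'
      rw [hc'.rows.1] at hj
      have hc'' := hc'.congr hag'
      have hx' : s''.reg 8 = (⟨i, hi⟩ : Fin n) := (hag'.reg 8 (by decide)).trans hx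
      have hy' : s''.reg 9 = (⟨j, hj⟩ : Fin n) := hy
      have e6 : s''.arr 6 j ≠ 0 ↔ (⟨j, hj⟩ : Fin n) ∈ X' := by
        rw [hag'.arr 6 (by decide)]; exact h5 ⟨j, hj⟩
      have e14 : s''.arr 14 i = bit (ref ⟨i, hi⟩) := by
        rw [hag'.arr 14 (by decide)]; exact href' ⟨i, hi⟩
      simp only [Expr.val_and, Expr.val_get, Expr.val_reg, hy', ne_eq, Expr.val_ne_eq_zero,
        Expr.val_entry hc''.rows hx' hy', hc''.mat ⟨i, hi⟩ ⟨j, hj⟩, hx', e14, bit_inj, bit_eq_zero,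
        not_not]
      constructor
      · rintro ⟨h1, h2⟩
        exact ⟨⟨j, hj⟩, rfl, e6.1 h1, h2⟩
      · rintro ⟨u, rfl, hu1, hu2⟩
        exact ⟨e6.2 hu1, hu2⟩
    · intro t s'' hag' hz
      have hc'' := hc'.congr hag'
      have hx' : s''.reg 8 = (⟨i, hi⟩ : Fin n) := (hag'.reg 8 (by decide)).trans hx
      have h6 : s''.arr 6 = s'.arr 6 := hag'.arr 6 (by decide)
      have hcond : (Expr.and (.eq (.get 5 (.reg 8)) (.reg 6)) (.reg 10)).val s'' ≠ 0 ↔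
          (⟨i, hi⟩ : Fin n) ∈ M ∧ ∃ u ∈ X', ¬ (A ⟨i, hi⟩ u ↔ ref ⟨i, hi⟩) := by
        have := hc''.mem ⟨i, hi⟩
        simp only [Expr.val_and, Expr.val_eq, Expr.val_get, Expr.val_reg, hx', this, hz, ne_eq,
          bit_eq_zero, not_not]
        have hex : (∃ j < s'.reg 0, ∃ u : Fin n, u = j ∧ u ∈ X' ∧ ¬ (A ⟨i, hi⟩ u ↔ ref ⟨i, hi⟩)) ↔
            ∃ u ∈ X', ¬ (A ⟨i, hi⟩ u ↔ ref ⟨i, hi⟩) :=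
          ⟨fun ⟨_, _, u, _, h⟩ => ⟨u, h⟩, fun ⟨u, h⟩ => ⟨u, by rw [hc'.rows.1]; exact u.2, u, rfl, h⟩⟩
        rw [hex]
      rw [Ends.cond_iff, hcond]
      simp only [Ends.write_iff, Ends.skip_iff]
      constructor
      · rintro ⟨hiM, u, hu, hne⟩
        refine ⟨insert ⟨i, hi⟩ X', h1.trans (Set.subset_insert _ _), Set.insert_subset hiM h2, ?_,
          ?_, ?_⟩
        · intro Y hXY hY
          refine Set.insert_subset ?_ (h3 Y hXY hY)
          by_contra hiY
          exact hne (hY _ hiM hiY u (h3 Y hXY hY hu))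
        · intro x hxM hxi v hv hne'
          by_cases he : x = ⟨i, hi⟩
          · exact .inl he
          · have : x.val ≠ i := fun e => he (Fin.ext e)
            exact .inr (h4 x hxM (by omega) v hv hne')
        · intro x
          simp only [Expr.val_reg, hx', Expr.val_const, Mem.setReg_arr, Mem.setArr_arr, if_true, h6]
          by_cases he : x = ⟨i, hi⟩
          · simp [he]
          · have : x.val ≠ i := fun e => he (Fin.ext e)
            rw [Function.update_of_ne this, h5]
            simp [he]
      · intro h0
        have h0 := fun h => hcond.2 h h0
        refine ⟨X', h1, h2, h3, ?_, fun x => by rw [Mem.setReg_arr, h6]; exact h5 x⟩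
        intro x hxM hxi v hv hne'
        by_cases he : x = ⟨i, hi⟩
        · subst he
          exact (h0 ⟨hxM, v, h1 hv, hne'⟩).elim
        · have : x.val ≠ i := fun e => he (Fin.ext e)
          exact h4 x hxM (by omega) v hv hne'
  · rintro t s' _ hag ⟨X', h1, h2, h3, h4, h5⟩
    exact ⟨X', h1, h2, h3, fun x hx => h4 x hx (by rw [hc.rows.1]; exact x.2), h5⟩

/-- Closes the set in array `6` under `closureStep`. -/
def closureProg : Cmd := forLoop 7 0 closureStep

/-- `X` is the least closed set that contains `X₀`. -/
def IsClosure (A : Fin n → Fin n → Prop) (M : Set (Fin n)) (ref : Fin n → Prop)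
    (X₀ X : Set (Fin n)) : Prop :=
  X₀ ⊆ X ∧ X ⊆ M ∧ IsClosedFor A M ref X ∧ ∀ Y, X₀ ⊆ Y → IsClosedFor A M ref Y → X ⊆ Y

/-- A round that starts from a set that is not closed adds a vertex. Starting from a non-empty set,
a set that is still not closed after `i` rounds has at least `i + 1` elements, which is impossible
for `i = n`. -/
theorem closureProg_spec {X₀ : Set (Fin n)} (hc : NodeCtx A M s)
    (href : ∀ x : Fin n, s.arr 14 x = bit (ref x)) (hX : ∀ x : Fin n, s.arr 6 x ≠ 0 ↔ x ∈ X₀)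
    (hXM : X₀ ⊆ M) (hne : X₀.Nonempty) :
    Ends closureProg s fun _ s' => ∃ X, IsClosure A M ref X₀ X ∧
      ∀ x : Fin n, s'.arr 6 x ≠ 0 ↔ x ∈ X := by
  refine Ends.forLoop (fun i s' => ∃ X, X₀ ⊆ X ∧ X ⊆ M ∧
      (∀ Y, X₀ ⊆ Y → IsClosedFor A M ref Y → X ⊆ Y) ∧ (IsClosedFor A M ref X ∨ i + 1 ≤ X.ncard) ∧
      ∀ x : Fin n, s'.arr 6 x ≠ 0 ↔ x ∈ X) ?_ ?_ ?_
  · exact ⟨X₀, subset_rfl, hXM, fun _ h _ => h, .inr ((Set.ncard_pos (Set.toFinite _)).2 hne), hX⟩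
  · rintro i s' hi hx hag ⟨X, h1, h2, h3, h4, h5⟩
    have href' : ∀ x : Fin n, s'.arr 14 x = bit (ref x) := fun x => by
      rw [hag.arr 14 (by decide)]; exact href x
    refine (closureStep_spec (hc.congr hag) href' h5 h2).mono ?_
    rintro _ s'' ⟨X', k1, k2, k3, k4, k5⟩
    refine ⟨X', h1.trans k1, k2, fun Y hY hcl => k3 Y (h3 Y hY hcl) hcl, ?_, k5⟩
    by_cases hcl : IsClosedFor A M ref X
    · left
      rwa [(k3 X subset_rfl hcl).antisymm k1]
    · right
      have h4 := h4.resolve_left hcl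
      have hcl' := hcl
      unfold IsClosedFor at hcl'
      push Not at hcl'
      obtain ⟨x, hx, hxX, u, hu, hne⟩ := hcl'
      have hxX' := k4 x hx u hu fun h => by
        rcases hne with ⟨a, b⟩ | ⟨a, b⟩
        · exact b (h.1 a)
        · exact a (h.2 b)
      have : X.ncard < X'.ncard := Set.ncard_lt_ncard
        ⟨k1, fun h => hxX (h hxX')⟩ (Set.toFinite _)
      omega
  · rintro t s' _ hag ⟨X, h1, h2, h3, h4, h5⟩
    refine ⟨X, ⟨h1, h2, h4.resolve_right fun h => ?_, h3⟩, h5⟩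
    have := Set.ncard_le_card X
    rw [hc.rows.1] at h
    simp at this
    omega

/-- The test whether the set in array `6` is a proper subset of the node. -/
def properTest (z : ℕ) : Cmd :=
  anyLoop z 9 0 (.and (.eq (.get 5 (.reg 9)) (.reg 6)) (.isZero (.get 6 (.reg 9))))

theorem properTest_spec {z : ℕ} {Q : ℕ → Mem → Prop} (hc : NodeCtx A M s)
    (hX : ∀ x : Fin n, s.arr 6 x ≠ 0 ↔ x ∈ X) (hXM : X ⊆ M)
    (hQ : ∀ t s', Agree [z, 9] [] s s' → s'.reg z = bit (X ≠ M) → Q t s')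
    (h9 : 9 ≠ z := by decide) (h6 : 6 ≠ z := by decide) (h0 : 0 ≠ z := by decide) :
    Ends (properTest z) s Q := by
  refine Ends.anyLoop (fun j => ∃ u : Fin n, u = j ∧ u ∈ M ∧ u ∉ X) ?_ ?_ (by decide) h9 h0
  · intro j s' hj hy hag
    rw [hc.rows.1] at hj
    have hc' := hc.congr hag (by simp [h0]) (by simp [h6])
    have h1 := hc'.mem ⟨j, hj⟩
    have h2 := hX ⟨j, hj⟩
    rw [← hag.arr 6 (by decide)] at h2
    simp only [Expr.val_and, Expr.val_eq, Expr.val_get, Expr.val_reg, Expr.val_isZero, hy, h1,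
      ne_eq, bit_eq_zero, not_not]
    constructor
    · rintro ⟨k1, k2⟩
      exact ⟨⟨j, hj⟩, rfl, k1, fun h => h2.2 h k2⟩
    · rintro ⟨u, rfl, hu1, hu2⟩
      exact ⟨hu1, by by_contra hcon; exact hu2 (h2.1 hcon)⟩
  · intro t s' hag hz
    refine hQ t s' hag (hz.trans (bit_congr ⟨?_, fun hne => ?_⟩))
    · rintro ⟨_, _, u, _, h1, h2⟩ rfl
      exact h2 h1
    · by_contra hcon
      push Not at hcon
      refine hne (hXM.antisymm fun x hx => hcon x ?_ x rfl hx)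
      rw [hc.rows.1]; exact x.2

/-! ### Bipartitions -/

/-- Computes the component (`b = 0`) or co-component (`b = 1`) of the representative of the node. -/
def bipartTry (b : ℕ) : Cmd :=
  .seq (forLoop 15 0 (.write 14 (.reg 15) (.const b)))
    (.seq (forLoop 15 0 (.write 6 (.reg 15) (.eq (.reg 15) (.get 13 (.reg 6)))))
      (.seq closureProg (properTest 11)))

/-- Register `11` tells whether the node has a bipartition, one side of which is in array `6`. -/
def HasBipart (A : Fin n → Fin n → Prop) (M : Set (Fin n)) (v : Fin n) (s : Mem) : Prop :=
  s.reg 11 ≠ 0 ∧ ∃ (b : Prop) (X : Set (Fin n)), v ∈ X ∧ X ⊆ M ∧ X ≠ M ∧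
    IsClosedFor A M (fun _ => b) X ∧ ∀ x : Fin n, s.arr 6 x ≠ 0 ↔ x ∈ X

/-- The closure of `{v}` for a constant reference lies in every closed set containing `v`. If it
exhausts `M`, all of these sets do. -/
theorem bipartTry_spec {v : Fin n} {b : ℕ} (hb : b = 0 ∨ b = 1) (hc : NodeCtx A M s) (hv : v ∈ M)
    (hrep : s.arr 13 (s.reg 6) = v) :
    Ends (bipartTry b) s fun _ s' => HasBipart A M v s' ∨ s'.reg 11 = 0 ∧
      ∀ X ⊆ M, v ∈ X → IsClosedFor A M (fun _ => b = 1) X → X = M := by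
  have hbit : b = bit (b = 1) := by rcases hb with rfl | rfl <;> simp [bit]
  rw [bipartTry, Ends.seq_iff]
  refine Ends.fill (n := n) (fun _ => bit (b = 1)) hc.rows.1 (fun _ _ _ _ => hbit) fun _ s₁ h₁ e₁ => ?_
  rw [Ends.seq_iff]
  have hc₁ := hc.congr h₁
  refine Ends.fill (n := n) (fun i => bit (i = v)) hc₁.rows.1 ?_ fun _ s₂ h₂ e₂ => ?_
  · intro i s' hi hag
    rw [Expr.val_eq, Expr.val_get, Expr.val_reg, Expr.val_reg, hi, hag.arr 13 (by decide),
      h₁.arr 13 (by decide), hag.reg 6 (by decide), h₁.reg 6 (by decide), hrep]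
    exact bit_congr Fin.ext_iff.symm
  have hc₂ := hc₁.congr h₂
  rw [Ends.seq_iff]
  refine (closureProg_spec (ref := fun _ => b = 1) (X₀ := {v}) hc₂ ?_ ?_ ?_ ⟨v, rfl⟩).conseq ?_
  · intro x; rw [h₂.arr 14 (by decide), e₁]
  · intro x; simp [e₂]
  · simpa using hv
  · rintro _ s₃ h₃ ⟨X, ⟨k1, k2, k3, k4⟩, k5⟩
    refine properTest_spec (hc₂.congr h₃) k5 k2 fun _ s₄ h₄ e₄ => ?_
    have hvX : v ∈ X := k1 rfl
    by_cases hXM : X = M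
    · right
      refine ⟨by rw [e₄]; simpa using hXM, fun Y hY hvY hcl => hY.antisymm ?_⟩
      rw [← hXM]
      exact k4 Y (by simpa using hvY) hcl
    · left
      refine ⟨by rw [e₄]; simpa using hXM, _, X, hvX, k2, hXM, k3, fun x => ?_⟩
      rw [h₄.arr 6 (by decide)]
      exact k5 x

/-- Looks for a bipartition of the node. -/
def bipartProg : Cmd := .seq (bipartTry 0) (.cond (.reg 11) .skip (bipartTry 1))

theorem bipartProg_spec {v : Fin n} (hA : ∀ x y, A x y → A y x) (hc : NodeCtx A M s) (hv : v ∈ M)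
    (hrep : s.arr 13 (s.reg 6) = v) :
    Ends bipartProg s fun _ s' => HasBipart A M v s' ∨ s'.reg 11 = 0 ∧ NoBipartition A M := by
  rw [bipartProg, Ends.seq_iff]
  refine (bipartTry_spec (.inl rfl) hc hv hrep).conseq fun _ s₁ h₁ k₁ => ?_
  simp only [Ends.cond_iff, Ends.skip_iff, Expr.val_reg]
  constructor
  · intro h11
    exact .inl (k₁.resolve_right fun h => h11 h.1)
  · intro h11
    have k₁ := (k₁.resolve_left fun h => h.1 h11).2
    refine (bipartTry_spec (.inr rfl) (hc.congr h₁) hv ?_).mono fun _ s₂ k₂ => ?_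
    · rw [h₁.arr 13 (by decide), h₁.reg 6 (by decide), hrep]
    · refine k₂.imp id fun ⟨e, k₂⟩ => ⟨e, noBipartition_of_mem hA hv fun b X hX hvX hcl => ?_⟩
      by_cases hb : b
      · refine k₂ X hX hvX ?_
        simpa [hb] using hcl
      · refine k₁ X hX hvX ?_
        simpa [hb] using hcl

/-! ### Classes -/

/-- Tests whether the vertices in the registers `13` and `14` lie in a proper module. -/
def sameTest : Cmd :=
  .seq (forLoop 15 0 (.write 14 (.reg 15) (.entry 3 15 14)))
    (.seq (forLoop 15 0 (.write 6 (.reg 15) (.add (.eq (.reg 15) (.reg 13)) (.eq (.reg 15) (.reg 14)))))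
      (.seq closureProg (properTest 12)))

/-- A set closed for any reference is a module, and a module containing `y` is closed for the
reference `A · y`. So the closure of `{x, y}` for this reference is the least module containing both
vertices, and testing whether it is proper decides `SameModule`. -/
theorem sameTest_spec {x y : Fin n} (hc : NodeCtx A M s) (hx : s.reg 13 = x) (hy : s.reg 14 = y)
    (hxM : x ∈ M) (hyM : y ∈ M) :
    Ends sameTest s fun _ s' => s'.reg 12 ≠ 0 ↔ SameModule A M x y := by
  rw [sameTest, Ends.seq_iff]
  refine Ends.fill (n := n) (fun i => bit (A i y)) hc.rows.1 ?_ fun _ s₁ h₁ e₁ => ?_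
  · intro i s' hi hag
    rw [Expr.val_entry (hc.rows.congr hag) hi ((hag.reg 14 (by decide)).trans hy)]
    exact (hc.mat.congr hag) i y
  rw [Ends.seq_iff]
  have hc₁ := hc.congr h₁
  refine Ends.fill (n := n) (fun i => bit ((i : ℕ) = x) + bit ((i : ℕ) = y))
    hc₁.rows.1 ?_ fun _ s₂ h₂ e₂ => ?_
  · intro i s' hi hag
    rw [Expr.val_add, Expr.val_eq, Expr.val_eq, Expr.val_reg, Expr.val_reg, Expr.val_reg, hi,
      hag.reg 13 (by decide), h₁.reg 13 (by decide), hag.reg 14 (by decide),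
      h₁.reg 14 (by decide), hx, hy]
  have hc₂ := hc₁.congr h₂
  rw [Ends.seq_iff]
  refine (closureProg_spec (ref := fun i => A i y) (X₀ := {x, y}) hc₂ ?_ ?_ ?_ ⟨x, by simp⟩).conseq ?_
  · intro i; rw [h₂.arr 14 (by decide), e₁]
  · intro i; simp [e₂, Fin.ext_iff]; tauto
  · intro z hz
    rcases hz with rfl | rfl
    · exact hxM
    · exact hyM
  · rintro _ s₃ h₃ ⟨X, ⟨k1, k2, k3, k4⟩, k5⟩
    refine properTest_spec (hc₂.congr h₃) k5 k2 fun _ s₄ h₄ e₄ => ?_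
    rw [e₄, ne_eq, bit_eq_zero, not_not]
    constructor
    · intro hXM
      exact ⟨X, k3.isModule k2, hXM, k1 (by simp), k1 (by simp)⟩
    · rintro ⟨Y, h1, h2, h3, h4⟩ rfl
      refine h2 (h1.1.antisymm (k4 Y ?_ (h1.isClosedFor h4)))
      intro z hz
      rcases hz with rfl | rfl
      · exact h3
      · exact h4

/-- An equivalence relation whose classes split `M` as required. -/
structure IsSplitting (A : Fin n → Fin n → Prop) (w : ℕ) (M : Set (Fin n))
    (E : Fin n → Fin n → Prop) : Prop where
  refl : ∀ x ∈ M, E x x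
  symm : ∀ x ∈ M, ∀ y ∈ M, E x y → E y x
  trans : ∀ x ∈ M, ∀ y ∈ M, ∀ z ∈ M, E x y → E y z → E x z
  uniform : ∀ {ι : Type} (lab : Fin n → ι), (∀ x ∈ M, ∀ y ∈ M, lab x = lab y ↔ E x y) →
    Uniform A M lab
  nontrivial : ∃ x ∈ M, ∃ y ∈ M, ¬ E x y
  bound : ∃ (l : ℕ) (col : Fin n → Fin l), l ≤ w ∧ ∀ x ∈ M, ∀ y ∈ M, col x = col y → E x y

theorem isSplitting_sameModule {w : ℕ} (hA : ∀ x y, A x y → A y x) (hM : NoBipartition A M)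
    (hn : M.Nontrivial) (hd : Dec w A M) : IsSplitting A w M (SameModule A M) where
  refl x hx := sameModule_self hx hn
  symm _ _ _ _ h := h.symm
  trans _ _ _ _ _ _ h h' := h.trans hA hM h'
  uniform _ h := SameModule.uniform hA h
  nontrivial := by
    obtain ⟨x, hx⟩ := hn.nonempty
    obtain ⟨y, hy, h⟩ := exists_not_sameModule hA hM (Set.toFinite _) hn hx
    exact ⟨x, hx, y, hy, h⟩
  bound := hd.exists_proper hn

theorem isSplitting_bipart {w : ℕ} (hA : ∀ x y, A x y → A y x) (hw : 2 ≤ w) {b : Prop} (hXM : X ⊆ M)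
    (hne : X.Nonempty) (hXne : X ≠ M) (hcl : IsClosedFor A M (fun _ => b) X) :
    IsSplitting A w M (fun x y => x ∈ X ↔ y ∈ X) where
  refl _ _ := Iff.rfl
  symm _ _ _ _ h := h.symm
  trans _ _ _ _ _ _ h h' := h.trans h'
  uniform lab h := by
    have key : ∀ x ∈ M, ∀ y ∈ M, lab x ≠ lab y → (A x y ↔ b) := by
      intro x hx y hy hxy
      rw [ne_eq, h x hx y hy] at hxy
      by_cases hxX : x ∈ X
      · have hyX : y ∉ X := fun h => hxy (iff_of_true hxX h)
        exact ⟨fun h => (hcl y hy hyX x hxX).1 (hA _ _ h), fun h => hA _ _ ((hcl y hy hyX x hxX).2 h)⟩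
      · have hyX : y ∈ X := by by_contra h; exact hxy (iff_of_false hxX h)
        exact hcl x hx hxX y hyX
    intro x hx x' hx' y hy y' hy' hxx hyy hxy
    rw [key x hx y hy hxy, key x' hx' y' hy' (by rw [← hxx, ← hyy]; exact hxy)]
  nontrivial := by
    obtain ⟨x, hx⟩ := hne
    have : ∃ y ∈ M, y ∉ X := by
      by_contra hcon; push Not at hcon; exact hXne (hXM.antisymm hcon)
    obtain ⟨y, hy, hyX⟩ := this
    exact ⟨x, hXM hx, y, hy, fun h => hyX (h.1 hx)⟩
  bound := by
    classical
    refine ⟨2, fun x => if x ∈ X then 0 else 1, hw, fun x _ y _ h => ?_⟩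
    by_cases hx : x ∈ X <;> by_cases hy : y ∈ X <;> simp_all

/-- Labels every vertex of the node by the last vertex of its class. -/
def labelProg : Cmd :=
  .seq bipartProg (.seq (forLoop 15 0 (.write 7 (.reg 15) (.isZero (.get 6 (.reg 15)))))
    (forLoop 13 0 (forLoop 14 0
      (.cond (.and (.eq (.get 5 (.reg 13)) (.reg 6)) (.eq (.get 5 (.reg 14)) (.reg 6)))
        (.seq (.cond (.reg 11) (.assign 12 (.eq (.get 7 (.reg 13)) (.get 7 (.reg 14)))) sameTest)
          (.cond (.reg 12) (.write 8 (.reg 13) (.reg 14)) .skip))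
        .skip))))

/-- The relation `E` is being on the same side if a bipartition was found, and `SameModule`
otherwise. Since the inner loop runs upwards and overwrites, the label is the largest vertex of the
class, a name that depends on the class only. -/
theorem labelProg_spec {w : ℕ} {v : Fin n} (hA : ∀ x y, A x y → A y x) (hw : 2 ≤ w)
    (hd : Dec w A M) (hn : M.Nontrivial) (hc : NodeCtx A M s) (hv : v ∈ M)
    (hrep : s.arr 13 (s.reg 6) = v) :
    Ends labelProg s fun _ s' => ∃ (E : Fin n → Fin n → Prop) (lab : Fin n → Fin n),
      IsSplitting A w M E ∧ ∀ x ∈ M, s'.arr 8 x = lab x ∧ lab x ∈ M ∧ E x (lab x) ∧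
        ∀ y ∈ M, E x y → y ≤ lab x := by
  rw [labelProg, Ends.seq_iff]
  refine (bipartProg_spec hA hc hv hrep).conseq fun _ s₁ h₁ k₁ => ?_
  have hc₁ := hc.congr h₁
  rw [Ends.seq_iff]
  -- Stored as bits, the entries of array `7` agree exactly when membership agrees, whatever
  -- non-zero values array `6` contains.
  refine Ends.fill (n := n) (fun i => bit (s₁.arr 6 i = 0)) hc₁.rows.1 ?_
    fun _ s₂ h₂ e₂ => ?_
  · intro i s' hi hag
    rw [Expr.val_isZero, Expr.val_get, Expr.val_reg, hi, hag.arr 6 (by decide)]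
  have hc₂ := hc₁.congr h₂
  have hE : ∃ E, IsSplitting A w M E ∧
      (s₂.reg 11 ≠ 0 ∧ (∀ x y : Fin n, E x y ↔ s₂.arr 7 x = s₂.arr 7 y) ∨
        s₂.reg 11 = 0 ∧ E = SameModule A M) := by
    rw [h₂.reg 11 (by decide)]
    rcases k₁ with ⟨h11, b, X, j1, j2, j3, j4, j5⟩ | ⟨h11, j⟩
    · refine ⟨_, isSplitting_bipart hA hw j2 ⟨v, j1⟩ j3 j4, .inl ⟨h11, fun x y => ?_⟩⟩
      rw [e₂, e₂, ← j5 x, ← j5 y, bit_inj]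
      exact not_iff_not
    · exact ⟨_, isSplitting_sameModule hA j hn hd, .inr ⟨h11, rfl⟩⟩
  obtain ⟨E, hE, hE'⟩ := hE
  have hmem : ∀ {R B s'} (x : Fin n), Agree R B s₂ s' → 6 ∉ R → 5 ∉ B →
      (s'.arr 5 x = s'.reg 6 ↔ x ∈ M) := fun x hag h6 h5 => by
    rw [hag.arr 5 h5, hag.reg 6 h6]; exact hc₂.mem x
  refine Ends.forLoop (fun i s' => ∀ x ∈ M, x.val < i → ∃ y ∈ M, s'.arr 8 x = y ∧ E x y ∧
    ∀ y' ∈ M, E x y' → y' ≤ y) ?_ ?_ ?_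
  · intro x _ hx; simp at hx
  · intro i s' hi hx hag hI
    rw [hc₂.rows.1] at hi
    have hc' := hc₂.congr hag
    -- Either no vertex below `j` is related to `i`, or the entry of `i` is the largest such vertex.
    -- In the end reflexivity of `E` excludes the first alternative.
    refine Ends.forLoop (fun j s'' => (∀ x ∈ M, x.val < i → ∃ y ∈ M, s''.arr 8 x = y ∧ E x y ∧
      ∀ y' ∈ M, E x y' → y' ≤ y) ∧ ((⟨i, hi⟩ : Fin n) ∈ M →
        (∀ y' ∈ M, E ⟨i, hi⟩ y' → ¬ y'.val < j) ∨ ∃ y ∈ M, s''.arr 8 i = y ∧ E ⟨i, hi⟩ y ∧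
          ∀ y' ∈ M, E ⟨i, hi⟩ y' → y'.val < j → y' ≤ y)) ?_ ?_ ?_
    · exact ⟨hI, fun _ => .inl fun y' _ _ => by simp⟩
    · intro j s'' hj hy hag' hJ
      rw [hc'.rows.1] at hj
      have hc'' := hc'.congr hag'
      have hx' : s''.reg 13 = (⟨i, hi⟩ : Fin n) := (hag'.reg 13 (by decide)).trans hx
      have hy' : s''.reg 14 = (⟨j, hj⟩ : Fin n) := hy
      have hcond : (Expr.and (.eq (.get 5 (.reg 13)) (.reg 6)) (.eq (.get 5 (.reg 14)) (.reg 6))).val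
          s'' ≠ 0 ↔ (⟨i, hi⟩ : Fin n) ∈ M ∧ (⟨j, hj⟩ : Fin n) ∈ M := by
        rw [← hc''.mem, ← hc''.mem]
        simp [hx', hy']
      rw [Ends.cond_iff, hcond, Ends.skip_iff]
      constructor
      · rintro ⟨hiM, hjM⟩
        rw [Ends.seq_iff]
        have test : Ends (.cond (.reg 11) (.assign 12 (.eq (.get 7 (.reg 13)) (.get 7 (.reg 14))))
            sameTest) s'' fun _ s₃ => s₃.reg 12 ≠ 0 ↔ E ⟨i, hi⟩ ⟨j, hj⟩ := by
          have e11 : s''.reg 11 = s₂.reg 11 :=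
            (hag'.reg 11 (by decide)).trans (hag.reg 11 (by decide))
          have e7 : s''.arr 7 = s₂.arr 7 := (hag'.arr 7 (by decide)).trans (hag.arr 7 (by decide))
          rw [Ends.cond_iff, Expr.val_reg, e11]
          constructor
          · intro h11
            rw [Ends.assign_iff]
            have hE' := (hE'.resolve_right fun h => h11 h.1).2
            rw [hE', ← e7]
            simp [hx', hy']
          · intro h11
            have hE' := (hE'.resolve_left fun h => h.1 h11).2
            rw [hE']
            exact sameTest_spec hc'' hx' hy' hiM hjM
        refine test.conseq fun _ s₃ h₃ e₃ => ?_
        have e8 : s₃.arr 8 = s''.arr 8 := h₃.arr 8 (by decide)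
        have hx₃ : s₃.reg 13 = (⟨i, hi⟩ : Fin n) := (h₃.reg 13 (by decide)).trans hx'
        have hy₃ : s₃.reg 14 = (⟨j, hj⟩ : Fin n) := (h₃.reg 14 (by decide)).trans hy'
        rw [Ends.cond_iff, Expr.val_reg, Ends.write_iff, Ends.skip_iff]
        constructor
        · intro hz
          have hEij := e₃.1 hz
          simp only [Expr.val_reg, hx₃, hy₃, Mem.setReg_arr, Mem.setArr_arr, if_true, e8]
          refine ⟨fun x hxM hxi => ?_, fun _ => .inr ⟨⟨j, hj⟩, hjM, ?_, hEij, fun y' _ _ h => ?_⟩⟩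
          · rw [Function.update_of_ne (by omega)]
            exact hJ.1 x hxM hxi
          · simp
          · exact Fin.le_def.2 (by simp; omega)
        · intro hz
          have hEij : ¬ E ⟨i, hi⟩ ⟨j, hj⟩ := fun h => e₃.2 h hz
          have hne : ∀ y', E ⟨i, hi⟩ y' → y'.val ≠ j := fun y' hy' e => hEij (by
            have : y' = ⟨j, hj⟩ := Fin.ext e
            rwa [← this])
          simp only [Mem.setReg_arr, e8]
          refine ⟨hJ.1, fun hiM => (hJ.2 hiM).imp ?_ ?_⟩
          · intro h y' hy' hEy hlt
            exact h y' hy' hEy (by have := hne y' hEy; omega)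
          · rintro ⟨y, h1, h2, h3, h4⟩
            exact ⟨y, h1, h2, h3, fun y' hy' hEy hlt => h4 y' hy' hEy (by have := hne y' hEy; omega)⟩
      · intro h0
        have h0 := fun h => hcond.2 h h0
        simp only [Mem.setReg_arr]
        refine ⟨hJ.1, fun hiM => ?_⟩
        have hne : ∀ y' ∈ M, y'.val ≠ j := fun y' hy' e => h0 ⟨hiM, by
            have : y' = ⟨j, hj⟩ := Fin.ext e
            rwa [← this]⟩
        refine (hJ.2 hiM).imp ?_ ?_
        · intro h y' hy' hEy hlt
          exact h y' hy' hEy (by have := hne y' hy'; omega)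
        · rintro ⟨y, h1, h2, h3, h4⟩
          exact ⟨y, h1, h2, h3, fun y' hy' hEy hlt => h4 y' hy' hEy (by have := hne y' hy'; omega)⟩
    · intro t s'' _ hag' hJ x hxM hxi
      rw [Mem.setReg_arr]
      by_cases he : x = ⟨i, hi⟩
      · subst he
        rw [hc'.rows.1] at hJ
        rcases hJ.2 hxM with h | ⟨y, h1, h2, h3, h4⟩
        · exact (h _ hxM (hE.refl _ hxM) hi).elim
        · exact ⟨y, h1, h2, h3, fun y' hy' hEy => h4 y' hy' hEy y'.2⟩
      · have : x.val ≠ i := fun e => he (Fin.ext e)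
        exact hJ.1 x hxM (by omega)
  · intro t s' _ hag hI
    have : ∀ x : Fin n, ∃ y : Fin n, x ∈ M → y ∈ M ∧ s'.arr 8 x = y ∧ E x y ∧
        ∀ y' ∈ M, E x y' → y' ≤ y := fun x => by
      by_cases hxM : x ∈ M
      · obtain ⟨y, h1, h⟩ := hI x hxM (by rw [hc₂.rows.1]; exact x.2)
        exact ⟨y, fun _ => ⟨h1, h⟩⟩
      · exact ⟨x, fun h => absurd h hxM⟩
    choose lab hlab using this
    exact ⟨E, lab, hE, fun x hx => ⟨(hlab x hx).2.1, (hlab x hx).1, (hlab x hx).2.2⟩⟩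


/-! ### Numbering the classes -/

section Classes

variable {n w : ℕ} {A : Fin n → Fin n → Prop} {M : Finset (Fin n)} {E : Fin n → Fin n → Prop}
  {lab : Fin n → Fin n}

/-- The vertices that are their own label. -/
def labels (M : Finset (Fin n)) (lab : Fin n → Fin n) : Finset (Fin n) :=
  M.filter fun x => lab x = x

/-- The number of the class of a vertex. -/
def classIndex (M : Finset (Fin n)) (lab : Fin n → Fin n) (x : Fin n) : ℕ :=
  ((labels M lab).filter (· < lab x)).card

/-- Symmetry and transitivity of `E` on `M` make each of two related labels a competitor for the
other maximum, so both maxima coincide. -/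
theorem lab_eq_iff (hE : IsSplitting A w M E) (hlab : ∀ x ∈ M, lab x ∈ M ∧ E x (lab x) ∧
    ∀ y ∈ M, E x y → y ≤ lab x) {x y : Fin n} (hx : x ∈ M) (hy : y ∈ M) :
    lab x = lab y ↔ E x y := by
  have key : ∀ x ∈ M, ∀ y ∈ M, E x y → lab x ≤ lab y := by
    intro x hx y hy h
    refine (hlab y hy).2.2 _ (hlab x hx).1 ?_
    exact hE.trans y hy x hx _ (hlab x hx).1 (hE.symm x hx y hy h) (hlab x hx).2.1
  constructor
  · intro h
    have h1 := (hlab x hx).2.1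
    rw [h] at h1
    exact hE.trans x hx _ (hlab y hy).1 y hy h1 (hE.symm y hy _ (hlab y hy).1 (hlab y hy).2.1)
  · intro h
    exact le_antisymm (key x hx y hy h) (key y hy x hx (hE.symm x hx y hy h))

theorem lab_mem_labels (hE : IsSplitting A w M E) (hlab : ∀ x ∈ M, lab x ∈ M ∧ E x (lab x) ∧
    ∀ y ∈ M, E x y → y ≤ lab x) {x : Fin n} (hx : x ∈ M) : lab x ∈ labels M lab :=
  Finset.mem_filter.2 ⟨(hlab x hx).1,
    ((lab_eq_iff hE hlab hx (hlab x hx).1).2 (hlab x hx).2.1).symm⟩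

theorem classIndex_lt (hE : IsSplitting A w M E) (hlab : ∀ x ∈ M, lab x ∈ M ∧ E x (lab x) ∧
    ∀ y ∈ M, E x y → y ≤ lab x) {x : Fin n} (hx : x ∈ M) :
    classIndex M lab x < (labels M lab).card :=
  Finset.card_lt_card ⟨Finset.filter_subset _ _, fun h => by
    have := h (lab_mem_labels hE hlab hx)
    simp at this⟩

theorem classIndex_eq_iff (hE : IsSplitting A w M E) (hlab : ∀ x ∈ M, lab x ∈ M ∧ E x (lab x) ∧
    ∀ y ∈ M, E x y → y ≤ lab x) {x y : Fin n} (hx : x ∈ M) (hy : y ∈ M) :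
    classIndex M lab x = classIndex M lab y ↔ E x y := by
  rw [← lab_eq_iff hE hlab hx hy]
  have key : ∀ x ∈ M, ∀ y, lab x < lab y → classIndex M lab x < classIndex M lab y := by
    intro x hx y h
    refine Finset.card_lt_card ⟨fun z hz => ?_, fun hsub => ?_⟩
    · rw [Finset.mem_filter] at hz ⊢
      exact ⟨hz.1, hz.2.trans h⟩
    · have := hsub (Finset.mem_filter.2 ⟨lab_mem_labels hE hlab hx, h⟩)
      simp at this
  constructor
  · intro h
    rcases lt_trichotomy (lab x) (lab y) with h' | h' | h'
    · exact absurd h (key x hx y h').ne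
    · exact h'
    · exact absurd h (key y hy x h').ne'
  · intro h
    rw [classIndex, classIndex, h]

/-- On the labels the index is injective with values in a range of the same cardinality, hence
surjective. No child of a node is empty. -/
theorem exists_classIndex_eq (hE : IsSplitting A w M E) (hlab : ∀ x ∈ M, lab x ∈ M ∧ E x (lab x) ∧
    ∀ y ∈ M, E x y → y ≤ lab x) {i : ℕ} (hi : i < (labels M lab).card) :
    ∃ x ∈ M, classIndex M lab x = i := by
  have hsub : (labels M lab).image (classIndex M lab) ⊆ Finset.range (labels M lab).card := by
    intro j hj
    obtain ⟨x, hx, rfl⟩ := Finset.mem_image.1 hj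
    exact Finset.mem_range.2 (classIndex_lt hE hlab (Finset.mem_filter.1 hx).1)
  have hinj : Set.InjOn (classIndex M lab) (labels M lab) := by
    intro x hx y hy h
    have hx := Finset.mem_filter.1 hx
    have hy := Finset.mem_filter.1 hy
    rw [classIndex_eq_iff hE hlab hx.1 hy.1, ← lab_eq_iff hE hlab hx.1 hy.1, hx.2, hy.2] at h
    exact h
  have := Finset.eq_of_subset_of_card_le hsub
    (by rw [Finset.card_image_of_injOn hinj, Finset.card_range])
  rw [← Finset.mem_range, ← this] at hi
  obtain ⟨x, hx, h⟩ := Finset.mem_image.1 hi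
  exact ⟨x, (Finset.mem_filter.1 hx).1, h⟩

theorem two_le_card_labels (hE : IsSplitting A w M E) (hlab : ∀ x ∈ M, lab x ∈ M ∧ E x (lab x) ∧
    ∀ y ∈ M, E x y → y ≤ lab x) : 2 ≤ (labels M lab).card := by
  obtain ⟨x, hx, y, hy, h⟩ := hE.nontrivial
  rw [← lab_eq_iff hE hlab hx hy] at h
  exact Finset.one_lt_card.2 ⟨_, lab_mem_labels hE hlab hx, _, lab_mem_labels hE hlab hy, h⟩

/-- Vertices of equal colour are related and so have equal labels. The colouring is therefore
injective on the labels. -/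
theorem card_labels_le (hE : IsSplitting A w M E) (hlab : ∀ x ∈ M, lab x ∈ M ∧ E x (lab x) ∧
    ∀ y ∈ M, E x y → y ≤ lab x) : (labels M lab).card ≤ w := by
  obtain ⟨l, col, hl, hcol⟩ := hE.bound
  refine le_trans ?_ hl
  have := Finset.card_le_card_of_injOn (s := labels M lab) (t := Finset.univ) col (by simp) ?_
  · simpa using this
  · intro x hx y hy h
    have hx := Finset.mem_filter.1 hx
    have hy := Finset.mem_filter.1 hy
    have := (lab_eq_iff hE hlab hx.1 hy.1).2 (hcol x hx.1 y hy.1 h)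
    rwa [hx.2, hy.2] at this

end Classes

variable {n : ℕ} {A : Fin n → Fin n → Prop} {s : Mem}

/-- Numbers the classes of the node. -/
def numberProg : Cmd :=
  forLoop 8 0 (.cond
    (.and (.eq (.get 5 (.reg 8)) (.reg 6)) (.eq (.get 8 (.reg 8)) (.reg 8)))
    (.seq (.write 9 (.reg 8) (.reg 3)) (.assign 3 (.add (.reg 3) (.const 1)))) .skip)

theorem card_filter_lt_succ {F : Finset (Fin n)} {i : ℕ} (hi : i < n) :
    (F.filter fun x => x.val < i + 1).card =
      (F.filter fun x => x.val < i).card + if (⟨i, hi⟩ : Fin n) ∈ F then 1 else 0 := by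
  split_ifs with h
  · rw [← Finset.card_insert_of_notMem (a := (⟨i, hi⟩ : Fin n)) (by simp)]
    congr 1
    ext x
    simp only [Finset.mem_filter, Finset.mem_insert, Fin.ext_iff]
    constructor
    · rintro ⟨h1, h2⟩
      by_cases hx : x.val = i
      · exact .inl hx
      · exact .inr ⟨h1, by omega⟩
    · rintro (hx | ⟨h1, h2⟩)
      · have : x = ⟨i, hi⟩ := Fin.ext hx
        exact ⟨this ▸ h, by omega⟩
      · exact ⟨h1, by omega⟩
  · rw [add_zero]
    congr 1
    ext x
    simp only [Finset.mem_filter]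
    refine and_congr_right fun hx => ?_
    have : x.val ≠ i := fun e => h (by rwa [show (⟨i, hi⟩ : Fin n) = x from Fin.ext e.symm])
    omega

/-- Register `3` is the next unused node number and labels are met in increasing order, so a label
receives the old value of this register plus its rank, which is the class index. -/
theorem numberProg_spec {M : Finset (Fin n)} {lab : Fin n → Fin n} (hc : NodeCtx A M s)
    (hlab : ∀ x ∈ M, s.arr 8 x = lab x) :
    Ends numberProg s fun _ s' => s'.reg 3 = s.reg 3 + (labels M lab).card ∧
      ∀ x ∈ labels M lab, s'.arr 9 x = s.reg 3 + ((labels M lab).filter (· < x)).card := by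
  refine Ends.forLoop (fun i s' =>
    s'.reg 3 = s.reg 3 + ((labels M lab).filter fun x => x.val < i).card ∧
      ∀ x ∈ labels M lab, x.val < i →
        s'.arr 9 x = s.reg 3 + ((labels M lab).filter (· < x)).card) ?_ ?_ ?_
  · simp
  · rintro i s' hi hx hag ⟨h1, h2⟩
    rw [hc.rows.1] at hi
    have e6 : s'.reg 6 = s.reg 6 := hag.reg 6 (by decide)
    have e5 : s'.arr 5 = s.arr 5 := hag.arr 5 (by decide)
    have e8 : s'.arr 8 = s.arr 8 := hag.arr 8 (by decide)
    have hcond : (Expr.and (.eq (.get 5 (.reg 8)) (.reg 6)) (.eq (.get 8 (.reg 8)) (.reg 8))).val s'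
        ≠ 0 ↔ (⟨i, hi⟩ : Fin n) ∈ labels M lab := by
      have := hc.mem ⟨i, hi⟩
      simp only [Expr.val_and, Expr.val_eq, Expr.val_get, Expr.val_reg, hx, e6, e5, e8, ne_eq,
        bit_eq_zero, not_not, labels, Finset.mem_filter]
      rw [this, Finset.mem_coe]
      refine and_congr_right fun hM => ?_
      have := hlab _ hM
      simp only at this
      rw [this, Fin.ext_iff]
    rw [Ends.cond_iff, hcond]
    simp only [Ends.seq_iff, Ends.write_iff, Ends.assign_iff, Ends.skip_iff]
    constructor
    · intro hF
      simp only [Expr.val_reg, hx, Expr.val_add, Expr.val_const, Mem.setReg_arr, Mem.setReg_reg,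
        Mem.setArr_arr, Mem.setArr_reg, if_true, h1, card_filter_lt_succ hi, if_pos hF]
      refine ⟨by simp; omega, fun x hx' hxi => ?_⟩
      by_cases he : x.val = i
      · have : x = ⟨i, hi⟩ := Fin.ext he
        subst this
        simp [Fin.lt_def]
      · rw [Function.update_of_ne he]
        exact h2 x hx' (by omega)
    · intro h0
      have h0 : (⟨i, hi⟩ : Fin n) ∉ labels M lab := fun h => hcond.2 h h0
      simp only [Mem.setReg_arr, Mem.setReg_reg, h1, card_filter_lt_succ hi, if_neg h0]
      refine ⟨by simp, fun x hx' hxi => h2 x hx' ?_⟩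
      have : x.val ≠ i := fun e => h0 (by rwa [show (⟨i, hi⟩ : Fin n) = x from Fin.ext e.symm])
      omega
  · rintro t s' _ hag ⟨h1, h2⟩
    rw [hc.rows.1] at h1 h2
    exact ⟨by rw [h1]; simp, fun x hx => h2 x hx x.2⟩

/-- Moves the vertices of the node to its children. -/
def reassignProg : Cmd :=
  forLoop 8 0 (.cond (.eq (.get 5 (.reg 8)) (.reg 6))
    (.write 5 (.reg 8) (.get 9 (.get 8 (.reg 8)))) .skip)

theorem reassignProg_spec {M : Finset (Fin n)} {lab : Fin n → Fin n} (hc : NodeCtx A M s)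
    (hlab : ∀ x ∈ M, s.arr 8 x = lab x) :
    Ends reassignProg s fun _ s' => ∀ x : Fin n, (x ∈ M → s'.arr 5 x = s.arr 9 (lab x)) ∧
      (x ∉ M → s'.arr 5 x = s.arr 5 x) := by
  refine Ends.forLoop (fun i s' => ∀ x : Fin n,
      (x ∈ M ∧ x.val < i → s'.arr 5 x = s.arr 9 (lab x)) ∧
      (¬ (x ∈ M ∧ x.val < i) → s'.arr 5 x = s.arr 5 x)) ?_ ?_ ?_
  · simp
  · rintro i s' hi hx hag hI
    rw [hc.rows.1] at hi
    have e6 : s'.reg 6 = s.reg 6 := hag.reg 6 (by decide)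
    have e9 : s'.arr 9 = s.arr 9 := hag.arr 9 (by decide)
    have e8 : s'.arr 8 = s.arr 8 := hag.arr 8 (by decide)
    have hcond : (Expr.eq (.get 5 (.reg 8)) (.reg 6)).val s' ≠ 0 ↔ (⟨i, hi⟩ : Fin n) ∈ M := by
      have h1 := hc.mem ⟨i, hi⟩
      have h2 := (hI ⟨i, hi⟩).2 (by simp)
      simp only at h1 h2
      simp only [Expr.val_eq, Expr.val_get, Expr.val_reg, hx, e6, h2, ne_eq,
        bit_eq_zero, not_not, h1, Finset.mem_coe]
    rw [Ends.cond_iff, hcond]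
    simp only [Ends.write_iff, Ends.skip_iff]
    constructor
    · intro hM x
      have hl := hlab _ hM
      simp only at hl
      simp only [Expr.val_reg, hx, Expr.val_get, Mem.setReg_arr, Mem.setArr_arr, if_true, e8, e9, hl]
      by_cases he : x.val = i
      · have : x = ⟨i, hi⟩ := Fin.ext he
        subst this
        simp [hM]
      · rw [Function.update_of_ne he]
        exact ⟨fun h => (hI x).1 ⟨h.1, by omega⟩, fun h => (hI x).2 fun h' => h ⟨h'.1, by omega⟩⟩
    · intro h0 x
      have h0 : (⟨i, hi⟩ : Fin n) ∉ M := fun h => hcond.2 h h0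
      rw [Mem.setReg_arr]
      refine ⟨fun h => (hI x).1 ⟨h.1, ?_⟩, fun h => (hI x).2 fun h' => h ⟨h'.1, by omega⟩⟩
      have : x.val ≠ i := fun e => h0 (by rw [show (⟨i, hi⟩ : Fin n) = x from Fin.ext e.symm]; exact h.1)
      omega
  · rintro t s' _ hag hI x
    rw [hc.rows.1] at hI
    exact ⟨fun h => (hI x).1 ⟨h, x.2⟩, fun h => (hI x).2 fun h' => h h'.1⟩

/-- Computes the size and a representative of the node. -/
def sizeProg : Cmd :=
  .seq (.write 12 (.reg 6) (.const 0))
    (forLoop 8 0 (.cond (.eq (.get 5 (.reg 8)) (.reg 6))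
      (.seq (.write 13 (.reg 6) (.reg 8))
        (.write 12 (.reg 6) (.add (.get 12 (.reg 6)) (.const 1)))) .skip))

theorem sizeProg_spec {M : Finset (Fin n)} (hc : NodeCtx A M s) (hM : M.Nonempty) :
    Ends sizeProg s fun _ s' => s'.arr 12 (s.reg 6) = M.card ∧
      (∃ v ∈ M, s'.arr 13 (s.reg 6) = (v : ℕ)) ∧
      ∀ j, j ≠ s.reg 6 → s'.arr 12 j = s.arr 12 j ∧ s'.arr 13 j = s.arr 13 j := by
  rw [sizeProg, Ends.seq_iff, Ends.write_iff]
  refine Ends.forLoop (fun i s' => s'.arr 12 (s.reg 6) = (M.filter fun x => x.val < i).card ∧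
      ((∃ v ∈ M, s'.arr 13 (s.reg 6) = (v : ℕ)) ∨ ∀ v ∈ M, ¬ v.val < i) ∧
      ∀ j, j ≠ s.reg 6 → s'.arr 12 j = s.arr 12 j ∧ s'.arr 13 j = s.arr 13 j) ?_ ?_ ?_
  · refine ⟨by simp, .inr (by simp), fun j hj => ?_⟩
    simp [Function.update_of_ne hj]
  · rintro i s' hi hx hag ⟨h1, h2, h3⟩
    rw [Mem.setArr_reg, hc.rows.1] at hi
    have e6 : s'.reg 6 = s.reg 6 := hag.reg 6 (by decide)
    have e5 : s'.arr 5 = s.arr 5 := hag.arr 5 (by decide)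
    have hcond : (Expr.eq (.get 5 (.reg 8)) (.reg 6)).val s' ≠ 0 ↔ (⟨i, hi⟩ : Fin n) ∈ M := by
      have h1 := hc.mem ⟨i, hi⟩
      simp only at h1
      simp only [Expr.val_eq, Expr.val_get, Expr.val_reg, hx, e6, e5, ne_eq,
        bit_eq_zero, not_not, h1, Finset.mem_coe]
    rw [Ends.cond_iff, hcond]
    simp only [Ends.seq_iff, Ends.write_iff, Ends.skip_iff]
    constructor
    · intro hiM
      simp only [Expr.val_reg, hx, e6, Expr.val_add, Expr.val_get, Expr.val_const, Mem.setReg_arr,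
        Mem.setArr_reg, Mem.setArr_arr, card_filter_lt_succ hi, if_pos hiM]
      refine ⟨by simp [h1], .inl ⟨_, hiM, by simp⟩, fun j hj => ?_⟩
      simp [Function.update_of_ne hj, h3 j hj]
    · intro h0
      have h0 : (⟨i, hi⟩ : Fin n) ∉ M := fun h => hcond.2 h h0
      simp only [Mem.setReg_arr, card_filter_lt_succ hi, if_neg h0]
      refine ⟨h1, h2.imp id fun h v hv hlt => h v hv ?_, h3⟩
      have : v.val ≠ i := fun e => h0 (by rwa [show (⟨i, hi⟩ : Fin n) = v from Fin.ext e.symm])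
      omega
  · rintro t s' _ hag ⟨h1, h2, h3⟩
    rw [Mem.setArr_reg, hc.rows.1] at h1 h2
    refine ⟨by rw [h1]; simp, h2.resolve_right fun h => ?_, h3⟩
    obtain ⟨v, hv⟩ := hM
    exact h v hv v.2

/-! ### The decomposition tree -/

/-- The first `k` nodes of the decomposition tree have been processed.  `M j` is the vertex set of
node `j`, register `3` holds the number of nodes, array `5` the unprocessed node or leaf of a vertex,
the arrays `10` and `11` the first child and the number of children of a node, the arrays `12` and
`13` its size and a representative. -/
structure PartialTree (A : Fin n → Fin n → Prop) (w k : ℕ) (M : ℕ → Finset (Fin n)) (s : Mem) :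
    Prop where
  le : k ≤ s.reg 3
  root : M 0 = Finset.univ
  total : s.reg 3 = 1 + ∑ j ∈ Finset.range k, s.arr 11 j
  first : ∀ j < k, s.arr 10 j = 1 + ∑ i ∈ Finset.range j, s.arr 11 i
  lt_first : ∀ j < k, j < s.arr 10 j
  size : ∀ j < k, s.arr 12 j = (M j).card
  rep : ∀ j < k, ∃ v ∈ M j, s.arr 13 j = (v : ℕ)
  leaf : ∀ j < k, s.arr 11 j = 0 → (M j).card = 1
  width : ∀ j < k, s.arr 11 j ≠ 0 → 2 ≤ s.arr 11 j ∧ s.arr 11 j ≤ w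
  split : ∀ j < k, s.arr 11 j ≠ 0 → ∃ col : Fin n → ℕ, Uniform A (M j) col ∧
    (∀ x ∈ M j, col x < s.arr 11 j) ∧
    ∀ i < s.arr 11 j, M (s.arr 10 j + i) = (M j).filter fun x => col x = i
  nonempty : ∀ j < s.reg 3, (M j).Nonempty
  part : ∀ j, k ≤ j → j < s.reg 3 → ∀ v : Fin n, v ∈ M j ↔ s.arr 5 v = j
  part_lt : ∀ v : Fin n, s.arr 5 v < s.reg 3
  count : s.reg 3 + 1 ≤ 2 * (Finset.univ.image fun v : Fin n => s.arr 5 v).card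

/-- Nodes are numbered in the order of their creation, so the children of `k` occupy the next `q`
numbers and are defined there as the colour classes of `M k`. A leaf corresponds to `q = 0` and
creates nothing. -/
theorem PartialTree.step {w k q : ℕ} {M : ℕ → Finset (Fin n)} {s s' : Mem}
    (h : PartialTree A w k M s) (hk : k < s.reg 3) (h3 : s'.reg 3 = s.reg 3 + q)
    (h10 : s'.arr 10 = Function.update (s.arr 10) k (s.reg 3))
    (h11 : s'.arr 11 = Function.update (s.arr 11) k q)
    (h12 : s'.arr 12 k = (M k).card) (h13 : ∃ v ∈ M k, s'.arr 13 k = (v : ℕ))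
    (h1213 : ∀ j, j ≠ k → s'.arr 12 j = s.arr 12 j ∧ s'.arr 13 j = s.arr 13 j)
    (hq : q = 0 ∧ (M k).card = 1 ∧ s'.arr 5 = s.arr 5 ∨
      2 ≤ q ∧ q ≤ w ∧ ∃ col : Fin n → ℕ, Uniform A (M k) col ∧ (∀ x ∈ M k, col x < q) ∧
        (∀ i < q, ∃ x ∈ M k, col x = i) ∧ (∀ x ∈ M k, s'.arr 5 x = s.reg 3 + col x) ∧
        ∀ x ∉ M k, s'.arr 5 x = s.arr 5 x) :
    ∃ M', PartialTree A w (k + 1) M' s' := by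
  have e10 : ∀ j < k, s'.arr 10 j = s.arr 10 j := fun j hj => by
    rw [h10, Function.update_of_ne hj.ne]
  have e11 : ∀ j < k, s'.arr 11 j = s.arr 11 j := fun j hj => by
    rw [h11, Function.update_of_ne hj.ne]
  have e10k : s'.arr 10 k = s.reg 3 := by rw [h10, Function.update_self]
  have e11k : s'.arr 11 k = q := by rw [h11, Function.update_self]
  have sum : ∀ j ≤ k, ∑ i ∈ Finset.range j, s'.arr 11 i = ∑ i ∈ Finset.range j, s.arr 11 i :=
    fun j hj => Finset.sum_congr rfl fun i hi => e11 i (by have := Finset.mem_range.1 hi; omega)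
  have hcl : ∃ col : Fin n → ℕ, q ≠ 0 → 2 ≤ q ∧ q ≤ w ∧ Uniform A (M k) col ∧
      (∀ x ∈ M k, col x < q) ∧ (∀ i < q, ∃ x ∈ M k, col x = i) ∧
      (∀ x ∈ M k, s'.arr 5 x = s.reg 3 + col x) ∧ ∀ x ∉ M k, s'.arr 5 x = s.arr 5 x := by
    rcases hq with hq | ⟨hq, hqw, col, hcol⟩
    · exact ⟨fun _ => 0, fun h => absurd hq.1 h⟩
    · exact ⟨col, fun _ => ⟨hq, hqw, hcol⟩⟩
  obtain ⟨col, hcol⟩ := hcl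
  have hchild : ∀ j < k, ∀ i < s.arr 11 j, s.arr 10 j + i < s.reg 3 := by
    intro j hj i hi
    rw [h.first j hj, h.total]
    have := Finset.sum_le_sum_of_subset (f := s.arr 11)
      (Finset.range_subset_range.2 (show j + 1 ≤ k from hj))
    rw [Finset.sum_range_succ] at this
    omega
  refine ⟨fun j => if j < s.reg 3 then M j else (M k).filter fun x => col x = j - s.reg 3, ?_⟩
  constructor
  · omega
  · rw [if_pos (by omega)]; exact h.root
  · rw [Finset.sum_range_succ, sum k le_rfl, e11k, h3, h.total]; ring
  · intro j hj
    rw [sum j (by omega)]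
    rcases Nat.lt_succ_iff_lt_or_eq.1 hj with hj | rfl
    · rw [e10 j hj, h.first j hj]
    · rw [e10k, h.total]
  · intro j hj
    rcases Nat.lt_succ_iff_lt_or_eq.1 hj with hj | rfl
    · rw [e10 j hj]; exact h.lt_first j hj
    · rw [e10k]; exact hk
  · intro j hj
    rw [if_pos (by omega)]
    rcases Nat.lt_succ_iff_lt_or_eq.1 hj with hj | rfl
    · rw [(h1213 j hj.ne).1]; exact h.size j hj
    · exact h12
  · intro j hj
    simp only [if_pos (show j < s.reg 3 by omega)]
    rcases Nat.lt_succ_iff_lt_or_eq.1 hj with hj | rfl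
    · rw [(h1213 j hj.ne).2]; exact h.rep j hj
    · exact h13
  · intro j hj h0
    rw [if_pos (by omega)]
    rcases Nat.lt_succ_iff_lt_or_eq.1 hj with hj | rfl
    · exact h.leaf j hj (by rwa [e11 j hj] at h0)
    · rw [e11k] at h0
      rcases hq with hq | hq
      · exact hq.2.1
      · omega
  · intro j hj h0
    rcases Nat.lt_succ_iff_lt_or_eq.1 hj with hj | rfl
    · rw [e11 j hj] at h0 ⊢; exact h.width j hj h0
    · rw [e11k] at h0 ⊢; exact ⟨(hcol h0).1, (hcol h0).2.1⟩
  · intro j hj h0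
    simp only [if_pos (show j < s.reg 3 by omega)]
    rcases Nat.lt_succ_iff_lt_or_eq.1 hj with hj | rfl
    · rw [e11 j hj] at h0 ⊢
      rw [e10 j hj]
      obtain ⟨c, h1, h2, h3⟩ := h.split j hj h0
      exact ⟨c, h1, h2, fun i hi => by rw [if_pos (hchild j hj i hi)]; exact h3 i hi⟩
    · rw [e11k] at h0 ⊢
      rw [e10k]
      obtain ⟨h1, h2, h3, h4, h5, h6, h7⟩ := hcol h0
      refine ⟨col, h3, h4, fun i hi => ?_⟩
      rw [if_neg (by omega)]
      simp
  · intro j hj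
    split_ifs with hlt
    · exact h.nonempty j hlt
    · obtain ⟨x, hx, hxi⟩ := (hcol (by omega)).2.2.2.2.1 (j - s.reg 3) (by omega)
      exact ⟨x, Finset.mem_filter.2 ⟨hx, hxi⟩⟩
  · intro j hkj hj v
    have hpart := h.part k le_rfl hk v
    split_ifs with hlt
    · rw [h.part j (by omega) hlt v]
      rcases hq with hq | ⟨hq, _⟩
      · rw [hq.2.2]
      · obtain ⟨h1, h2, h3, h4, h5, h6, h7⟩ := hcol (by omega)
        by_cases hv : v ∈ M k
        · rw [hpart.1 hv, h6 v hv]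
          omega
        · rw [h7 v hv]
    · obtain ⟨h1, h2, h3, h4, h5, h6, h7⟩ := hcol (by omega)
      rw [Finset.mem_filter]
      constructor
      · rintro ⟨hv, hvj⟩
        rw [h6 v hv]; omega
      · intro hv
        have hvM : v ∈ M k := by
          by_contra hcon
          rw [h7 v hcon] at hv
          have := h.part_lt v
          omega
        rw [h6 v hvM] at hv
        exact ⟨hvM, by omega⟩
  · intro v
    rcases hq with hq | ⟨hq, _⟩
    · rw [hq.2.2, h3]; have := h.part_lt v; omega
    · obtain ⟨h1, h2, _, h4, h5, h6, h7⟩ := hcol (by omega)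
      by_cases hv : v ∈ M k
      · rw [h6 v hv, h3]; have := h4 v hv; omega
      · rw [h7 v hv, h3]; have := h.part_lt v; omega
  · rcases hq with hq | ⟨hq, _⟩
    · rw [hq.2.2, h3, hq.1]; exact h.count
    · obtain ⟨h1, h2, _, h4, h5, h6, h7⟩ := hcol (by omega)
      -- The split gives up at most the value `k` and gains `q` new ones. So the number of parts
      -- grows by at least `q - 1`, and `q ≤ 2 * (q - 1)` for `q ≥ 2` preserves the inequality of
      -- `count`.
      have hsub : ((Finset.univ.image fun v : Fin n => s.arr 5 v).erase k) ∪
          (Finset.Ico (s.reg 3) (s.reg 3 + q)) ⊆ Finset.univ.image fun v : Fin n => s'.arr 5 v := by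
        intro j hj
        rcases Finset.mem_union.1 hj with hj | hj
        · obtain ⟨hjk, hj⟩ := Finset.mem_erase.1 hj
          obtain ⟨v, -, rfl⟩ := Finset.mem_image.1 hj
          refine Finset.mem_image.2 ⟨v, Finset.mem_univ _, h7 v fun hv => hjk ?_⟩
          exact (h.part k le_rfl hk v).1 hv
        · rw [Finset.mem_Ico] at hj
          obtain ⟨v, hv, hvj⟩ := h5 (j - s.reg 3) (by omega)
          refine Finset.mem_image.2 ⟨v, Finset.mem_univ _, ?_⟩
          rw [h6 v hv]; omega
      have hdisj : Disjoint ((Finset.univ.image fun v : Fin n => s.arr 5 v).erase k)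
          (Finset.Ico (s.reg 3) (s.reg 3 + q)) := by
        rw [Finset.disjoint_left]
        intro j hj hj'
        obtain ⟨hjk, hj⟩ := Finset.mem_erase.1 hj
        obtain ⟨v, -, rfl⟩ := Finset.mem_image.1 hj
        rw [Finset.mem_Ico] at hj'
        have := h.part_lt v
        omega
      have hcard := Finset.card_le_card hsub
      rw [Finset.card_union_of_disjoint hdisj, Nat.card_Ico] at hcard
      have := Finset.pred_card_le_card_erase (s := Finset.univ.image fun v : Fin n => s.arr 5 v) (a := k)
      have := h.count
      omega

/-- Processes the node in register `6`. -/
def nodeProg : Cmd :=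
  .seq (.write 10 (.reg 6) (.reg 3))
    (.seq sizeProg
      (.seq (.cond (.sub (.get 12 (.reg 6)) (.const 1))
          (.seq labelProg (.seq numberProg reassignProg)) .skip)
        (.write 11 (.reg 6) (.sub (.reg 3) (.get 10 (.reg 6))))))

/-- The decomposition of the whole vertex set restricts to `M k` by `Dec.subset`, so the number of
children is bounded by the same `w` at every node. -/
theorem nodeProg_spec {w k : ℕ} {M : ℕ → Finset (Fin n)} (hA : ∀ x y, A x y → A y x) (hw : 2 ≤ w)
    (hd : Dec w A Set.univ) (hrows : HasRows n s) (hmat : HasMatrix 3 A s)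
    (h : PartialTree A w k M s) (hk6 : s.reg 6 = k) (hk : k < s.reg 3) :
    Ends nodeProg s fun _ s' => ∃ M', PartialTree A w (k + 1) M' s' := by
  have hc : NodeCtx A (M k) s := ⟨hrows, hmat, fun x => by
    rw [hk6]; exact (h.part k le_rfl hk x).symm⟩
  rw [nodeProg, Ends.seq_iff, Ends.write_iff]
  simp only [Expr.val_reg, hk6]
  have hc₁ : NodeCtx A (M k) (s.setArr 10 k (s.reg 3)) := ⟨hrows, hmat, hc.mem⟩
  rw [Ends.seq_iff]
  refine (sizeProg_spec hc₁ (h.nonempty k hk)).conseq fun _ s₂ a₂ ⟨e1, e2, e3⟩ => ?_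
  rw [Mem.setArr_reg, hk6] at e1 e2 e3
  have hc₂ := hc₁.congr a₂
  have k₂ : s₂.reg 6 = k := (a₂.reg 6 (by decide)).trans hk6
  have m₂ : s₂.reg 3 = s.reg 3 := (a₂.reg 3 (by decide)).trans rfl
  have p₂ : s₂.arr 5 = s.arr 5 := (a₂.arr 5 (by decide)).trans rfl
  rw [Ends.seq_iff]
  have key : Ends (.cond (.sub (.get 12 (.reg 6)) (.const 1))
      (.seq labelProg (.seq numberProg reassignProg)) .skip) s₂ fun _ s₃ =>
      ∃ q, s₃.reg 3 = s.reg 3 + q ∧ (q = 0 ∧ (M k).card = 1 ∧ s₃.arr 5 = s.arr 5 ∨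
      2 ≤ q ∧ q ≤ w ∧ ∃ col : Fin n → ℕ, Uniform A (M k) col ∧ (∀ x ∈ M k, col x < q) ∧
        (∀ i < q, ∃ x ∈ M k, col x = i) ∧ (∀ x ∈ M k, s₃.arr 5 x = s.reg 3 + col x) ∧
        ∀ x ∉ M k, s₃.arr 5 x = s.arr 5 x) := by
    simp only [Ends.cond_iff, Expr.val_sub, Expr.val_get, Expr.val_reg, Expr.val_const, k₂, e1,
      Ends.skip_iff]
    constructor
    · intro hlt
      obtain ⟨v, hv, hrep⟩ := e2
      have hn : (M k : Set (Fin n)).Nontrivial := Finset.one_lt_card_iff_nontrivial.1 (by omega)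
      rw [Ends.seq_iff]
      refine (labelProg_spec hA hw (hd.subset (Set.subset_univ _)) hn hc₂ hv (by rw [k₂]; exact hrep)
        ).conseq fun _ s₃ a₃ ⟨E, lab, hE, hlab⟩ => ?_
      have hlab' : ∀ x ∈ M k, lab x ∈ M k ∧ E x (lab x) ∧ ∀ y ∈ M k, E x y → y ≤ lab x :=
        fun x hx => (hlab x hx).2
      have hc₃ := hc₂.congr a₃
      rw [Ends.seq_iff]
      refine (numberProg_spec hc₃ fun x hx => (hlab x hx).1).conseq fun _ s₄ a₄ ⟨f1, f2⟩ => ?_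
      have hc₄ := hc₃.congr a₄
      refine (reassignProg_spec (lab := lab) hc₄ fun x hx => ?_).conseq fun _ s₅ a₅ g => ?_
      · rw [a₄.arr 8 (by decide)]; exact (hlab x hx).1
      have m₃ : s₃.reg 3 = s.reg 3 := (a₃.reg 3 (by decide)).trans m₂
      refine ⟨(labels (M k) lab).card, ?_, .inr ⟨two_le_card_labels hE hlab', card_labels_le hE hlab',
        classIndex (M k) lab, ?_, fun x hx => classIndex_lt hE hlab' hx,
        fun i hi => exists_classIndex_eq hE hlab' hi, fun x hx => ?_, fun x hx => ?_⟩⟩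
      · rw [a₅.reg 3 (by decide), f1, m₃]
      · exact hE.uniform _ fun x hx y hy => classIndex_eq_iff hE hlab' hx hy
      · rw [(g x).1 hx, f2 _ (lab_mem_labels hE hlab' hx), m₃]; rfl
      · rw [(g x).2 hx, a₄.arr 5 (by decide), a₃.arr 5 (by decide), p₂]
    · intro hle
      have := Finset.card_pos.2 (h.nonempty k hk)
      exact ⟨0, m₂, .inl ⟨rfl, by omega, p₂⟩⟩
  refine key.conseq fun _ s₃ a₃ ⟨q, h3, hq⟩ => ?_
  rw [Ends.write_iff]
  have k₃ : s₃.reg 6 = k := (a₃.reg 6 (by decide)).trans k₂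
  have e10 : s₃.arr 10 = Function.update (s.arr 10) k (s.reg 3) := by
    rw [a₃.arr 10 (by decide), a₂.arr 10 (by decide)]; simp
  have e11 : s₃.arr 11 = s.arr 11 := by
    rw [a₃.arr 11 (by decide), a₂.arr 11 (by decide)]; rfl
  simp only [Expr.val_reg, Expr.val_sub, Expr.val_get, k₃, e10, h3, Function.update_self]
  refine h.step (q := q) hk h3 (by simpa using e10) ?_ ?_ ?_ ?_ (by simpa using hq)
  · simp [e11]
  · simp only [Mem.setArr_arr]; rw [if_neg (by decide), a₃.arr 12 (by decide)]; exact e1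
  · simp only [Mem.setArr_arr]; rw [if_neg (by decide), a₃.arr 13 (by decide)]; exact e2
  · intro j hj
    simp only [Mem.setArr_arr]
    rw [if_neg (by decide), if_neg (by decide), a₃.arr 12 (by decide), a₃.arr 13 (by decide)]
    exact e3 j hj

/-- The preprocessing. -/
def preProg : Cmd :=
  .seq rowProg (.seq powProg (.seq (.assign 4 (.add (.reg 0) (.reg 0)))
    (.seq (.assign 3 (.const 1)) (forLoop 6 4 (.cond (.sub (.reg 3) (.reg 6)) nodeProg .skip)))))

/-- The memory after the preprocessing. -/
structure Ready (A : Fin n → Fin n → Prop) (w : ℕ) (M : ℕ → Finset (Fin n)) (s : Mem) : Prop where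
  rows : HasRows n s
  mat : HasMatrix 3 A s
  tree : PartialTree A w (s.reg 3) M s

/-- By `count` there are at most `2 * n - 1` nodes, so a loop of `2 * n` iterations reaches all of
them. Once no unprocessed node is left it idles, hence the invariant with `min i (s'.reg 3)`. The
demand register is not touched, which lets the same preprocessing serve the single combined program.
-/
theorem preProg_spec {r w : ℕ} {G : SimpleGraph (Fin n)} (hn : 0 < n) (hs : HasMatrix 0 G.Adj s)
    (h0 : s.reg 0 = n) (h1 : s.reg 1 = r) (hz : ∀ a i, a ≠ 0 → s.arr a i = 0)
    (hw : 2 ≤ w) (hd : Dec w (PowAdj G r) Set.univ) :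
    Ends preProg s fun _ s' => s'.reg 2 = s.reg 2 ∧ ∃ M, Ready (PowAdj G r) w M s' := by
  have : Ends preProg s fun _ s' => ∃ M, Ready (PowAdj G r) w M s' := by
    rw [preProg, Ends.seq_iff]
    refine (rowProg_spec h0).conseq fun _ s₁ a₁ e₁ => ?_
    rw [Ends.seq_iff]
    refine (powProg_spec e₁ ((a₁.reg 1 (by decide)).trans h1) (hs.congr a₁) ?_).conseq
      fun _ s₂ a₂ e₂ => ?_
    · intro i; rw [a₁.arr 3 (by decide), hz 3 i (by decide)]
    have r₂ := e₁.congr a₂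
    rw [Ends.seq_iff, Ends.assign_iff, Ends.seq_iff, Ends.assign_iff]
    have p₂ : ∀ i, s₂.arr 5 i = 0 := fun i => by
      rw [a₂.arr 5 (by decide), a₁.arr 5 (by decide), hz 5 i (by decide)]
    refine Ends.forLoop (fun i s' => ∃ M, PartialTree (PowAdj G r) w (min i (s'.reg 3)) M s') ?_ ?_ ?_
    · refine ⟨fun _ => Finset.univ, ?_⟩
      simp only [Nat.zero_min]
      have hne : (Finset.univ : Finset (Fin n)).Nonempty := ⟨⟨0, hn⟩, Finset.mem_univ _⟩
      constructor
      · simp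
      · rfl
      · simp
      · simp
      · simp
      · simp
      · simp
      · simp
      · simp
      · simp
      · intro j hj; exact hne
      · intro j _ hj v
        simp at hj
        simp [p₂, hj]
      · simp [p₂]
      · simp only [Mem.setReg_reg, Mem.setReg_arr, p₂]
        rw [Finset.image_const hne]
        simp
    · rintro i s' hi hx hag ⟨M, hI⟩
      have r' : HasRows n s' := HasRows.congr (s := (s₂.setReg 4 _).setReg 3 _) ⟨r₂.1, r₂.2⟩ hag
      have e' : HasMatrix 3 (PowAdj G r) s' :=
        HasMatrix.congr (s := (s₂.setReg 4 _).setReg 3 _) e₂ hag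
      simp only [Ends.cond_iff, Expr.val_sub, Expr.val_reg, hx, Ends.skip_iff]
      constructor
      · intro hlt
        have hlt : i < s'.reg 3 := by omega
        rw [min_eq_left hlt.le] at hI
        refine (nodeProg_spec (fun _ _ h => PowAdj.symm h) hw hd r' e' hI hx hlt).mono ?_
        rintro _ s'' ⟨M', h'⟩
        refine ⟨M', ?_⟩
        have := h'.le
        simp only [Mem.setReg_reg]
        rw [if_neg (by decide), min_eq_left this]
        -- Only the loop counter in register `6` differs, and no field of `PartialTree` reads it.
        exact ⟨h'.1, h'.2, h'.3, h'.4, h'.5, h'.6, h'.7, h'.8, h'.9, h'.10, h'.11, h'.12, h'.13, h'.14⟩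
      · intro hge
        refine ⟨M, ?_⟩
        simp only [Mem.setReg_reg]
        rw [if_neg (by decide), min_eq_right (by omega)]
        rw [min_eq_right (by omega)] at hI
        exact ⟨hI.1, hI.2, hI.3, hI.4, hI.5, hI.6, hI.7, hI.8, hI.9, hI.10, hI.11, hI.12, hI.13, hI.14⟩
    · rintro t s' _ hag ⟨M, hI⟩
      refine ⟨M, HasRows.congr (s := (s₂.setReg 4 _).setReg 3 _) ⟨r₂.1, r₂.2⟩ hag,
        HasMatrix.congr (s := (s₂.setReg 4 _).setReg 3 _) e₂ hag, ?_⟩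
      rw [min_eq_right] at hI
      · exact hI
      · have h1 := hI.count
        have h2 : (Finset.univ.image fun v : Fin n => s'.arr 5 v).card ≤ n :=
          Finset.card_image_le.trans (by simp)
        simp [r₂.1]
        omega
  exact this.conseq fun _ s' hag h => ⟨hag.reg 2 (by decide), h⟩

theorem Ready.card_le {w : ℕ} {M : ℕ → Finset (Fin n)} (h : Ready A w M s) : s.reg 3 ≤ 2 * n := by
  have h1 := h.tree.count
  have h2 : (Finset.univ.image fun v : Fin n => s.arr 5 v).card ≤ n :=
    Finset.card_image_le.trans (by simp)
  omega

/-! ### Running time of the preprocessing. -/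

theorem rowProg_bounded : Bounded [0] rowProg := by
  repeat' first
    | decide | apply Bounded.any | apply Bounded.iterate | apply Bounded.assign | apply Bounded.write
    | apply Bounded.seq

theorem powProg_bounded : Bounded [0] powProg := by
  repeat' first
    | decide | apply Bounded.any | apply Bounded.iterate | apply Bounded.assign | apply Bounded.write
    | apply Bounded.skip | apply Bounded.cond | apply Bounded.seq

theorem closureProg_bounded : Bounded [0, 4] closureProg := by
  repeat' first
    | decide | apply Bounded.any | apply Bounded.iterate | apply Bounded.assign | apply Bounded.write
    | apply Bounded.skip | apply Bounded.cond | apply Bounded.seq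

theorem bipartTry_bounded (b : ℕ) : Bounded [0, 4] (bipartTry b) :=
  .seq (.iterate (by decide) (by decide) (by simp [Cmd.regs]) .write)
    (.seq (.iterate (by decide) (by decide) (by decide) .write)
      (.seq closureProg_bounded (.any (by decide) (by decide) (by decide) (by decide))))

theorem labelProg_bounded : Bounded [0, 4] labelProg := by
  repeat' first
    | decide | exact closureProg_bounded | exact bipartTry_bounded _ | apply Bounded.any
    | apply Bounded.iterate | apply Bounded.assign | apply Bounded.write
    | apply Bounded.skip | apply Bounded.cond | apply Bounded.seq

theorem nodeProg_bounded : Bounded [0, 4] nodeProg := by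
  repeat' first
    | decide | exact labelProg_bounded | apply Bounded.any | apply Bounded.iterate
    | apply Bounded.assign | apply Bounded.write
    | apply Bounded.skip | apply Bounded.cond | apply Bounded.seq

/-- The preprocessing takes polynomial time. -/
theorem preProg_time : ∃ C c : ℕ, ∀ (n : ℕ) (s : Mem), 1 ≤ n → s.reg 0 = n →
    Ends preProg s fun t _ => t ≤ C * n ^ c := by
  obtain ⟨K₁, D₁, h₁⟩ := rowProg_bounded.time
  obtain ⟨K₂, D₂, h₂⟩ := powProg_bounded.time
  -- Register `4` bounds a loop only after it has received the value `2 * n`, so this part is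
  -- treated separately with the bound `2 * n`. This accounts for the factor `2 ^ D₃`.
  obtain ⟨K₃, D₃, h₃⟩ := (Bounded.seq (.assign (x := 3) (e := .const 1) (by decide))
    (.iterate (x := 6) (y := 4) (by decide) (by decide) (by decide)
      (.cond (b := .sub (.reg 3) (.reg 6)) nodeProg_bounded .skip)) : Bounded [0, 4] _).time
  refine ⟨K₁ + (K₂ + (4 + K₃ * 2 ^ D₃)), D₁ + (D₂ + D₃), fun n s hn h0 => ?_⟩
  rw [preProg, Ends.seq_iff]
  refine (h₁ n s hn (by simp [h0])).conseq fun t₁ s₁ a₁ b₁ => ?_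
  have h0 : s₁.reg 0 = n := (a₁.reg 0 (by decide)).trans h0
  rw [Ends.seq_iff]
  refine (h₂ n s₁ hn (by simp [h0])).conseq fun t₂ s₂ a₂ b₂ => ?_
  have h0 : s₂.reg 0 = n := (a₂.reg 0 (by decide)).trans h0
  rw [Ends.seq_iff, Ends.assign_iff]
  refine (h₃ (2 * n) _ (by omega) (by simp [h0]; omega)).mono fun t₃ _ b₃ => ?_
  have pow : ∀ {a b : ℕ}, a ≤ b → n ^ a ≤ n ^ b := fun h => Nat.pow_le_pow_right hn h
  have hp : 1 ≤ n ^ (D₁ + (D₂ + D₃)) := Nat.one_le_pow _ _ hn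
  have c₁ := b₁.trans (Nat.mul_le_mul_left K₁ (pow (show D₁ ≤ D₁ + (D₂ + D₃) by omega)))
  have c₂ := b₂.trans (Nat.mul_le_mul_left K₂ (pow (show D₂ ≤ D₁ + (D₂ + D₃) by omega)))
  have c₃ : t₃ ≤ K₃ * 2 ^ D₃ * n ^ (D₁ + (D₂ + D₃)) := by
    refine b₃.trans ?_
    rw [mul_pow, ← mul_assoc]
    exact Nat.mul_le_mul_left _ (pow (by omega))
  simp only [Expr.cost, add_mul]
  omega


/-! ### Costs of expressions. -/

namespace Expr

variable (e f : Expr)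

@[simp] theorem cost_const (k : ℕ) : (const k).cost = 1 := rfl
@[simp] theorem cost_reg (x : ℕ) : (reg x).cost = 1 := rfl
@[simp] theorem cost_get (a : ℕ) : (get a e).cost = e.cost + 1 := rfl
@[simp] theorem cost_add : (add e f).cost = e.cost + f.cost + 1 := rfl
@[simp] theorem cost_sub : (sub e f).cost = e.cost + f.cost + 1 := rfl
@[simp] theorem cost_isZero : (isZero e).cost = e.cost + 2 := by simp [isZero]; omega
@[simp] theorem cost_and : (and e f).cost = e.cost + f.cost + 7 := by simp [and]; omega
@[simp] theorem cost_eq : (eq e f).cost = 2 * e.cost + 2 * f.cost + 5 := by simp [eq, ne]; omega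
@[simp] theorem cost_max : (max e f).cost = 2 * e.cost + f.cost + 2 := by simp [max]; omega
@[simp] theorem cost_min : (min e f).cost = 2 * e.cost + f.cost + 2 := by simp [min]; omega

end Expr

/-! ### Domination inside a node -/

section LocalDom

variable {n : ℕ} {A : Fin n → Fin n → Prop}

open Classical in
/-- Every vertex of `X` outside `T` has at least `q` neighbours in `X ∩ T`. -/
def LocalDom (A : Fin n → Fin n → Prop) (X : Finset (Fin n)) (q : ℕ) (T : Finset (Fin n)) : Prop :=
  ∀ v ∈ X, v ∉ T → q ≤ ((X ∩ T).filter (A v)).card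

open Classical in
/-- The neighbours of a vertex in a node, by children of this node. -/
theorem card_neighbours {l : ℕ} {X T : Finset (Fin n)} {col : Fin n → ℕ} {ρ : ℕ → Fin n}
    (hu : Uniform A X col) (hcol : ∀ x ∈ X, col x < l) (hρ : ∀ i < l, ρ i ∈ X ∧ col (ρ i) = i)
    (hirr : ∀ x, ¬ A x x) {v : Fin n} (hv : v ∈ X) :
    ((X ∩ T).filter (A v)).card = (((X.filter fun x => col x = col v) ∩ T).filter (A v)).card +
      ∑ j ∈ Finset.range l, bit (A (ρ (col v)) (ρ j)) * ((X.filter fun x => col x = j) ∩ T).card := by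
  have hmaps : ∀ x ∈ (X ∩ T).filter (A v), col x ∈ Finset.range l := by
    intro x hx
    simp only [Finset.mem_filter, Finset.mem_inter] at hx
    exact Finset.mem_range.2 (hcol x hx.1.1)
  rw [Finset.card_eq_sum_card_fiberwise hmaps]
  have key : ∀ j ∈ Finset.range l, (((X ∩ T).filter (A v)).filter fun x => col x = j).card =
      (if j = col v then (((X.filter fun x => col x = col v) ∩ T).filter (A v)).card else 0) +
        bit (A (ρ (col v)) (ρ j)) * ((X.filter fun x => col x = j) ∩ T).card := by
    intro j hj
    have hj := Finset.mem_range.1 hj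
    by_cases hjv : j = col v
    · subst hjv
      -- Irreflexivity of `A` removes the summand of the own class, whose neighbours are counted
      -- separately.
      rw [if_pos rfl, bit_of_false (hirr _), zero_mul, add_zero]
      congr 1
      ext x
      simp only [Finset.mem_filter, Finset.mem_inter]
      tauto
    · rw [if_neg hjv, zero_add]
      obtain ⟨h1, h2⟩ := hρ j hj
      obtain ⟨h3, h4⟩ := hρ (col v) (hcol v hv)
      have hadj : ∀ x ∈ X, col x = j → (A v x ↔ A (ρ (col v)) (ρ j)) := fun x hx hxj =>
        hu v hv _ h3 x hx _ h1 h4.symm (hxj.trans h2.symm) (by rw [hxj]; exact Ne.symm hjv)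
      by_cases hA : A (ρ (col v)) (ρ j)
      · rw [bit_of_true hA, one_mul]
        congr 1
        ext x
        simp only [Finset.mem_filter, Finset.mem_inter]
        constructor
        · tauto
        · rintro ⟨⟨hx, hxj⟩, hT⟩
          exact ⟨⟨⟨hx, hT⟩, (hadj x hx hxj).2 hA⟩, hxj⟩
      · rw [bit_of_false hA, zero_mul, Finset.card_eq_zero, Finset.filter_eq_empty_iff]
        intro x hx hxj
        simp only [Finset.mem_filter, Finset.mem_inter] at hx
        exact hA ((hadj x hx.1.1 hxj).1 hx.2)
  rw [Finset.sum_congr rfl key, Finset.sum_add_distrib]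
  congr 1
  rw [Finset.sum_ite_eq' (Finset.range l) (col v), if_pos (Finset.mem_range.2 (hcol v hv))]

theorem card_inter_eq_sum {l : ℕ} {X T : Finset (Fin n)} {col : Fin n → ℕ}
    (hcol : ∀ x ∈ X, col x < l) :
    (X ∩ T).card = ∑ j ∈ Finset.range l, ((X.filter fun x => col x = j) ∩ T).card := by
  rw [Finset.card_eq_sum_card_fiberwise (f := col) (t := Finset.range l)]
  · refine Finset.sum_congr rfl fun j _ => ?_
    congr 1
    ext x
    simp only [Finset.mem_filter, Finset.mem_inter]
    tauto
  · intro x hx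
    simp only [Finset.coe_inter, Set.mem_inter_iff, Finset.mem_coe] at hx
    exact Finset.mem_coe.2 (Finset.mem_range.2 (hcol x hx.1))

/-- A dominating set of a node dominates its children with the remaining demands. -/
theorem LocalDom.child {l q : ℕ} {X T : Finset (Fin n)} {col : Fin n → ℕ} {ρ : ℕ → Fin n}
    (hu : Uniform A X col) (hcol : ∀ x ∈ X, col x < l) (hρ : ∀ i < l, ρ i ∈ X ∧ col (ρ i) = i)
    (hirr : ∀ x, ¬ A x x) (h : LocalDom A X q T) (i : ℕ) :
    LocalDom A (X.filter fun x => col x = i) (q - ∑ j ∈ Finset.range l,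
      bit (A (ρ i) (ρ j)) * ((X.filter fun x => col x = j) ∩ T).card) T := by
  classical
  intro v hv hvT
  obtain ⟨hvX, rfl⟩ := Finset.mem_filter.1 hv
  have := h v hvX hvT
  rw [card_neighbours hu hcol hρ hirr hvX] at this
  convert Nat.sub_le_of_le_add this

/-- Dominating sets of the children, with the remaining demands, dominate the node. -/
theorem LocalDom.of_children {l q : ℕ} {X T : Finset (Fin n)} {col : Fin n → ℕ} {ρ : ℕ → Fin n}
    {dm : ℕ → ℕ} (hu : Uniform A X col) (hcol : ∀ x ∈ X, col x < l)
    (hρ : ∀ i < l, ρ i ∈ X ∧ col (ρ i) = i) (hirr : ∀ x, ¬ A x x)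
    (h : ∀ i < l, LocalDom A (X.filter fun x => col x = i) (dm i) T)
    (hdm : ∀ i < l, q ≤ dm i + ∑ j ∈ Finset.range l,
      bit (A (ρ i) (ρ j)) * ((X.filter fun x => col x = j) ∩ T).card) : LocalDom A X q T := by
  classical
  intro v hvX hvT
  have h1 := h (col v) (hcol v hvX) v (Finset.mem_filter.2 ⟨hvX, rfl⟩) hvT
  have h2 := hdm (col v) (hcol v hvX)
  have h3 := card_neighbours (T := T) hu hcol hρ hirr hvX
  have h4 : q ≤ ((X ∩ T).filter (A v)).card := by
    rw [h3]
    refine h2.trans (Nat.add_le_add_right ?_ _)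
    convert h1
  convert h4

/-- Capping the numbers at the demand does not change the remaining demands. -/
theorem sub_sum_min {l d q : ℕ} (hq : q ≤ d) (E a : ℕ → ℕ) :
    q - ∑ j ∈ Finset.range l, E j * min (a j) d = q - ∑ j ∈ Finset.range l, E j * a j := by
  -- One adjacent child with at least `d` chosen vertices already reduces both remaining demands to
  -- zero, as `q ≤ d`. If there is none, no number that matters is capped.
  by_cases h : ∃ j ∈ Finset.range l, E j ≠ 0 ∧ d ≤ a j
  · obtain ⟨j, hj, hE, hd⟩ := h
    have h1 : d ≤ E j * min (a j) d := by
      rw [min_eq_right hd]; exact Nat.le_mul_of_pos_left _ (Nat.pos_of_ne_zero hE)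
    have h2 : d ≤ E j * a j := hd.trans (Nat.le_mul_of_pos_left _ (Nat.pos_of_ne_zero hE))
    have h3 := Finset.single_le_sum (f := fun j => E j * min (a j) d) (fun _ _ => Nat.zero_le _) hj
    have h4 := Finset.single_le_sum (f := fun j => E j * a j) (fun _ _ => Nat.zero_le _) hj
    omega
  · push Not at h
    congr 1
    refine Finset.sum_congr rfl fun j hj => ?_
    by_cases hE : E j = 0
    · simp [hE]
    · rw [min_eq_left (h j hj hE).le]

end LocalDom

/-! ### Digits -/

/-- A row number is read in base `X`, the digit at position `i` being the guess for child `i`. A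
number below `X ^ a` leaves room for the digit `j` at position `a`, and all higher digits are zero.
-/
theorem digit_block {X a i j t : ℕ} (hj : j < X) (ht : t < X ^ a) :
    (j * X ^ a + t) / X ^ i % X = if i = a then j else if i < a then t / X ^ i % X else 0 := by
  have hX : 0 < X := by omega
  split_ifs with h1 h2
  · subst h1
    rw [mul_comm, Nat.mul_add_div (Nat.pow_pos hX), Nat.div_eq_of_lt ht, add_zero,
      Nat.mod_eq_of_lt hj]
  · obtain ⟨b, rfl⟩ : ∃ b, a = i + (b + 1) := ⟨a - i - 1, by omega⟩
    rw [show j * X ^ (i + (b + 1)) = X ^ i * (X * (j * X ^ b)) by ring,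
      Nat.mul_add_div (Nat.pow_pos hX), Nat.mul_add_mod]
  · rw [Nat.div_eq_of_lt, Nat.zero_mod]
    calc j * X ^ a + t < (j + 1) * X ^ a := by rw [add_mul]; omega
      _ ≤ X * X ^ a := Nat.mul_le_mul_right _ hj
      _ = X ^ (a + 1) := by ring
      _ ≤ X ^ i := Nat.pow_le_pow_right hX (by omega)

theorem exists_digits {X : ℕ} (K : ℕ → ℕ) (l : ℕ) (h : ∀ i < l, K i < X) :
    ∃ t < X ^ l, ∀ i < l, t / X ^ i % X = K i := by
  induction l with
  | zero => exact ⟨0, by simp, by simp⟩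
  | succ l ih =>
    obtain ⟨t, ht, hd⟩ := ih fun i hi => h i (by omega)
    refine ⟨K l * X ^ l + t, ?_, fun i hi => ?_⟩
    · have := Nat.mul_le_mul_right (X ^ l) (show K l + 1 ≤ X from h l (by omega))
      rw [add_mul, one_mul] at this
      rw [pow_succ, mul_comm (X ^ l)]
      omega
    · rw [digit_block (h l (by omega)) ht]
      split_ifs with h1 h2
      · rw [h1]
      · exact hd i h2
      · omega

/-- The number chosen for child `i` in row `t` of the table. -/
def rowNum (X : ℕ) (size : ℕ → ℕ) (t i : ℕ) : ℕ := min (t / X ^ i % X) (size i)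

/-- The contribution of the other children to the demand of child `i` in row `t`. -/
def rowSum (X l : ℕ) (size : ℕ → ℕ) (E : ℕ → ℕ → ℕ) (t i : ℕ) : ℕ :=
  ∑ j ∈ Finset.range l, E i j * rowNum X size t j

/-- Raising the digit at position `a` affects child `a` only, and there only while its size is not
yet reached. Hence a row is obtained from the row `X ^ a` places earlier by adding a bit, without
computing any digits. -/
theorem rowNum_succ {X a j t i : ℕ} {size : ℕ → ℕ} (hj : j + 1 < X) (ht : t < X ^ a) :
    rowNum X size ((j + 1) * X ^ a + t) i =
      rowNum X size (j * X ^ a + t) i + bit (j < size a ∧ i = a) := by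
  rw [rowNum, rowNum, digit_block hj ht, digit_block (by omega) ht]
  by_cases hi : i = a
  · subst hi
    simp only [if_true, and_true]
    unfold bit
    split_ifs <;> omega
  · simp [hi, bit_of_false]

theorem rowSum_succ {X l a j t i : ℕ} {size : ℕ → ℕ} {E : ℕ → ℕ → ℕ} (hj : j + 1 < X)
    (ht : t < X ^ a) (ha : a < l) :
    rowSum X l size E ((j + 1) * X ^ a + t) i =
      rowSum X l size E (j * X ^ a + t) i + bit (j < size a) * E i a := by
  have : ∀ k ∈ Finset.range l, E i k * rowNum X size ((j + 1) * X ^ a + t) k =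
      E i k * rowNum X size (j * X ^ a + t) k + if k = a then bit (j < size a) * E i a else 0 := by
    intro k _
    rw [rowNum_succ hj ht, mul_add]
    by_cases hk : k = a
    · simp [hk, mul_comm]
    · simp [hk, bit_of_false]
  rw [rowSum, rowSum, Finset.sum_congr rfl this, Finset.sum_add_distrib, Finset.sum_ite_eq',
    if_pos (Finset.mem_range.2 ha)]


/-! ### The table of a node -/

/-- What the construction of the table reads: the demand, the number `l` of children and the first
child `c₀`, the sizes of the children and the adjacency between them. -/
structure TableCtx (d l c₀ : ℕ) (size : ℕ → ℕ) (E : ℕ → ℕ → ℕ) (s : Mem) : Prop where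
  demand : s.reg 2 = d
  num : s.reg 23 = l
  fst : s.reg 24 = c₀
  sizes : ∀ i < l, s.arr 12 (c₀ + i) = size i
  adj : ∀ i < l, ∀ j < l, s.arr 3 (s.arr 2 (s.arr 13 (c₀ + i)) + s.arr 13 (c₀ + j)) = E i j

variable {d l c₀ : ℕ} {size : ℕ → ℕ} {E : ℕ → ℕ → ℕ} {s : Mem}

theorem TableCtx.congr {R B : List ℕ} {s s' : Mem} (h : TableCtx d l c₀ size E s)
    (hA : Agree R B s s') (r2 : 2 ∉ R := by decide) (r23 : 23 ∉ R := by decide)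
    (r24 : 24 ∉ R := by decide) (a2 : 2 ∉ B := by decide) (a3 : 3 ∉ B := by decide)
    (a12 : 12 ∉ B := by decide) (a13 : 13 ∉ B := by decide) : TableCtx d l c₀ size E s' := by
  constructor
  · rw [hA.reg 2 r2, h.demand]
  · rw [hA.reg 23 r23, h.num]
  · rw [hA.reg 24 r24, h.fst]
  · rw [hA.arr 12 a12]; exact h.sizes
  · rw [hA.arr 2 a2, hA.arr 3 a3, hA.arr 13 a13]; exact h.adj

/-- The entries of the table before position `p` have been computed. -/
def Filled (d l : ℕ) (size : ℕ → ℕ) (E : ℕ → ℕ → ℕ) (p : ℕ) (s : Mem) : Prop :=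
  ∀ t i, i < l → t * l + i < p → s.arr 19 (t * l + i) = rowNum (d + 1) size t i ∧
    s.arr 20 (t * l + i) = rowSum (d + 1) l size E t i

theorem row_index_inj {l t i t' i' : ℕ} (hi : i < l) (hi' : i' < l)
    (h : t * l + i = t' * l + i') : t = t' ∧ i = i' := by
  have h1 : (t * l + i) / l = t := by
    rw [mul_comm, Nat.mul_add_div (by omega), Nat.div_eq_of_lt hi, add_zero]
  have h2 : (t' * l + i') / l = t' := by
    rw [mul_comm, Nat.mul_add_div (by omega), Nat.div_eq_of_lt hi', add_zero]
  have h3 : t = t' := by rw [← h1, h, h2]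
  subst h3
  exact ⟨rfl, by omega⟩

/-- Computes one entry of the table. -/
def cellProg : Cmd :=
  .seq (.write 19 (.reg 25) (.add (.get 19 (.sub (.reg 25) (.reg 26)))
      (.and (.reg 33) (.eq (.reg 32) (.reg 29)))))
    (.seq (.write 20 (.reg 25) (.add (.get 20 (.sub (.reg 25) (.reg 26)))
      (.and (.reg 33) (.get 3 (.add (.get 2 (.get 13 (.add (.reg 24) (.reg 32))))
        (.get 13 (.add (.reg 24) (.reg 29))))))))
      (.assign 25 (.add (.reg 25) (.const 1))))

/-- The row with digit `j` in place of `j + 1` lies `(d + 1) ^ a` rows earlier, which is the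
distance in register `26`. The new entry is the old one plus a correction gated by the bit in
register `33`. -/
theorem cellProg_spec {a j t i : ℕ} (hE : ∀ i j, E i j ≤ 1) (hc : TableCtx d l c₀ size E s)
    (ha : a < l) (hi : i < l) (hj : j < d) (ht : t < (d + 1) ^ a)
    (h25 : s.reg 25 = ((j + 1) * (d + 1) ^ a + t) * l + i) (h26 : s.reg 26 = (d + 1) ^ a * l)
    (h29 : s.reg 29 = a) (h32 : s.reg 32 = i) (h33 : s.reg 33 = bit (j < size a))
    (hf : Filled d l size E (((j + 1) * (d + 1) ^ a + t) * l + i) s) :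
    Ends cellProg s fun t' s' => t' ≤ 60 ∧ s'.reg 25 = ((j + 1) * (d + 1) ^ a + t) * l + (i + 1) ∧
      Filled d l size E (((j + 1) * (d + 1) ^ a + t) * l + (i + 1)) s' := by
  have hsub : ((j + 1) * (d + 1) ^ a + t) * l + i - (d + 1) ^ a * l
      = (j * (d + 1) ^ a + t) * l + i := by
    rw [Nat.sub_eq_iff_eq_add (by nlinarith)]; ring
  obtain ⟨g1, g2⟩ := hf (j * (d + 1) ^ a + t) i hi (by
    have h1 : 0 < (d + 1) ^ a * l := Nat.mul_pos (Nat.pow_pos (by omega)) (by omega)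
    have h2 : ((j + 1) * (d + 1) ^ a + t) * l + i =
        (j * (d + 1) ^ a + t) * l + i + (d + 1) ^ a * l := by ring
    omega)
  simp only [cellProg, Ends.seq_iff, Ends.write_iff, Ends.assign_iff]
  refine ⟨by simp, by simp [h25]; ring, ?_⟩
  intro t₂ i₂ hi₂ hlt
  simp only [Mem.setReg_arr, Mem.setArr_arr, Mem.setArr_reg, Expr.val_reg, Expr.val_add,
    Expr.val_sub, Expr.val_get, Expr.val_and, Expr.val_eq, h25, h26, h29, h32, h33, hsub, hc.fst]
  norm_num
  by_cases he : t₂ * l + i₂ = ((j + 1) * (d + 1) ^ a + t) * l + i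
  · obtain ⟨rfl, rfl⟩ := row_index_inj hi₂ hi he
    rw [Function.update_self, Function.update_self, g1, g2, hc.adj _ hi _ ha,
      rowNum_succ (by omega) ht, rowSum_succ (by omega) ht ha]
    refine ⟨rfl, ?_⟩
    congr 1
    have := hE i₂ a
    unfold bit
    split_ifs <;> omega
  · rw [Function.update_of_ne he, Function.update_of_ne he]
    exact hf t₂ i₂ hi₂ (by omega)

/-- Appends the rows in which the number chosen for child `a` is `j + 1`. -/
def blockProg : Cmd :=
  .seq (.assign 33 (.isZero (.isZero (.sub (.get 12 (.add (.reg 24) (.reg 29))) (.reg 30)))))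
    (.seq (forLoop 31 28 (forLoop 32 23 cellProg)) (.assign 27 (.add (.reg 27) (.reg 28))))

theorem blockProg_spec {a j : ℕ} (hE : ∀ i j, E i j ≤ 1) (hc : TableCtx d l c₀ size E s)
    (ha : a < l) (hj : j < d)
    (h25 : s.reg 25 = ((j + 1) * (d + 1) ^ a) * l) (h26 : s.reg 26 = (d + 1) ^ a * l)
    (h27 : s.reg 27 = (j + 1) * (d + 1) ^ a) (h28 : s.reg 28 = (d + 1) ^ a)
    (h29 : s.reg 29 = a) (h30 : s.reg 30 = j)
    (hf : Filled d l size E (((j + 1) * (d + 1) ^ a) * l) s) :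
    Ends blockProg s fun t' s' => t' ≤ 68 * ((d + 1) ^ a * (l + 1)) ∧
      s'.reg 25 = ((j + 1 + 1) * (d + 1) ^ a) * l ∧ s'.reg 27 = (j + 1 + 1) * (d + 1) ^ a ∧
      Filled d l size E (((j + 1 + 1) * (d + 1) ^ a) * l) s' := by
  have hX : 1 ≤ (d + 1) ^ a := Nat.one_le_pow _ _ (by omega)
  rw [blockProg, Ends.seq_iff, Ends.assign_iff, Ends.seq_iff]
  have e33 : (Expr.isZero (.isZero (.sub (.get 12 (.add (.reg 24) (.reg 29))) (.reg 30)))).val s =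
      bit (j < size a) := by
    simp only [Expr.val_isZero, Expr.val_sub, Expr.val_get, Expr.val_add, Expr.val_reg, hc.fst, h29,
      h30, hc.sizes a ha, bit_eq_zero]
    exact bit_congr (by omega)
  rw [e33]
  have hc₁ : TableCtx d l c₀ size E (s.setReg 33 (bit (j < size a))) :=
    ⟨hc.1, hc.2, hc.3, hc.4, hc.5⟩
  refine Ends.forLoop_le (fun t s' => s'.reg 25 = ((j + 1) * (d + 1) ^ a + t) * l ∧
    Filled d l size E (((j + 1) * (d + 1) ^ a + t) * l) s') (fun _ => 6 + l * 68) ?_ ?_ ?_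
  · exact ⟨by simp [h25], by rw [add_zero]; exact hf⟩
  · rintro t s' ht hxt hag ⟨g25, gf⟩
    have ht : t < (d + 1) ^ a := by simpa [h28] using ht
    have hc' := hc₁.congr hag
    refine Ends.forLoop_le (fun i s' => s'.reg 25 = ((j + 1) * (d + 1) ^ a + t) * l + i ∧
      Filled d l size E (((j + 1) * (d + 1) ^ a + t) * l + i) s') (fun _ => 60) ?_ ?_ ?_
    · exact ⟨by simp [g25], gf⟩
    · rintro i s'' hi hxi hag' ⟨k25, kf⟩
      rw [hc'.num] at hi
      refine (cellProg_spec hE (hc'.congr hag') ha hi hj ht k25 ?_ ?_ hxi ?_ kf).mono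
        fun t' s₃ ⟨q1, q2, q3⟩ => ⟨q1, by simpa using q2, q3⟩
      · rw [hag'.reg 26 (by decide), hag.reg 26 (by decide)]; simpa using h26
      · rw [hag'.reg 29 (by decide), hag.reg 29 (by decide)]; simpa using h29
      · rw [hag'.reg 33 (by decide), hag.reg 33 (by decide)]; simp
    · rintro t' s'' _ hag' ⟨k25, kf⟩ hT
      rw [hc'.num] at k25 kf hT
      refine ⟨?_, ?_, ?_⟩
      · simpa using hT
      · simp only [Mem.setReg_reg]; rw [if_neg (by decide), k25]; ring
      · have e : ((j + 1) * (d + 1) ^ a + (t + 1)) * l =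
            ((j + 1) * (d + 1) ^ a + t) * l + l := by ring
        rw [e]; exact kf
  · rintro t s' _ hag ⟨g25, gf⟩ hT
    have e28 : (s.setReg 33 (bit (j < size a))).reg 28 = (d + 1) ^ a := by simpa using h28
    rw [e28] at g25 gf hT
    rw [Ends.assign_iff]
    have e : (j + 1 + 1) * (d + 1) ^ a = (j + 1) * (d + 1) ^ a + (d + 1) ^ a := by ring
    refine ⟨?_, ?_, ?_, ?_⟩
    · simp only [Finset.sum_const, Finset.card_range, smul_eq_mul] at hT
      simp only [Expr.cost_isZero, Expr.cost_sub, Expr.cost_get, Expr.cost_add, Expr.cost_reg]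
      nlinarith
    · simp only [Mem.setReg_reg]; rw [if_neg (by decide), g25, e]
    · simp only [Mem.setReg_reg, Expr.val_add, Expr.val_reg, if_true]
      rw [hag.reg 27 (by decide), hag.reg 28 (by decide), e]
      simp [h27, h28]
    · rw [e]; exact gf

/-- Computes the table, child by child. -/
def tableProg : Cmd :=
  .seq (forLoop 32 23 (.seq (.write 19 (.reg 32) (.const 0)) (.write 20 (.reg 32) (.const 0))))
    (.seq (.assign 25 (.reg 23)) (.seq (.assign 27 (.const 1))
      (forLoop 29 23 (.seq (.assign 26 (.reg 25)) (.seq (.assign 28 (.reg 27))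
        (forLoop 30 2 blockProg))))))

theorem sum_pow_succ_le {X : ℕ} (hX : 2 ≤ X) (l : ℕ) :
    ∑ a ∈ Finset.range l, X ^ (a + 1) ≤ 2 * X ^ l := by
  induction l with
  | zero => simp
  | succ l ih =>
    rw [Finset.sum_range_succ, pow_succ]
    have : 2 * X ^ l ≤ X ^ l * X := by rw [mul_comm]; exact Nat.mul_le_mul_left _ hX
    omega

/-- Before child `a` is treated, the table consists of the `(d + 1) ^ a` rows whose digits vanish
from position `a` on, starting with the zero row. Child `a` appends `d` modified copies. The stages
grow geometrically because `d + 1 ≥ 2`, so the last one dominates the cost. -/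
theorem tableProg_spec (hd : 0 < d) (hE : ∀ i j, E i j ≤ 1) (hc : TableCtx d l c₀ size E s) :
    Ends tableProg s fun t' s' => t' ≤ 300 * ((l + 1) * (d + 1) ^ l) ∧
      s'.reg 27 = (d + 1) ^ l ∧ Filled d l size E ((d + 1) ^ l * l) s' := by
  rw [tableProg, Ends.seq_iff]
  refine Ends.forLoop_le (fun i s' => ∀ i' < i, s'.arr 19 i' = 0 ∧ s'.arr 20 i' = 0) (fun _ => 6)
    ?_ ?_ ?_
  · simp
  · intro i s' hi hxi hag hI
    simp only [Ends.seq_iff, Ends.write_iff]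
    refine ⟨by simp, fun i' hi' => ?_⟩
    simp only [Mem.setReg_arr, Mem.setArr_arr, Mem.setArr_reg, Expr.val_reg, Expr.val_const, hxi]
    norm_num
    by_cases he : i' = i
    · simp [he]
    · rw [Function.update_of_ne he, Function.update_of_ne he]; exact hI i' (by omega)
  rintro t₁ s₁ _ a₁ f₁ T₁
  have hc₁ := hc.congr a₁
  rw [hc.num] at f₁ T₁
  simp only [Ends.seq_iff (p := .assign 25 _), Ends.seq_iff (p := .assign 27 _), Ends.assign_iff]
  simp only [Expr.val_reg, Expr.val_const, hc₁.num]
  have hc₂ : TableCtx d l c₀ size E ((s₁.setReg 25 l).setReg 27 1) :=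
    ⟨hc₁.1, hc₁.2, hc₁.3, hc₁.4, hc₁.5⟩
  refine Ends.forLoop_le (fun a s' => s'.reg 25 = (d + 1) ^ a * l ∧ s'.reg 27 = (d + 1) ^ a ∧
    Filled d l size E ((d + 1) ^ a * l) s') (fun a => 86 * ((d + 1) ^ (a + 1) * (l + 1))) ?_ ?_ ?_
  · refine ⟨by simp, by simp, fun t i hi hlt => ?_⟩
    rw [pow_zero, one_mul] at hlt
    have ht : t = 0 := by
      by_contra h
      have : 1 * l ≤ t * l := Nat.mul_le_mul_right _ (by omega)
      omega
    subst ht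
    have := f₁ i hi
    have hn : ∀ i, rowNum (d + 1) size 0 i = 0 := fun i => by simp [rowNum]
    simp only [Mem.setReg_arr, zero_mul, zero_add, this, hn]
    simp [rowSum, hn]
  · rintro a s' ha hxa hag ⟨g25, g27, gf⟩
    rw [hc₂.num] at ha
    have hc' := hc₂.congr hag
    simp only [Ends.seq_iff (p := .assign 26 _), Ends.seq_iff (p := .assign 28 _), Ends.assign_iff]
    simp only [Expr.val_reg, Mem.setReg_reg, g25]
    rw [if_neg (by decide), g27]
    have hc₃ : TableCtx d l c₀ size E
        ((s'.setReg 26 ((d + 1) ^ a * l)).setReg 28 ((d + 1) ^ a)) :=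
      ⟨hc'.1, hc'.2, hc'.3, hc'.4, hc'.5⟩
    refine Ends.forLoop_le (fun j s' => s'.reg 25 = ((j + 1) * (d + 1) ^ a) * l ∧
      s'.reg 27 = (j + 1) * (d + 1) ^ a ∧ Filled d l size E (((j + 1) * (d + 1) ^ a) * l) s')
      (fun _ => 68 * ((d + 1) ^ a * (l + 1))) ?_ ?_ ?_
    · refine ⟨by simp [g25], by simp [g27], by
        rw [zero_add, one_mul]; exact gf⟩
    · rintro j s'' hj hxj hag' ⟨k25, k27, kf⟩
      rw [hc₃.demand] at hj
      refine (blockProg_spec hE (hc₃.congr hag') ha hj k25 ?_ k27 ?_ ?_ hxj kf).mono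
        fun t' s₃ ⟨q1, q2, q3, q4⟩ => ⟨q1, by simpa using q2, by simpa using q3, q4⟩
      · rw [hag'.reg 26 (by decide)]; simp
      · rw [hag'.reg 28 (by decide)]; simp
      · rw [hag'.reg 29 (by decide)]; simpa using hxa
    · rintro t' s'' _ hag' ⟨k25, k27, kf⟩ hT
      rw [hc₃.demand] at k25 k27 kf hT
      have e : (d + 1) ^ (a + 1) = (d + 1) * (d + 1) ^ a := by ring
      refine ⟨?_, ?_, ?_, ?_⟩
      · simp only [Finset.sum_const, Finset.card_range, smul_eq_mul] at hT
        simp only [Expr.cost_reg, e]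
        have hX : 1 ≤ (d + 1) ^ a * (l + 1) := Nat.mul_pos (Nat.pow_pos (by omega)) (by omega)
        rw [mul_assoc]
        nlinarith
      · rw [e, ← k25]; rfl
      · rw [e, ← k27]; rfl
      · rw [e]; exact kf
  · rintro t₂ s₂ _ a₂ ⟨g25, g27, gf⟩ hT
    rw [hc₂.num] at g25 g27 gf hT
    refine ⟨?_, g27, gf⟩
    rw [Finset.sum_add_distrib, ← Finset.mul_sum, ← Finset.sum_mul] at hT
    have h1 := Nat.mul_le_mul_right (l + 1) (sum_pow_succ_le (X := d + 1) (by omega) l)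
    simp only [Finset.sum_const, Finset.card_range, smul_eq_mul] at hT T₁
    have hX : 1 ≤ (d + 1) ^ l := Nat.one_le_pow _ _ (by omega)
    simp only [Expr.cost_reg, Expr.cost_const]
    nlinarith


/-! ### The values of a node -/

/-- What the evaluation of the table of node `k` reads; `F i` holds the values of child `i`. -/
structure EvalCtx (d l c₀ k : ℕ) (size : ℕ → ℕ) (E F : ℕ → ℕ → ℕ) (s : Mem) : Prop
    extends TableCtx d l c₀ size E s where
  node : s.reg 21 = k
  rows : s.reg 27 = (d + 1) ^ l
  base : ∀ i < l, s.arr 15 (c₀ + i) = (c₀ + i) * (d + 1)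
  vals : ∀ i < l, ∀ x ≤ d, s.arr 16 ((c₀ + i) * (d + 1) + x) = F i x
  filled : ∀ t < (d + 1) ^ l, ∀ i < l, s.arr 19 (t * l + i) = rowNum (d + 1) size t i ∧
    s.arr 20 (t * l + i) = rowSum (d + 1) l size E t i

variable {d l c₀ k : ℕ} {size : ℕ → ℕ} {E F : ℕ → ℕ → ℕ} {s : Mem}

theorem EvalCtx.congr {R B : List ℕ} {s s' : Mem} (h : EvalCtx d l c₀ k size E F s)
    (hA : Agree R B s s') (r2 : 2 ∉ R := by decide) (r23 : 23 ∉ R := by decide)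
    (r24 : 24 ∉ R := by decide) (r21 : 21 ∉ R := by decide) (r27 : 27 ∉ R := by decide)
    (a2 : 2 ∉ B := by decide) (a3 : 3 ∉ B := by decide) (a12 : 12 ∉ B := by decide)
    (a13 : 13 ∉ B := by decide) (a15 : 15 ∉ B := by decide) (a16 : 16 ∉ B := by decide)
    (a19 : 19 ∉ B := by decide) (a20 : 20 ∉ B := by decide) : EvalCtx d l c₀ k size E F s' := by
  refine ⟨h.toTableCtx.congr hA r2 r23 r24 a2 a3 a12 a13, ?_, ?_, ?_, ?_, ?_⟩
  · rw [hA.reg 21 r21, h.node]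
  · rw [hA.reg 27 r27, h.rows]
  · rw [hA.arr 15 a15]; exact h.base
  · rw [hA.arr 16 a16]; exact h.vals
  · rw [hA.arr 19 a19, hA.arr 20 a20]; exact h.filled

/-- The number of chosen vertices in child `i` according to row `t`, for the demand `q`. -/
def rowVal (d l : ℕ) (size : ℕ → ℕ) (E F : ℕ → ℕ → ℕ) (q t i : ℕ) : ℕ :=
  max (rowNum (d + 1) size t i) (F i (q - rowSum (d + 1) l size E t i))

/-- Adds up the values of a row. -/
def scoreProg : Cmd :=
  .seq (.assign 35 (.const 0)) (forLoop 32 23 (.seq (.assign 35 (.add (.reg 35)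
    (.max (.get 19 (.reg 25)) (.get 16 (.add (.get 15 (.add (.reg 24) (.reg 32)))
      (.sub (.reg 34) (.get 20 (.reg 25))))))))
    (.assign 25 (.add (.reg 25) (.const 1)))))

theorem scoreProg_spec {q t : ℕ} (h : EvalCtx d l c₀ k size E F s) (hq : q ≤ d)
    (ht : t < (d + 1) ^ l) (h34 : s.reg 34 = q) (h25 : s.reg 25 = t * l) :
    Ends scoreProg s fun t' s' => t' ≤ 50 * (l + 1) ∧ s'.reg 25 = (t + 1) * l ∧
      s'.reg 35 = ∑ i ∈ Finset.range l, rowVal d l size E F q t i := by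
  rw [scoreProg, Ends.seq_iff, Ends.assign_iff]
  have h₁ : EvalCtx d l c₀ k size E F (s.setReg 35 (Expr.val s (.const 0))) :=
    ⟨⟨h.1.1, h.1.2, h.1.3, h.1.4, h.1.5⟩, h.2, h.3, h.4, h.5, h.6⟩
  refine Ends.forLoop_le (fun i s' => s'.reg 25 = t * l + i ∧
    s'.reg 35 = ∑ j ∈ Finset.range i, rowVal d l size E F q t j) (fun _ => 30) ?_ ?_ ?_
  · simp [h25]
  · rintro i s' hi hxi hag ⟨g25, g35⟩
    rw [h₁.num] at hi
    have hc := h₁.congr hag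
    have g34 : s'.reg 34 = q := by rw [hag.reg 34 (by decide)]; simpa using h34
    simp only [Ends.seq_iff, Ends.assign_iff]
    refine ⟨by simp, by simp [g25, add_assoc], ?_⟩
    obtain ⟨e1, e2⟩ := hc.filled t ht i hi
    simp only [Mem.setReg_reg, Expr.val_add, Expr.val_reg, Expr.val_max, Expr.val_get,
      Expr.val_sub, g25, hxi, hc.fst, hc.base i hi, g34, e1, e2, g35,
      hc.vals i hi _ ((Nat.sub_le _ _).trans hq)]
    norm_num
    rw [Finset.sum_range_succ, rowVal]
  · rintro t' s' _ hag ⟨g25, g35⟩ hT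
    rw [h₁.num] at g25 g35 hT
    refine ⟨?_, by rw [g25]; ring, g35⟩
    simp only [Finset.sum_const, Finset.card_range, smul_eq_mul] at hT
    simp only [Expr.cost_const]
    omega

/-- Finds a row of minimal value. -/
def searchProg : Cmd :=
  .seq (.assign 36 (.add (.get 12 (.reg 21)) (.const 1))) (.seq (.assign 25 (.const 0))
    (forLoop 31 27 (.seq scoreProg (.cond (.sub (.reg 36) (.reg 35))
      (.seq (.assign 36 (.reg 35)) (.assign 37 (.sub (.reg 25) (.reg 23)))) .skip))))

/-- The search starts with a best value of one more than the size of the node. By `h0` the zero row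
beats it, so some row is selected. After a row has been scored, register `25` points behind it, and
subtracting `l` gives its beginning. -/
theorem searchProg_spec {q : ℕ} (h : EvalCtx d l c₀ k size E F s) (hq : q ≤ d)
    (h34 : s.reg 34 = q)
    (h0 : ∑ i ∈ Finset.range l, rowVal d l size E F q 0 i ≤ s.arr 12 k) :
    Ends searchProg s fun t' s' => t' ≤ 90 * ((l + 1) * (d + 1) ^ l) ∧
      ∃ t < (d + 1) ^ l, s'.reg 37 = t * l ∧
        s'.reg 36 = ∑ i ∈ Finset.range l, rowVal d l size E F q t i ∧
        ∀ t' < (d + 1) ^ l, s'.reg 36 ≤ ∑ i ∈ Finset.range l, rowVal d l size E F q t' i := by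
  rw [searchProg, Ends.seq_iff, Ends.assign_iff, Ends.seq_iff, Ends.assign_iff]
  set s₁ := (s.setReg 36 (Expr.val s (.add (.get 12 (.reg 21)) (.const 1)))) with hs₁
  have h₁ : EvalCtx d l c₀ k size E F (s₁.setReg 25 (Expr.val s₁ (.const 0))) :=
    ⟨⟨h.1.1, h.1.2, h.1.3, h.1.4, h.1.5⟩, h.2, h.3, h.4, h.5, h.6⟩
  have hX : 1 ≤ (d + 1) ^ l := Nat.one_le_pow _ _ (by omega)
  refine Ends.forLoop_le (fun t s' => s'.reg 25 = t * l ∧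
    (s'.reg 36 = s.arr 12 k + 1 ∨ ∃ t' < t, s'.reg 37 = t' * l ∧
      s'.reg 36 = ∑ i ∈ Finset.range l, rowVal d l size E F q t' i) ∧
    ∀ t' < t, s'.reg 36 ≤ ∑ i ∈ Finset.range l, rowVal d l size E F q t' i)
    (fun _ => 50 * (l + 1) + 12) ?_ ?_ ?_
  · simp [hs₁, h.node]
  · rintro t s' ht hxt hag ⟨g25, g36, gle⟩
    rw [h₁.rows] at ht
    have hc := h₁.congr hag
    rw [Ends.seq_iff]
    refine (scoreProg_spec hc hq ht (by
      rw [hag.reg 34 (by decide)]; simpa [hs₁] using h34) g25).conseq ?_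
    rintro t₂ s₂ a₂ ⟨T₂, k25, k35⟩
    have e36 : s₂.reg 36 = s'.reg 36 := a₂.reg 36 (by decide)
    have e37 : s₂.reg 37 = s'.reg 37 := a₂.reg 37 (by decide)
    have e23 : s₂.reg 23 = l := (hc.congr a₂).num
    simp only [Ends.cond_iff, Ends.seq_iff, Ends.assign_iff, Ends.skip_iff, Expr.val_sub,
      Expr.val_reg, Expr.cost_sub, Expr.cost_reg]
    constructor
    · intro hlt
      refine ⟨by omega, by simpa using k25, Or.inr ⟨t, by omega, ?_, by simpa using k35⟩, ?_⟩
      · simp only [Mem.setReg_reg]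
        norm_num
        rw [k25, e23, add_mul, one_mul, Nat.add_sub_cancel]
      · intro t' ht'
        simp only [Mem.setReg_reg]
        norm_num
        rcases Nat.lt_succ_iff_lt_or_eq.1 ht' with h' | rfl
        · have := gle t' h'
          omega
        · exact k35.le
    · intro hle
      refine ⟨by omega, by simpa using k25, ?_, ?_⟩
      · refine g36.imp (fun e => by simpa [e36] using e) ?_
        rintro ⟨t', ht', q1, q2⟩
        exact ⟨t', by omega, by simpa [e37] using q1, by simpa [e36] using q2⟩
      · intro t' ht'
        simp only [Mem.setReg_reg]
        norm_num
        rcases Nat.lt_succ_iff_lt_or_eq.1 ht' with h' | rfl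
        · have := gle t' h'
          omega
        · rw [← k35]; omega
  · rintro t' s' _ hag ⟨-, g36, gle⟩ hT
    rw [h₁.rows] at g36 gle hT
    refine ⟨?_, ?_⟩
    · simp only [Finset.sum_const, Finset.card_range, smul_eq_mul] at hT
      simp only [Expr.cost_const, Expr.cost_add, Expr.cost_get, Expr.cost_reg]
      nlinarith
    · rcases g36 with g36 | ⟨t, ht, q1, q2⟩
      · have := gle 0 (by omega)
        omega
      · exact ⟨t, ht, q1, q2, gle⟩

/-- Records the numbers and the demands of the children in the chosen row. -/
def recordProg : Cmd :=
  forLoop 32 23 (.seq (.write 18 (.add (.get 15 (.add (.reg 24) (.reg 32))) (.reg 34))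
      (.sub (.reg 34) (.get 20 (.add (.reg 37) (.reg 32)))))
    (.write 17 (.add (.get 15 (.add (.reg 24) (.reg 32))) (.reg 34))
      (.max (.get 19 (.add (.reg 37) (.reg 32)))
        (.get 16 (.add (.get 15 (.add (.reg 24) (.reg 32)))
          (.sub (.reg 34) (.get 20 (.add (.reg 37) (.reg 32)))))))))

theorem recordProg_spec {q t : ℕ} (h : EvalCtx d l c₀ k size E F s) (hq : q ≤ d)
    (ht : t < (d + 1) ^ l) (h34 : s.reg 34 = q) (h37 : s.reg 37 = t * l) :
    Ends recordProg s fun t' s' => t' ≤ 60 * (l + 1) ∧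
      (∀ i < l, s'.arr 17 ((c₀ + i) * (d + 1) + q) = rowVal d l size E F q t i ∧
        s'.arr 18 ((c₀ + i) * (d + 1) + q) = q - rowSum (d + 1) l size E t i) ∧
      ∀ p, (∀ i < l, p ≠ (c₀ + i) * (d + 1) + q) →
        s'.arr 17 p = s.arr 17 p ∧ s'.arr 18 p = s.arr 18 p := by
  rw [recordProg]
  refine Ends.forLoop_le (fun i s' =>
    (∀ j < i, s'.arr 17 ((c₀ + j) * (d + 1) + q) = rowVal d l size E F q t j ∧
      s'.arr 18 ((c₀ + j) * (d + 1) + q) = q - rowSum (d + 1) l size E t j) ∧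
    ∀ p, (∀ j < i, p ≠ (c₀ + j) * (d + 1) + q) →
      s'.arr 17 p = s.arr 17 p ∧ s'.arr 18 p = s.arr 18 p) (fun _ => 50) ?_ ?_ ?_
  · simp
  · rintro i s' hi hxi hag ⟨g1, g2⟩
    rw [h.num] at hi
    have hc := h.congr hag
    have g34 : s'.reg 34 = q := by rw [hag.reg 34 (by decide)]; exact h34
    have g37 : s'.reg 37 = t * l := by rw [hag.reg 37 (by decide)]; exact h37
    obtain ⟨e1, e2⟩ := hc.filled t ht i hi
    simp only [Ends.seq_iff, Ends.write_iff]
    refine ⟨by simp, ?_⟩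
    simp only [Mem.setReg_arr, Mem.setArr_arr, Mem.setArr_reg, Expr.val_add, Expr.val_reg,
      Expr.val_max, Expr.val_get, Expr.val_sub, hxi, hc.fst, hc.base i hi, g34, g37]
    norm_num
    simp only [hc.base i hi, e1, e2, hc.vals i hi _ ((Nat.sub_le _ _).trans hq)]
    constructor
    · intro j hj
      by_cases he : j = i
      · subst he
        simp [rowVal]
      · have hne : (c₀ + j) * (d + 1) + q ≠ (c₀ + i) * (d + 1) + q := fun e => he (by
          have := (row_index_inj (by omega) (by omega) e).1
          omega)
        rw [Function.update_of_ne hne, Function.update_of_ne hne]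
        exact g1 j (by omega)
    · intro p hp
      have hne := hp i (by omega)
      rw [Function.update_of_ne hne, Function.update_of_ne hne]
      exact g2 p fun j hj => hp j (by omega)
  · rintro t' s' _ hag ⟨g1, g2⟩ hT
    rw [h.num] at g1 g2 hT
    refine ⟨?_, g1, g2⟩
    simp only [Finset.sum_const, Finset.card_range, smul_eq_mul] at hT
    omega

/-- Computes the values of a node that is not a leaf. -/
def evalProg : Cmd :=
  forLoop 34 20 (.seq searchProg (.seq recordProg
    (.write 16 (.add (.get 15 (.reg 21)) (.reg 34)) (.reg 36))))

/-- Row `t` of the table is optimal for the demand `q`, and has been recorded. -/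
def Recorded (d l c₀ k : ℕ) (size : ℕ → ℕ) (E F : ℕ → ℕ → ℕ) (q : ℕ) (s : Mem) : Prop :=
  ∃ t < (d + 1) ^ l,
    s.arr 16 (k * (d + 1) + q) = ∑ i ∈ Finset.range l, rowVal d l size E F q t i ∧
    (∀ t' < (d + 1) ^ l,
      s.arr 16 (k * (d + 1) + q) ≤ ∑ i ∈ Finset.range l, rowVal d l size E F q t' i) ∧
    ∀ i < l, s.arr 17 ((c₀ + i) * (d + 1) + q) = rowVal d l size E F q t i ∧
      s.arr 18 ((c₀ + i) * (d + 1) + q) = q - rowSum (d + 1) l size E t i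

/-- The values of the children are still read while those of node `k` are written. The assumption `k
< c₀` keeps these parts of array `16` apart, and records for different demands are distinguished by
the remainder of the address modulo `d + 1`. -/
theorem evalProg_spec (h : EvalCtx d l c₀ k size E F s) (hk : k < c₀) (h20 : s.reg 20 = d + 1)
    (h15 : s.arr 15 k = k * (d + 1))
    (h0 : ∀ q ≤ d, ∑ i ∈ Finset.range l, rowVal d l size E F q 0 i ≤ s.arr 12 k) :
    Ends evalProg s fun t' s' => t' ≤ 200 * ((l + 1) * (d + 1) ^ (l + 1)) ∧
      (∀ q ≤ d, Recorded d l c₀ k size E F q s') ∧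
      (∀ p, (∀ q ≤ d, p ≠ k * (d + 1) + q) → s'.arr 16 p = s.arr 16 p) ∧
      ∀ p, (∀ i < l, ∀ q ≤ d, p ≠ (c₀ + i) * (d + 1) + q) →
        s'.arr 17 p = s.arr 17 p ∧ s'.arr 18 p = s.arr 18 p := by
  have hX : 1 ≤ (d + 1) ^ l := Nat.one_le_pow _ _ (by omega)
  rw [evalProg]
  refine Ends.forLoop_le (fun q s' => (∀ q' < q, Recorded d l c₀ k size E F q' s') ∧
      (∀ p, (∀ q' < q, p ≠ k * (d + 1) + q') → s'.arr 16 p = s.arr 16 p) ∧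
      ∀ p, (∀ i < l, ∀ q' < q, p ≠ (c₀ + i) * (d + 1) + q') →
        s'.arr 17 p = s.arr 17 p ∧ s'.arr 18 p = s.arr 18 p)
    (fun _ => 160 * ((l + 1) * (d + 1) ^ l)) ?_ ?_ ?_
  · simp
  · rintro q s' hq hxq hag ⟨g1, g2, g3⟩
    rw [h20] at hq
    have hc : EvalCtx d l c₀ k size E F s' := by
      refine ⟨h.toTableCtx.congr hag, ?_, ?_, ?_, ?_, ?_⟩
      · rw [hag.reg 21 (by decide), h.node]
      · rw [hag.reg 27 (by decide), h.rows]
      · rw [hag.arr 15 (by decide)]; exact h.base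
      · intro i hi x hx
        rw [g2, h.vals i hi x hx]
        intro q' hq' e
        have := (row_index_inj (by omega) (by omega) e).1
        omega
      · rw [hag.arr 19 (by decide), hag.arr 20 (by decide)]; exact h.filled
    rw [Ends.seq_iff]
    refine (searchProg_spec hc (by omega) hxq
      (by rw [hag.arr 12 (by decide)]; exact h0 q (by omega))).conseq ?_
    rintro t₁ s₁ a₁ ⟨T₁, t, ht, k37, k36, kle⟩
    rw [Ends.seq_iff]
    refine (recordProg_spec (hc.congr a₁) (by omega) ht
      ((a₁.reg 34 (by decide)).trans hxq) k37).conseq ?_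
    rintro t₂ s₂ a₂ ⟨T₂, r1, r2⟩
    rw [Ends.write_iff]
    have e15 : s₂.arr 15 k = k * (d + 1) := by
      rw [a₂.arr 15 (by decide), a₁.arr 15 (by decide), hag.arr 15 (by decide), h15]
    have e16 : s₂.arr 16 = s'.arr 16 := by rw [a₂.arr 16 (by decide), a₁.arr 16 (by decide)]
    have e17 : s₁.arr 17 = s'.arr 17 := a₁.arr 17 (by decide)
    have e18 : s₁.arr 18 = s'.arr 18 := a₁.arr 18 (by decide)
    have e36 : s₂.reg 36 = s₁.reg 36 := a₂.reg 36 (by decide)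
    rw [e17, e18] at r2
    simp only [Expr.val_add, Expr.val_get, Expr.val_reg, ((hc.congr a₁).congr a₂).node, e15,
      a₂.reg 34 (by decide), a₁.reg 34 (by decide), hxq, e36]
    refine ⟨?_, ?_, ?_, ?_⟩
    · simp only [Expr.cost_add, Expr.cost_get, Expr.cost_reg]
      nlinarith
    · intro q' hq'
      rcases Nat.lt_succ_iff_lt_or_eq.1 hq' with h' | rfl
      · obtain ⟨t', ht', u1, u2, u3⟩ := g1 q' h'
        have hne : ∀ c c', c * (d + 1) + q' ≠ c' * (d + 1) + q := fun c c' e => by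
          have := (row_index_inj (by omega) (by omega) e).2
          omega
        have e16' : ((s₂.setArr 16 (k * (d + 1) + q) (s₁.reg 36)).setReg 34 (q + 1)).arr 16
            (k * (d + 1) + q') = s'.arr 16 (k * (d + 1) + q') := by
          rw [Mem.setReg_arr, Mem.setArr_arr, if_pos rfl, Function.update_of_ne (hne k k), e16]
        refine ⟨t', ht', e16'.trans u1, fun t'' ht'' => e16'.le.trans (u2 t'' ht''),
          fun i hi => ?_⟩
        obtain ⟨v1, v2⟩ := r2 ((c₀ + i) * (d + 1) + q') fun j _ => hne _ _
        simpa [v1, v2] using u3 i hi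
      · have e16' : ((s₂.setArr 16 (k * (d + 1) + q') (s₁.reg 36)).setReg 34 (q' + 1)).arr 16
            (k * (d + 1) + q') = s₁.reg 36 := by simp
        exact ⟨t, ht, e16'.trans k36, fun t'' ht'' => e16'.le.trans (kle t'' ht''),
          fun i hi => by simpa using r1 i hi⟩
    · intro p hp
      rw [← g2 p fun q' hq' => hp q' (by omega)]
      simp [hp q (by omega), e16]
    · intro p hp
      obtain ⟨v1, v2⟩ := r2 p fun i hi => hp i hi q (by omega)
      obtain ⟨w1, w2⟩ := g3 p fun i hi q' hq' => hp i hi q' (by omega)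
      simp [v1, v2, w1, w2]
  · rintro t' s' _ hag ⟨g1, g2, g3⟩ hT
    rw [h20] at g1 g2 g3 hT
    refine ⟨?_, fun q hq => g1 q (by omega), fun p hp => g2 p fun q hq => hp q (by omega),
      fun p hp => g3 p fun i hi q hq => hp i hi q (by omega)⟩
    simp only [Finset.sum_const, Finset.card_range, smul_eq_mul] at hT
    rw [pow_succ]
    have : 1 ≤ (l + 1) * (d + 1) ^ l := Nat.mul_pos (by omega) hX
    nlinarith


/-! ### The dynamic program -/

/-- The registers that the dynamic program may write. -/
abbrev workRegs : List ℕ :=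
  [21, 22, 23, 24, 25, 26, 27, 28, 29, 30, 31, 32, 33, 34, 35, 36, 37, 38, 39, 40]

/-- The arrays that the dynamic program may write. -/
abbrev workArrs : List ℕ := [1, 16, 17, 18, 19, 20, 21, 22]

variable {n : ℕ}

/-- The memory before the dynamic program for the demand `d` starts; `ρ k` is the representative of
node `k`. -/
structure Start (A : Fin n → Fin n → Prop) (w : ℕ) (M : ℕ → Finset (Fin n)) (d : ℕ)
    (ρ : ℕ → Fin n) (s : Mem) : Prop extends Ready A w M s where
  demand : s.reg 2 = d
  wide : s.reg 20 = d + 1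
  base : ∀ c < s.reg 3, s.arr 15 c = c * (d + 1)
  rep : ∀ c < s.reg 3, ρ c ∈ M c ∧ s.arr 13 c = ρ c

variable {A : Fin n → Fin n → Prop} {w d : ℕ} {M : ℕ → Finset (Fin n)} {ρ : ℕ → Fin n} {s₀ s : Mem}

namespace PartialTree

theorem first_add {j k m : ℕ} (h : PartialTree A w m M s) (hj : j < k) (hk : k < m) :
    s.arr 10 j + s.arr 11 j ≤ s.arr 10 k := by
  rw [h.first j (by omega), h.first k hk, add_assoc, ← Finset.sum_range_succ]
  exact Nat.add_le_add_left
    (Finset.sum_le_sum_of_subset (Finset.range_mono (by omega))) _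

theorem child_lt {i k : ℕ} (h : PartialTree A w (s.reg 3) M s) (hk : k < s.reg 3)
    (hi : i < s.arr 11 k) : s.arr 10 k + i < s.reg 3 := by
  have h1 := h.total
  rw [h.first k hk]
  have : ∑ j ∈ Finset.range (k + 1), s.arr 11 j ≤ ∑ j ∈ Finset.range (s.reg 3), s.arr 11 j :=
    Finset.sum_le_sum_of_subset (Finset.range_mono (by omega))
  rw [Finset.sum_range_succ] at this
  omega

end PartialTree

/-- The values of node `k` are correct: they are lower bounds for the size of dominating sets of
this node, and are attained, with the recorded numbers and demands of the children. -/
structure Solved (A : Fin n → Fin n → Prop) (M : ℕ → Finset (Fin n)) (d : ℕ) (ρ : ℕ → Fin n)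
    (s₀ : Mem) (k : ℕ) (s : Mem) : Prop where
  lower : ∀ q ≤ d, ∀ T, LocalDom A (M k) q T → s.arr 16 (k * (d + 1) + q) ≤ (M k ∩ T).card
  le_size : ∀ q ≤ d, s.arr 16 (k * (d + 1) + q) ≤ (M k).card
  leaf : s₀.arr 11 k = 0 → ∀ q ≤ d, s.arr 16 (k * (d + 1) + q) = bit (q ≠ 0)
  sum : s₀.arr 11 k ≠ 0 → ∀ q ≤ d, ∑ i ∈ Finset.range (s₀.arr 11 k),
    s.arr 17 ((s₀.arr 10 k + i) * (d + 1) + q) = s.arr 16 (k * (d + 1) + q)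
  child : ∀ q ≤ d, ∀ i < s₀.arr 11 k, s.arr 18 ((s₀.arr 10 k + i) * (d + 1) + q) ≤ d ∧
    s.arr 16 ((s₀.arr 10 k + i) * (d + 1) + s.arr 18 ((s₀.arr 10 k + i) * (d + 1) + q)) ≤
      s.arr 17 ((s₀.arr 10 k + i) * (d + 1) + q) ∧
    s.arr 17 ((s₀.arr 10 k + i) * (d + 1) + q) ≤ (M (s₀.arr 10 k + i)).card ∧
    q ≤ s.arr 18 ((s₀.arr 10 k + i) * (d + 1) + q) + ∑ j ∈ Finset.range (s₀.arr 11 k),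
      bit (A (ρ (s₀.arr 10 k + i)) (ρ (s₀.arr 10 k + j))) *
        s.arr 17 ((s₀.arr 10 k + j) * (d + 1) + q)

theorem Solved.congr {k : ℕ} {s' : Mem} (h : Solved A M d ρ s₀ k s)
    (h1 : ∀ q ≤ d, s'.arr 16 (k * (d + 1) + q) = s.arr 16 (k * (d + 1) + q))
    (h2 : ∀ i < s₀.arr 11 k, ∀ q ≤ d, s'.arr 16 ((s₀.arr 10 k + i) * (d + 1) + q) =
      s.arr 16 ((s₀.arr 10 k + i) * (d + 1) + q))
    (h3 : ∀ i < s₀.arr 11 k, ∀ q ≤ d, s'.arr 17 ((s₀.arr 10 k + i) * (d + 1) + q) =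
      s.arr 17 ((s₀.arr 10 k + i) * (d + 1) + q) ∧ s'.arr 18 ((s₀.arr 10 k + i) * (d + 1) + q) =
      s.arr 18 ((s₀.arr 10 k + i) * (d + 1) + q)) : Solved A M d ρ s₀ k s' := by
  constructor
  · intro q hq
    rw [h1 q hq]
    exact h.lower q hq
  · intro q hq
    rw [h1 q hq]
    exact h.le_size q hq
  · intro h0 q hq
    rw [h1 q hq]
    exact h.leaf h0 q hq
  · intro h0 q hq
    rw [h1 q hq, ← h.sum h0 q hq]
    exact Finset.sum_congr rfl fun i hi => (h3 i (Finset.mem_range.1 hi) q hq).1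
  · intro q hq i hi
    obtain ⟨c1, c2, c3, c4⟩ := h.child q hq i hi
    rw [(h3 i hi q hq).1, (h3 i hi q hq).2, h2 i hi _ c1]
    refine ⟨c1, c2, c3, c4.trans_eq ?_⟩
    congr 1
    refine Finset.sum_congr rfl fun j hj => ?_
    rw [(h3 j (Finset.mem_range.1 hj) q hq).1]

/-- Computes the values of a leaf. -/
def leafProg : Cmd :=
  forLoop 34 20 (.write 16 (.add (.get 15 (.reg 21)) (.reg 34)) (.isZero (.isZero (.reg 34))))

theorem leafProg_spec {k : ℕ} (h20 : s.reg 20 = d + 1) (h21 : s.reg 21 = k)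
    (h15 : s.arr 15 k = k * (d + 1)) :
    Ends leafProg s fun t s' => t ≤ 30 * (d + 1) ∧
      (∀ q ≤ d, s'.arr 16 (k * (d + 1) + q) = bit (q ≠ 0)) ∧
      ∀ p, (∀ q ≤ d, p ≠ k * (d + 1) + q) → s'.arr 16 p = s.arr 16 p := by
  rw [leafProg]
  refine Ends.forLoop_le (fun q s' => (∀ q' < q, s'.arr 16 (k * (d + 1) + q') = bit (q' ≠ 0)) ∧
    ∀ p, (∀ q' < q, p ≠ k * (d + 1) + q') → s'.arr 16 p = s.arr 16 p) (fun _ => 12) ?_ ?_ ?_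
  · simp
  · rintro q s' hq hxq hag ⟨g1, g2⟩
    have e15 : s'.arr 15 k = k * (d + 1) := by rw [hag.arr 15 (by decide), h15]
    have e21 : s'.reg 21 = k := by rw [hag.reg 21 (by decide), h21]
    simp only [Ends.write_iff, Mem.setReg_arr, Mem.setArr_arr, Expr.val_add, Expr.val_get,
      Expr.val_reg, Expr.val_isZero, e15, e21, hxq, if_true, bit_eq_zero]
    refine ⟨by simp, fun q' hq' => ?_, fun p hp => ?_⟩
    · by_cases he : q' = q
      · rw [he, Function.update_self]
      · rw [Function.update_of_ne (by omega)]
        exact g1 q' (by omega)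
    · rw [Function.update_of_ne (hp q (by omega))]
      exact g2 p fun q' hq' => hp q' (by omega)
  · rintro t s' _ hag ⟨g1, g2⟩ hT
    rw [h20] at g1 g2 hT
    simp only [Finset.sum_const, Finset.card_range, smul_eq_mul] at hT
    exact ⟨by omega, fun q hq => g1 q (by omega), fun p hp => g2 p fun q hq => hp q (by omega)⟩

/-- If the only vertex is not chosen, it has no chosen neighbour in the node, so only the demand
zero is met. -/
theorem card_pos_of_localDom {q : ℕ} {X T : Finset (Fin n)} (hX : X.card = 1)
    (h : LocalDom A X q T) : bit (q ≠ 0) ≤ (X ∩ T).card := by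
  obtain ⟨v, rfl⟩ := Finset.card_eq_one.1 hX
  by_cases hv : v ∈ T
  · rw [Finset.singleton_inter_of_mem hv, Finset.card_singleton]
    exact bit_le_one _
  · have := h v (Finset.mem_singleton_self v) hv
    rw [Finset.singleton_inter_of_notMem hv] at this ⊢
    simp only [Finset.filter_empty, Finset.card_empty] at this
    simp [bit_of_false, Nat.le_zero.1 this]

/-- Computes the values of a node. -/
def solveProg : Cmd :=
  .cond (.get 11 (.reg 21))
    (.seq (.assign 23 (.get 11 (.reg 21)))
      (.seq (.assign 24 (.get 10 (.reg 21))) (.seq tableProg evalProg)))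
    leafProg

/-- The recorded row makes the node solved. -/
theorem solved_of_recorded {k l c₀ : ℕ} {F : ℕ → ℕ → ℕ} (h : Start A w M d ρ s₀)
    (hirr : ∀ x, ¬ A x x) (hk : k < s₀.reg 3) (hl : s₀.arr 11 k = l) (hl0 : l ≠ 0)
    (hc : s₀.arr 10 k = c₀)
    (hlow : ∀ i < l, ∀ q ≤ d, ∀ T, LocalDom A (M (c₀ + i)) q T → F i q ≤ (M (c₀ + i) ∩ T).card)
    (hsize : ∀ i < l, ∀ q ≤ d, F i q ≤ (M (c₀ + i)).card)
    (hF : ∀ i < l, ∀ q ≤ d, s.arr 16 ((c₀ + i) * (d + 1) + q) = F i q)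
    (hrec : ∀ q ≤ d, Recorded d l c₀ k (fun i => (M (c₀ + i)).card)
      (fun i j => bit (A (ρ (c₀ + i)) (ρ (c₀ + j)))) F q s) : Solved A M d ρ s₀ k s := by
  obtain ⟨col, hu, hcol, hM⟩ := h.tree.split k hk (by omega)
  rw [hl] at hcol hM
  rw [hc] at hM
  have hlt : ∀ i < l, c₀ + i < s₀.reg 3 := fun i hi => by
    have := h.tree.child_lt hk (i := i) (by omega)
    rwa [hc] at this
  have hρ : ∀ i < l, ρ (c₀ + i) ∈ M k ∧ col (ρ (c₀ + i)) = i := fun i hi => by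
    have := (h.rep _ (hlt i hi)).1
    rw [hM i hi] at this
    exact Finset.mem_filter.1 this
  have hval : ∀ q ≤ d, ∀ t, ∀ i < l, rowVal d l (fun i => (M (c₀ + i)).card)
      (fun i j => bit (A (ρ (c₀ + i)) (ρ (c₀ + j)))) F q t i ≤ (M (c₀ + i)).card :=
    fun q hq t i hi => max_le (min_le_right _ _) (hsize i hi _ ((Nat.sub_le _ _).trans hq))
  have hcard : ∀ T : Finset (Fin n), (M k ∩ T).card = ∑ i ∈ Finset.range l,
      (M (c₀ + i) ∩ T).card := fun T => by
    rw [card_inter_eq_sum hcol]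
    exact Finset.sum_congr rfl fun i hi => by rw [hM i (Finset.mem_range.1 hi)]
  refine ⟨fun q hq T hT => ?_, fun q hq => ?_, fun h0 => by omega, fun _ q hq => ?_,
    fun q hq i hi => ?_⟩
  · obtain ⟨-, -, -, hle, -⟩ := hrec q hq
    -- The row belonging to `T` has as digits the numbers of vertices of `T` in the children, capped
    -- at `d`. Its value is at most the size of `M k ∩ T`: in each child `T` meets the remaining
    -- demand, and this demand is not affected by the capping.
    obtain ⟨t, ht, hdig⟩ := exists_digits (X := d + 1) (fun i => min (M (c₀ + i) ∩ T).card d) l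
      fun i _ => by omega
    refine (hle t ht).trans ?_
    rw [hcard T]
    have hnum : ∀ i < l, rowNum (d + 1) (fun i => (M (c₀ + i)).card) t i =
        min (M (c₀ + i) ∩ T).card d := fun i hi => by
      rw [rowNum, hdig i hi]
      have := Finset.card_le_card (Finset.inter_subset_left (s₁ := M (c₀ + i)) (s₂ := T))
      omega
    refine Finset.sum_le_sum fun i hi => ?_
    have hi := Finset.mem_range.1 hi
    refine max_le ((hnum i hi).le.trans (min_le_left _ _)) ?_
    refine hlow i hi _ ((Nat.sub_le _ _).trans hq) T ?_
    have h1 := hT.child hu hcol hρ hirr i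
    have h2 : rowSum (d + 1) l (fun i => (M (c₀ + i)).card)
        (fun i j => bit (A (ρ (c₀ + i)) (ρ (c₀ + j)))) t i = ∑ j ∈ Finset.range l,
          bit (A (ρ (c₀ + i)) (ρ (c₀ + j))) * min (M (c₀ + j) ∩ T).card d :=
      Finset.sum_congr rfl fun j hj => by rw [hnum j (Finset.mem_range.1 hj)]
    rw [h2, sub_sum_min hq]
    rw [← hM i hi] at h1
    convert h1 using 2
    refine Finset.sum_congr rfl fun j hj => ?_
    rw [hM j (Finset.mem_range.1 hj)]
  · obtain ⟨t, -, he, -⟩ := hrec q hq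
    rw [he]
    have := hcard Finset.univ
    simp only [Finset.inter_univ] at this
    rw [this]
    exact Finset.sum_le_sum fun i hi => hval q hq t i (Finset.mem_range.1 hi)
  · obtain ⟨t, -, he, -, hr⟩ := hrec q hq
    rw [he, hl, hc]
    exact Finset.sum_congr rfl fun i hi => (hr i (Finset.mem_range.1 hi)).1
  · obtain ⟨t, -, he, -, hr⟩ := hrec q hq
    rw [hl] at hi ⊢
    rw [hc, (hr i hi).1, (hr i hi).2, hF i hi _ ((Nat.sub_le _ _).trans hq)]
    refine ⟨(Nat.sub_le _ _).trans hq, le_max_right _ _, hval q hq t i hi, ?_⟩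
    -- The recorded numbers are maxima, so they are at least the numbers of the row from which the
    -- remaining demands were computed.
    refine (le_tsub_add (b := q)).trans (Nat.add_le_add_left (Finset.sum_le_sum fun j hj => ?_) _)
    rw [(hr j (Finset.mem_range.1 hj)).1]
    exact Nat.mul_le_mul_left _ (le_max_left _ _)

/-- Children have larger numbers than their parent, so they are already solved. Nodes solved before
remain so: new values are written only for `k`, new records only for the children of `k`, and by
`first_add` these are not children of any later node. -/
theorem solveProg_spec {k : ℕ} (hd : 0 < d) (h : Start A w M d ρ s₀) (hirr : ∀ x, ¬ A x x)
    (hA : Agree workRegs workArrs s₀ s) (hk : k < s₀.reg 3) (h21 : s.reg 21 = k)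
    (hs : ∀ c, k < c → c < s₀.reg 3 → Solved A M d ρ s₀ c s) :
    Ends solveProg s fun t s' => t ≤ 600 * ((s₀.arr 11 k + 1) * (d + 1) ^ (s₀.arr 11 k + 1)) ∧
      ∀ c, k ≤ c → c < s₀.reg 3 → Solved A M d ρ s₀ c s' := by
  have e11 : s.arr 11 = s₀.arr 11 := hA.arr 11 (by decide)
  have e10 : s.arr 10 = s₀.arr 10 := hA.arr 10 (by decide)
  have e15 : s.arr 15 k = k * (d + 1) := by rw [hA.arr 15 (by decide), h.base k hk]
  have e20 : s.reg 20 = d + 1 := by rw [hA.reg 20 (by decide), h.wide]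
  rw [solveProg, Ends.cond_iff]
  simp only [Expr.val_get, Expr.val_reg, h21, e11, Expr.cost_get, Expr.cost_reg]
  constructor
  · intro hl0
    obtain ⟨l, hl⟩ : ∃ l, s₀.arr 11 k = l := ⟨_, rfl⟩
    obtain ⟨c₀, hc⟩ : ∃ c₀, s₀.arr 10 k = c₀ := ⟨_, rfl⟩
    have hkc : k < c₀ := hc ▸ h.tree.lt_first k hk
    have hlt : ∀ i < l, c₀ + i < s₀.reg 3 := fun i hi => by
      have := h.tree.child_lt hk (i := i) (by omega)
      rwa [hc] at this
    simp only [Ends.seq_iff (p := .assign 23 _), Ends.seq_iff (p := .assign 24 _), Ends.assign_iff]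
    simp only [Expr.val_get, Expr.val_reg, Mem.setReg_reg, Mem.setReg_arr, h21, e11, e10]
    rw [if_neg (by decide), hl, hc]
    set s₂ := (s.setReg 23 l).setReg 24 c₀
    have htab : TableCtx d l c₀ (fun i => (M (c₀ + i)).card)
        (fun i j => bit (A (ρ (c₀ + i)) (ρ (c₀ + j)))) s₂ := by
      refine ⟨?_, by simp [s₂], by simp [s₂], fun i hi => ?_, fun i hi j hj => ?_⟩
      · rw [← h.demand, ← hA.reg 2 (by decide)]; simp [s₂]
      · change s.arr 12 _ = _
        rw [hA.arr 12 (by decide), h.tree.size _ (hlt i hi)]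
      · change s.arr 3 (s.arr 2 (s.arr 13 _) + s.arr 13 _) = _
        rw [hA.arr 3 (by decide), hA.arr 2 (by decide), hA.arr 13 (by decide),
          (h.rep _ (hlt i hi)).2, (h.rep _ (hlt j hj)).2, h.rows.2, h.mat]
    rw [Ends.seq_iff]
    refine (tableProg_spec hd (fun _ _ => bit_le_one _) htab).conseq ?_
    rintro t₃ s₃ a₃ ⟨T₃, g27, gf⟩
    have e16 : s₃.arr 16 = s.arr 16 := a₃.arr 16 (by decide)
    have f15 : s₃.arr 15 = s₀.arr 15 := (a₃.arr 15 (by decide)).trans (hA.arr 15 (by decide))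
    have heval : EvalCtx d l c₀ k (fun i => (M (c₀ + i)).card)
        (fun i j => bit (A (ρ (c₀ + i)) (ρ (c₀ + j))))
        (fun i x => s.arr 16 ((c₀ + i) * (d + 1) + x)) s₃ := by
      refine ⟨htab.congr a₃, ?_, g27, fun i hi => ?_, fun i hi x hx => ?_, fun t ht i hi =>
        gf t i hi ?_⟩
      · rw [a₃.reg 21 (by decide)]; simpa [s₂] using h21
      · rw [f15, h.base _ (hlt i hi)]
      · rw [e16]
      · calc t * l + i < (t + 1) * l := by rw [add_mul]; omega
          _ ≤ (d + 1) ^ l * l := Nat.mul_le_mul_right _ ht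
    have hsum : ∀ q ≤ d, ∑ i ∈ Finset.range l, rowVal d l (fun i => (M (c₀ + i)).card)
        (fun i j => bit (A (ρ (c₀ + i)) (ρ (c₀ + j))))
        (fun i x => s.arr 16 ((c₀ + i) * (d + 1) + x)) q 0 i ≤ s₃.arr 12 k := by
      intro q hq
      have e12 : s₃.arr 12 k = (M k).card := by
        rw [a₃.arr 12 (by decide)]
        change s.arr 12 k = _
        rw [hA.arr 12 (by decide), h.tree.size k hk]
      obtain ⟨col, -, hcol, hM⟩ := h.tree.split k hk hl0
      rw [hl] at hcol hM
      rw [hc] at hM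
      have := card_inter_eq_sum (T := Finset.univ) hcol
      simp only [Finset.inter_univ] at this
      rw [e12, this]
      refine Finset.sum_le_sum fun i hi => ?_
      have hi := Finset.mem_range.1 hi
      rw [← hM i hi]
      exact max_le (min_le_right _ _) ((hs _ (by omega) (hlt i hi)).le_size _
        ((Nat.sub_le _ _).trans hq))
    refine (evalProg_spec heval hkc ?_ ?_ hsum).mono ?_
    · rw [a₃.reg 20 (by decide)]; simpa [s₂] using e20
    · rw [f15, h.base k hk]
    rintro t₄ s₄ ⟨T₄, hrec, r16, r17⟩
    have hrow : ∀ c, k < c → ∀ q ≤ d, s₄.arr 16 (c * (d + 1) + q) = s.arr 16 (c * (d + 1) + q) :=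
      fun c hkc q hq => by
        rw [r16, e16]
        intro q' hq' e
        have := (row_index_inj (by omega) (by omega) e).1
        omega
    refine ⟨?_, fun c hc1 hc2 => ?_⟩
    · have hX : 1 ≤ (l + 1) * (d + 1) ^ l := Nat.mul_pos (by omega) (Nat.pow_pos (by omega))
      have hY : (l + 1) * (d + 1) ^ l ≤ (l + 1) * (d + 1) ^ (l + 1) :=
        Nat.mul_le_mul_left _ (Nat.pow_le_pow_right (by omega) (by omega))
      simp only [Expr.cost_get, Expr.cost_reg]
      omega
    · rcases Nat.eq_or_lt_of_le hc1 with rfl | hkc'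
      · refine solved_of_recorded h hirr hk hl (by omega) hc ?_ ?_ ?_ hrec
        · exact fun i hi => (hs _ (by omega) (hlt i hi)).lower
        · exact fun i hi => (hs _ (by omega) (hlt i hi)).le_size
        · exact fun i hi => hrow _ (by omega)
      · refine (hs c hkc' hc2).congr (hrow c hkc') (fun i hi => hrow _ ?_) fun i hi q hq => ?_
        · have := h.tree.lt_first c hc2
          omega
        · have h1 := h.tree.first_add hkc' hc2
          rw [hc, hl] at h1
          have h17 : s₃.arr 17 = s.arr 17 := a₃.arr 17 (by decide)
          have h18 : s₃.arr 18 = s.arr 18 := a₃.arr 18 (by decide)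
          rw [← h17, ← h18]
          refine r17 _ fun i' hi' q' hq' e => ?_
          have := (row_index_inj (by omega) (by omega) e).1
          omega
  · intro hl
    have hcard := h.tree.leaf k hk hl
    refine (leafProg_spec e20 h21 e15).conseq ?_
    rintro t s' ag ⟨T, g1, g2⟩
    have hrow : ∀ c, k < c → ∀ q ≤ d, s'.arr 16 (c * (d + 1) + q) = s.arr 16 (c * (d + 1) + q) :=
      fun c hkc q hq => g2 _ fun q' hq' e => by
        have := (row_index_inj (by omega) (by omega) e).1
        omega
    refine ⟨by rw [hl]; simp only [zero_add, one_mul, pow_one]; omega, fun c hc1 hc2 => ?_⟩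
    rcases Nat.eq_or_lt_of_le hc1 with rfl | hkc
    · refine ⟨fun q hq T hT => ?_, fun q hq => ?_, fun _ => g1, fun h0 => absurd hl h0,
        fun q hq i hi => by omega⟩
      · rw [g1 q hq]
        exact card_pos_of_localDom hcard hT
      · rw [g1 q hq, hcard]
        exact bit_le_one _
    · refine (hs c hkc hc2).congr (hrow c hkc) (fun i hi => hrow _ ?_) fun i hi q hq => ?_
      · have := h.tree.lt_first c hc2
        omega
      · rw [ag.arr 17 (by decide), ag.arr 18 (by decide)]
        exact ⟨rfl, rfl⟩

/-- Computes the values of all nodes, children before parents. -/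
def dpProg : Cmd :=
  forLoop 22 3 (.seq (.assign 21 (.sub (.sub (.reg 3) (.const 1)) (.reg 22))) solveProg)

theorem dpProg_spec (hd : 0 < d) (h : Start A w M d ρ s) (hirr : ∀ x, ¬ A x x) :
    Ends dpProg s fun t s' => t ≤ 6 + ∑ k ∈ Finset.range (s.reg 3),
        (620 * ((s.arr 11 k + 1) * (d + 1) ^ (s.arr 11 k + 1))) ∧
      ∀ c < s.reg 3, Solved A M d ρ s c s' := by
  rw [dpProg]
  refine Ends.forLoop_le (fun i s' => ∀ c, s.reg 3 ≤ c + i → c < s.reg 3 → Solved A M d ρ s c s')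
    (fun i => 612 * ((s.arr 11 (s.reg 3 - 1 - i) + 1) *
      (d + 1) ^ (s.arr 11 (s.reg 3 - 1 - i) + 1))) ?_ ?_ ?_
  · intro c h1 h2
    omega
  · intro i s' hi hxi hag hI
    rw [Ends.seq_iff, Ends.assign_iff]
    simp only [Expr.val_sub, Expr.val_reg, Expr.val_const, hxi, hag.reg 3 (by decide)]
    have hag' : Agree workRegs workArrs s (s'.setReg 21 (s.reg 3 - 1 - i)) := by
      refine ⟨fun x hx => ?_, fun a ha => hag.arr a fun h => ha ?_⟩
      · have h21 : x ≠ 21 := by rintro rfl; simp at hx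
        rw [Mem.setReg_reg, if_neg h21]
        exact hag.reg x fun h => hx ((by decide : (22 :: (Cmd.seq _ solveProg).regs) ⊆ workRegs) h)
      · exact (by decide : (Cmd.seq _ solveProg).arrs ⊆ workArrs) h
    refine (solveProg_spec (k := s.reg 3 - 1 - i) hd h hirr hag' (by omega) (by simp) ?_).mono ?_
    · intro c h1 h2
      exact (hI c (by omega) h2).congr (fun _ _ => rfl) (fun _ _ _ _ => rfl)
        fun _ _ _ _ => ⟨rfl, rfl⟩
    · rintro t s'' ⟨T, g⟩
      refine ⟨?_, fun c h1 h2 => (g c (by omega) h2).congr (fun _ _ => rfl) (fun _ _ _ _ => rfl)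
        fun _ _ _ _ => ⟨rfl, rfl⟩⟩
      have : 1 ≤ (s.arr 11 (s.reg 3 - 1 - i) + 1) * (d + 1) ^ (s.arr 11 (s.reg 3 - 1 - i) + 1) :=
        Nat.mul_pos (by omega) (Nat.pow_pos (by omega))
      simp only [Expr.cost_sub, Expr.cost_reg, Expr.cost_const]
      omega
  · intro t s' _ _ hI hT
    refine ⟨hT.trans (Nat.add_le_add_left ?_ _), fun c hc => hI c (by omega) hc⟩
    rw [← Finset.sum_range_reflect]
    refine Finset.sum_le_sum fun i hi => ?_
    have hi := Finset.mem_range.1 hi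
    have e : s.reg 3 - 1 - (s.reg 3 - 1 - i) = i := by omega
    rw [e]
    have : 1 ≤ (s.arr 11 i + 1) * (d + 1) ^ (s.arr 11 i + 1) :=
      Nat.mul_pos (by omega) (Nat.pow_pos (by omega))
    omega


/-! ### Construction of the dominating set -/

variable {n : ℕ} {A : Fin n → Fin n → Prop} {w d : ℕ} {M : ℕ → Finset (Fin n)} {ρ : ℕ → Fin n}
  {s₀ s : Mem}

namespace PartialTree

/-- Among the leaves before `k` and the unprocessed nodes that have a parent before `k`, different
nodes are disjoint. -/
theorem disjoint_of_front {m k : ℕ} (h : PartialTree A w m M s) (hk : k ≤ m) :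
    ∀ i j, i < 1 + ∑ a ∈ Finset.range k, s.arr 11 a → j < 1 + ∑ a ∈ Finset.range k, s.arr 11 a →
      (k ≤ i ∨ s.arr 11 i = 0) → (k ≤ j ∨ s.arr 11 j = 0) → i ≠ j → Disjoint (M i) (M j) := by
  induction k with
  | zero => simp
  | succ k ih =>
    have ih := ih (by omega)
    have hf := h.first k hk
    have hlt := h.lt_first k hk
    rw [← hf] at ih
    rw [Finset.sum_range_succ, ← add_assoc, ← hf]
    by_cases h0 : s.arr 11 k = 0
    · intro i j hi hj hi' hj' hij
      refine ih i j (by omega) (by omega) ?_ ?_ hij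
      · exact hi'.imp (by omega) id
      · exact hj'.imp (by omega) id
    obtain ⟨col, -, -, hM⟩ := h.split k hk h0
    have child : ∀ i, s.arr 10 k ≤ i → i < s.arr 10 k + s.arr 11 k →
        M i = (M k).filter fun x => col x = i - s.arr 10 k := fun i h1 h2 => by
      have := hM (i - s.arr 10 k) (by omega)
      rwa [Nat.add_sub_cancel' h1] at this
    -- A child of `k` is contained in `M k`, which by induction is disjoint from the other nodes of
    -- the front.
    have old : ∀ i j, i < s.arr 10 k → s.arr 10 k ≤ j → j < s.arr 10 k + s.arr 11 k →
        (k + 1 ≤ i ∨ s.arr 11 i = 0) → Disjoint (M i) (M j) := by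
      intro i j hi hj hj' hi'
      rw [child j hj hj']
      refine (ih i k hi hlt (hi'.imp (by omega) id) (.inl le_rfl) ?_).mono_right
        (Finset.filter_subset _ _)
      rintro rfl
      omega
    intro i j hi hj hi' hj' hij
    rcases lt_or_ge i (s.arr 10 k) with h1 | h1 <;> rcases lt_or_ge j (s.arr 10 k) with h2 | h2
    · exact ih i j h1 h2 (hi'.imp (by omega) id) (hj'.imp (by omega) id) hij
    · exact old i j h1 h2 hj hi'
    · exact (old j i h2 h1 hi hj').symm
    · rw [child i h1 hi, child j h2 hj, Finset.disjoint_left]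
      intro x hx hx'
      have e1 := (Finset.mem_filter.1 hx).2
      have e2 := (Finset.mem_filter.1 hx').2
      omega

theorem disjoint_leaves {i j : ℕ} (h : PartialTree A w (s.reg 3) M s) (hi : i < s.reg 3)
    (hj : j < s.reg 3) (hi' : s.arr 11 i = 0) (hj' : s.arr 11 j = 0) (hij : i ≠ j) :
    Disjoint (M i) (M j) :=
  h.disjoint_of_front le_rfl i j (by rw [← h.total]; exact hi) (by rw [← h.total]; exact hj)
    (.inr hi') (.inr hj') hij

end PartialTree

/-- Node `c` has been assigned a demand (array `22`) and a number of chosen vertices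
(array `21`). -/
structure Assigned (M : ℕ → Finset (Fin n)) (d c : ℕ) (s : Mem) : Prop where
  le : s.arr 22 c ≤ d
  val_le : s.arr 16 (c * (d + 1) + s.arr 22 c) ≤ s.arr 21 c
  le_card : s.arr 21 c ≤ (M c).card

/-- The numbers and demands of the children of node `k` fit to those of `k`. -/
structure Distributed (A : Fin n → Fin n → Prop) (ρ : ℕ → Fin n) (s₀ : Mem) (k : ℕ) (s : Mem) :
    Prop where
  leaf : s₀.arr 11 k = 0 → s.arr 1 (ρ k) = s.arr 21 k
  sum : s₀.arr 11 k ≠ 0 →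
    ∑ i ∈ Finset.range (s₀.arr 11 k), s.arr 21 (s₀.arr 10 k + i) = s.arr 21 k
  demand : ∀ i < s₀.arr 11 k, s.arr 22 k ≤ s.arr 22 (s₀.arr 10 k + i) +
    ∑ j ∈ Finset.range (s₀.arr 11 k),
      bit (A (ρ (s₀.arr 10 k + i)) (ρ (s₀.arr 10 k + j))) * s.arr 21 (s₀.arr 10 k + j)

theorem Distributed.congr {k : ℕ} {s' : Mem} (h : Distributed A ρ s₀ k s)
    (h1 : s₀.arr 11 k = 0 → s'.arr 1 (ρ k) = s.arr 1 (ρ k))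
    (h2 : s'.arr 21 k = s.arr 21 k ∧ s'.arr 22 k = s.arr 22 k)
    (h3 : ∀ i < s₀.arr 11 k, s'.arr 21 (s₀.arr 10 k + i) = s.arr 21 (s₀.arr 10 k + i) ∧
      s'.arr 22 (s₀.arr 10 k + i) = s.arr 22 (s₀.arr 10 k + i)) : Distributed A ρ s₀ k s' := by
  constructor
  · intro h0
    rw [h1 h0, h2.1, h.leaf h0]
  · intro h0
    rw [h2.1, ← h.sum h0]
    exact Finset.sum_congr rfl fun i hi => (h3 i (Finset.mem_range.1 hi)).1
  · intro i hi
    rw [h2.2, (h3 i hi).2]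
    refine (h.demand i hi).trans_eq ?_
    congr 1
    exact Finset.sum_congr rfl fun j hj => by rw [(h3 j (Finset.mem_range.1 hj)).1]

/-- Completely distributed numbers describe a dominating set. -/
theorem localDom_of_distributed {k : ℕ} {S : Finset (Fin n)} (h : Start A w M d ρ s₀)
    (hirr : ∀ x, ¬ A x x) (hs : ∀ c < s₀.reg 3, Solved A M d ρ s₀ c s)
    (ha : ∀ c < s₀.reg 3, Assigned M d c s) (hd : ∀ c < s₀.reg 3, Distributed A ρ s₀ c s)
    (hS : ∀ v : Fin n, v ∈ S ↔ s.arr 1 v ≠ 0) (hk : k < s₀.reg 3) :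
    (M k ∩ S).card = s.arr 21 k ∧ LocalDom A (M k) (s.arr 22 k) S := by
  obtain ⟨b, hb⟩ : ∃ b, b = s₀.reg 3 - k := ⟨_, rfl⟩
  -- Children have larger numbers, so the induction runs from the last node towards the root.
  induction b using Nat.strong_induction_on generalizing k with
  | _ b ih =>
    by_cases h0 : s₀.arr 11 k = 0
    · have hc := h.tree.leaf k hk h0
      have hle := (ha k hk).le_card
      have hval := (ha k hk).val_le
      rw [(hs k hk).leaf h0 _ (ha k hk).le] at hval
      have hρ := (h.rep k hk).1
      have hmem := hS (ρ k)
      rw [(hd k hk).leaf h0] at hmem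
      obtain ⟨v, hv⟩ := Finset.card_eq_one.1 hc
      rw [hc] at hle
      rw [hv, Finset.mem_singleton] at hρ
      rw [hρ] at hmem
      rw [hv]
      by_cases hvS : v ∈ S
      · rw [Finset.singleton_inter_of_mem hvS, Finset.card_singleton]
        have := hmem.1 hvS
        refine ⟨by omega, fun u hu hu' => ?_⟩
        rw [Finset.mem_singleton] at hu
        exact absurd (hu ▸ hvS) hu'
      · rw [Finset.singleton_inter_of_notMem hvS, Finset.card_empty]
        have e : s.arr 21 k = 0 := by
          by_contra hne
          exact hvS (hmem.2 hne)
        -- The leaf is not chosen, so its number is zero, whereas a positive demand would have the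
        -- value one.
        have e' : s.arr 22 k = 0 := by
          by_contra hne
          rw [bit_of_true hne] at hval
          omega
        exact ⟨e.symm, fun u _ _ => by rw [e']; exact Nat.zero_le _⟩
    · obtain ⟨col, hu, hcol, hM⟩ := h.tree.split k hk h0
      have hlt : ∀ i < s₀.arr 11 k, s₀.arr 10 k + i < s₀.reg 3 := fun i hi => h.tree.child_lt hk hi
      have hkc := h.tree.lt_first k hk
      have hρ : ∀ i < s₀.arr 11 k, ρ (s₀.arr 10 k + i) ∈ M k ∧ col (ρ (s₀.arr 10 k + i)) = i :=
        fun i hi => by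
          have := (h.rep _ (hlt i hi)).1
          rw [hM i hi] at this
          exact Finset.mem_filter.1 this
      have ih' : ∀ i < s₀.arr 11 k,
          ((M k).filter (fun x => col x = i) ∩ S).card = s.arr 21 (s₀.arr 10 k + i) ∧
          LocalDom A ((M k).filter fun x => col x = i) (s.arr 22 (s₀.arr 10 k + i)) S :=
        fun i hi => by
          rw [← hM i hi]
          exact ih (s₀.reg 3 - (s₀.arr 10 k + i)) (by have := hlt i hi; omega) (hlt i hi) rfl
      constructor
      · rw [card_inter_eq_sum hcol, ← (hd k hk).sum h0]
        exact Finset.sum_congr rfl fun i hi => (ih' i (Finset.mem_range.1 hi)).1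
      · refine LocalDom.of_children hu hcol hρ hirr (fun i hi => (ih' i hi).2) fun i hi => ?_
        refine ((hd k hk).demand i hi).trans_eq ?_
        congr 1
        exact Finset.sum_congr rfl fun j hj => by rw [(ih' j (Finset.mem_range.1 hj)).1]

/-- Assigns the recorded demand and number to a child, and as many of the remaining vertices as
possible. -/
def childProg : Cmd :=
  .seq (.assign 39 (.add (.reg 24) (.reg 32)))
    (.seq (.assign 40 (.add (.get 15 (.reg 39)) (.reg 34)))
      (.seq (.assign 33 (.min (.reg 38) (.sub (.get 12 (.reg 39)) (.get 17 (.reg 40)))))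
        (.seq (.write 21 (.reg 39) (.add (.get 17 (.reg 40)) (.reg 33)))
          (.seq (.write 22 (.reg 39) (.get 18 (.reg 40)))
            (.assign 38 (.sub (.reg 38) (.reg 33)))))))

theorem childProg_spec {c q : ℕ} (h39 : s.reg 24 + s.reg 32 = c) (h34 : s.reg 34 = q)
    (h15 : s.arr 15 c = c * (d + 1)) :
    Ends childProg s fun t s' => t ≤ 50 ∧
      s'.arr 21 = Function.update (s.arr 21) c (s.arr 17 (c * (d + 1) + q) +
        min (s.reg 38) (s.arr 12 c - s.arr 17 (c * (d + 1) + q))) ∧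
      s'.arr 22 = Function.update (s.arr 22) c (s.arr 18 (c * (d + 1) + q)) ∧
      s'.reg 38 = s.reg 38 - min (s.reg 38) (s.arr 12 c - s.arr 17 (c * (d + 1) + q)) := by
  simp only [childProg, Ends.seq_iff, Ends.assign_iff, Ends.write_iff]
  refine ⟨by simp, ?_⟩
  simp only [Expr.val_add, Expr.val_get, Expr.val_reg, Expr.val_sub, Expr.val_min, Mem.setReg_reg,
    Mem.setReg_arr, Mem.setArr_reg, Mem.setArr_arr]
  norm_num
  simp only [h39, h34, h15, and_self]

/-- Treats a node: distributes the number of chosen vertices to the children, or writes the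
output. -/
def distributeProg : Cmd :=
  .cond (.get 11 (.reg 21))
    (.seq (.assign 34 (.get 22 (.reg 21)))
      (.seq (.assign 38 (.sub (.get 21 (.reg 21)) (.get 16 (.add (.get 15 (.reg 21)) (.reg 34)))))
        (.seq (.assign 23 (.get 11 (.reg 21))) (.seq (.assign 24 (.get 10 (.reg 21)))
          (forLoop 32 23 childProg)))))
    (.write 1 (.get 13 (.reg 21)) (.get 21 (.reg 21)))

/-- The recorded numbers add up to the value of `k`, but `k` may have been assigned more. Filling up
the children greedily is harmless, since a child may have any number between its value and its size,
and larger numbers only help its siblings. -/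
theorem distributeProg_spec {k : ℕ} (h : Start A w M d ρ s₀) (hA : Agree workRegs workArrs s₀ s)
    (hk : k < s₀.reg 3) (h21 : s.reg 21 = k) (hs : ∀ c < s₀.reg 3, Solved A M d ρ s₀ c s)
    (ha : Assigned M d k s) :
    Ends distributeProg s fun t s' => t ≤ 100 * (s₀.arr 11 k + 1) ∧
      (∀ i < s₀.arr 11 k, Assigned M d (s₀.arr 10 k + i) s') ∧ Distributed A ρ s₀ k s' ∧
      (∀ c < s₀.arr 10 k, s'.arr 21 c = s.arr 21 c ∧ s'.arr 22 c = s.arr 22 c) ∧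
      ∀ v : Fin n, (s₀.arr 11 k = 0 → v ≠ ρ k) → s'.arr 1 v = s.arr 1 v := by
  have e11 : s.arr 11 = s₀.arr 11 := hA.arr 11 (by decide)
  have e10 : s.arr 10 = s₀.arr 10 := hA.arr 10 (by decide)
  have e13 : s.arr 13 = s₀.arr 13 := hA.arr 13 (by decide)
  have e15 : s.arr 15 = s₀.arr 15 := hA.arr 15 (by decide)
  have hkc := h.tree.lt_first k hk
  rw [distributeProg, Ends.cond_iff]
  simp only [Expr.val_get, Expr.val_reg, h21, e11, Expr.cost_get, Expr.cost_reg]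
  constructor
  · intro h0
    obtain ⟨l, hl⟩ : ∃ l, s₀.arr 11 k = l := ⟨_, rfl⟩
    obtain ⟨c₀, hc⟩ : ∃ c₀, s₀.arr 10 k = c₀ := ⟨_, rfl⟩
    obtain ⟨q, hq⟩ : ∃ q, s.arr 22 k = q := ⟨_, rfl⟩
    have hqd : q ≤ d := hq ▸ ha.le
    have hlt : ∀ i < l, c₀ + i < s₀.reg 3 := fun i hi => by
      have := h.tree.child_lt hk (i := i) (by omega)
      rwa [hc] at this
    have hsum := (hs k hk).sum h0 q hqd
    have hchild := (hs k hk).child q hqd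
    have hval := ha.val_le
    have hle := ha.le_card
    have hsize : (M k).card = ∑ i ∈ Finset.range l, (M (c₀ + i)).card := by
      obtain ⟨col, -, hcol, hM⟩ := h.tree.split k hk h0
      rw [hl] at hcol hM
      rw [hc] at hM
      have := card_inter_eq_sum (T := Finset.univ) hcol
      simp only [Finset.inter_univ] at this
      rw [this]
      exact Finset.sum_congr rfl fun i hi => by rw [hM i (Finset.mem_range.1 hi)]
    rw [hl] at h0 hsum hchild
    rw [hc] at hsum hchild hkc
    rw [hq] at hval
    simp only [Ends.seq_iff, Ends.assign_iff]
    have e38 : Expr.val (s.setReg 34 (s.arr 22 k)) (.sub (.get 21 (.reg 21))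
        (.get 16 (.add (.get 15 (.reg 21)) (.reg 34)))) =
        s.arr 21 k - s.arr 16 (k * (d + 1) + q) := by
      simp [h21, e15, h.base k hk, hq]
    simp only [Expr.val_get (e := .reg 21), Expr.val_reg, h21, e38]
    simp only [Mem.setReg_reg, Mem.setReg_arr, h21, e11, e10]
    norm_num
    simp only [hl, hc, hq]
    set s₁ := (((s.setReg 34 q).setReg 38 (s.arr 21 k - s.arr 16 (k * (d + 1) + q))).setReg 23
      l).setReg 24 c₀ with hs₁
    refine Ends.forLoop_le (fun i s' =>
      s'.reg 38 + ∑ j ∈ Finset.range i, s'.arr 21 (c₀ + j) =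
        s.arr 21 k - s.arr 16 (k * (d + 1) + q) +
          ∑ j ∈ Finset.range i, s.arr 17 ((c₀ + j) * (d + 1) + q) ∧
      (∀ j < i, s.arr 17 ((c₀ + j) * (d + 1) + q) ≤ s'.arr 21 (c₀ + j) ∧
        s'.arr 21 (c₀ + j) ≤ (M (c₀ + j)).card ∧
        s'.arr 22 (c₀ + j) = s.arr 18 ((c₀ + j) * (d + 1) + q)) ∧
      (s'.reg 38 = 0 ∨ ∀ j < i, s'.arr 21 (c₀ + j) = (M (c₀ + j)).card) ∧
      ∀ c, c < c₀ ∨ c₀ + i ≤ c → s'.arr 21 c = s.arr 21 c ∧ s'.arr 22 c = s.arr 22 c)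
      (fun _ => 50) ?_ ?_ ?_
    · simp [hs₁]
    · rintro i s' hi hxi hag ⟨g1, g2, g3, g4⟩
      replace hi : i < l := by simpa [hs₁] using hi
      have f17 : s'.arr 17 = s.arr 17 := hag.arr 17 (by decide)
      have f18 : s'.arr 18 = s.arr 18 := hag.arr 18 (by decide)
      have f12 : s'.arr 12 (c₀ + i) = (M (c₀ + i)).card := by
        rw [hag.arr 12 (by decide)]
        change s.arr 12 _ = _
        rw [hA.arr 12 (by decide), h.tree.size _ (hlt i hi)]
      have f15 : s'.arr 15 (c₀ + i) = (c₀ + i) * (d + 1) := by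
        rw [hag.arr 15 (by decide)]
        change s.arr 15 _ = _
        rw [e15, h.base _ (hlt i hi)]
      refine (childProg_spec (c := c₀ + i) (q := q) ?_ ?_ f15).mono ?_
      · rw [hxi, hag.reg 24 (by decide)]; simp [hs₁]
      · rw [hag.reg 34 (by decide)]; simp [hs₁]
      rintro t s'' ⟨T, k21, k22, k38⟩
      rw [f17, f12] at k21 k38
      rw [f18] at k22
      obtain ⟨-, -, c3, -⟩ := hchild i (by omega)
      have hcell : (s''.setReg 32 (i + 1)).reg 38 = s''.reg 38 := rfl
      have hne : ∀ j < i, c₀ + j ≠ c₀ + i := fun j hj => by omega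
      rw [hcell, Mem.setReg_arr, k21, k22, k38]
      refine ⟨T, ?_, ?_, ?_, ?_⟩
      · rw [Finset.sum_range_succ, Finset.sum_range_succ, Function.update_self]
        have : ∑ j ∈ Finset.range i, Function.update (s'.arr 21) (c₀ + i)
            (s.arr 17 ((c₀ + i) * (d + 1) + q) + min (s'.reg 38)
              ((M (c₀ + i)).card - s.arr 17 ((c₀ + i) * (d + 1) + q))) (c₀ + j) =
            ∑ j ∈ Finset.range i, s'.arr 21 (c₀ + j) :=
          Finset.sum_congr rfl fun j hj =>
            Function.update_of_ne (hne j (Finset.mem_range.1 hj)) _ _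
        rw [this]
        omega
      · intro j hj
        rcases Nat.lt_succ_iff_lt_or_eq.1 hj with h' | rfl
        · rw [Function.update_of_ne (hne j h'), Function.update_of_ne (hne j h')]
          exact g2 j h'
        · rw [Function.update_self, Function.update_self]
          exact ⟨by omega, by omega, rfl⟩
      · rcases g3 with g3 | g3
        · left; omega
        · by_cases hz : s'.reg 38 ≤ (M (c₀ + i)).card - s.arr 17 ((c₀ + i) * (d + 1) + q)
          · left; omega
          · right
            intro j hj
            rcases Nat.lt_succ_iff_lt_or_eq.1 hj with h' | rfl
            · rw [Function.update_of_ne (hne j h')]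
              exact g3 j h'
            · rw [Function.update_self]
              omega
      · intro c hc'
        rw [Function.update_of_ne (by omega), Function.update_of_ne (by omega)]
        exact g4 c (by omega)
    · rintro t s' _ hag ⟨g1, g2, g3, g4⟩ hT
      have e23 : s₁.reg 23 = l := by simp [hs₁]
      rw [e23] at g1 g2 g3 g4 hT
      have f16 : s'.arr 16 = s.arr 16 := hag.arr 16 (by decide)
      obtain ⟨p1, p2⟩ := g4 k (.inl hkc)
      -- If something remained, all children would be full. The sum of their sizes is the size of `M
      -- k`, so the number assigned to `k` would exceed this size.
      have hz : s'.reg 38 = 0 := by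
        rcases g3 with g3 | g3
        · exact g3
        · have : ∑ j ∈ Finset.range l, s'.arr 21 (c₀ + j) =
              ∑ j ∈ Finset.range l, (M (c₀ + j)).card :=
            Finset.sum_congr rfl fun j hj => g3 j (Finset.mem_range.1 hj)
          omega
      refine ⟨?_, fun i hi => ?_, ⟨fun h0' => absurd (hl ▸ h0') h0, fun _ => ?_, fun i hi => ?_⟩,
        fun c hc' => g4 c (.inl hc'), fun v _ => ?_⟩
      · simp only [Finset.sum_const, Finset.card_range, smul_eq_mul] at hT
        omega
      · obtain ⟨q1, q2, q3⟩ := g2 i hi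
        obtain ⟨c1, c2, c3, -⟩ := hchild i hi
        exact ⟨q3 ▸ c1, by rw [q3, f16]; exact c2.trans q1, q2⟩
      · rw [hl, hc, p1]
        omega
      · rw [hl] at hi
        obtain ⟨q1, q2, q3⟩ := g2 i hi
        obtain ⟨c1, c2, c3, c4⟩ := hchild i hi
        rw [hl, hc, p2, hq, q3]
        refine c4.trans (Nat.add_le_add_left (Finset.sum_le_sum fun j hj => ?_) _)
        exact Nat.mul_le_mul_left _ (g2 j (Finset.mem_range.1 hj)).1
      · rw [hag.arr 1 (by decide)]
        rfl
  · intro h0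
    rw [Ends.write_iff]
    simp only [Expr.val_get, Expr.val_reg, h21, e13, (h.rep k hk).2]
    refine ⟨by simp only [Expr.cost_get, Expr.cost_reg]; omega, fun i hi => by omega,
      ⟨fun _ => by simp, fun h' => absurd h0 h',
      fun i hi => by omega⟩, fun c _ => by simp, fun v hv => ?_⟩
    rw [Mem.setArr_arr, if_pos rfl, Function.update_of_ne (Fin.val_ne_of_ne (hv h0))]

/-- Constructs the dominating set, parents before children. -/
def topProg : Cmd := forLoop 21 3 distributeProg

/-- After `k` nodes, the root and the children of these nodes have been assigned, and they are
exactly the nodes below `1 + ∑`. Outputs of different leaves do not overwrite each other because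
distinct leaves are disjoint (`disjoint_leaves`). -/
theorem topProg_spec (h : Start A w M d ρ s₀) (hA : Agree workRegs workArrs s₀ s)
    (hs : ∀ c < s₀.reg 3, Solved A M d ρ s₀ c s) (ha : Assigned M d 0 s) :
    Ends topProg s fun t s' => t ≤ 6 + ∑ k ∈ Finset.range (s₀.reg 3),
        (108 * (s₀.arr 11 k + 1)) ∧
      s'.arr 21 0 = s.arr 21 0 ∧ s'.arr 22 0 = s.arr 22 0 ∧
      (∀ c < s₀.reg 3, Solved A M d ρ s₀ c s') ∧ (∀ c < s₀.reg 3, Assigned M d c s') ∧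
      ∀ c < s₀.reg 3, Distributed A ρ s₀ c s' := by
  have e3 : s.reg 3 = s₀.reg 3 := hA.reg 3 (by decide)
  have hsol : ∀ s', s'.arr 16 = s.arr 16 → s'.arr 17 = s.arr 17 → s'.arr 18 = s.arr 18 →
      ∀ c < s₀.reg 3, Solved A M d ρ s₀ c s' := fun s' h1 h2 h3 c hc =>
    (hs c hc).congr (fun _ _ => by rw [h1]) (fun _ _ _ _ => by rw [h1])
      fun _ _ _ _ => by rw [h2, h3]; exact ⟨rfl, rfl⟩
  rw [topProg]
  refine Ends.forLoop_le (fun k s' => s'.arr 21 0 = s.arr 21 0 ∧ s'.arr 22 0 = s.arr 22 0 ∧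
    (∀ c < 1 + ∑ j ∈ Finset.range k, s₀.arr 11 j, Assigned M d c s') ∧
    ∀ c < k, Distributed A ρ s₀ c s') (fun k => 100 * (s₀.arr 11 k + 1)) ?_ ?_ ?_
  · refine ⟨rfl, rfl, fun c hc => ?_, fun c hc => by omega⟩
    obtain rfl : c = 0 := by simpa using hc
    exact ⟨ha.1, ha.2, ha.3⟩
  · rintro k s' hk hxk hag ⟨g1, g2, g3, g4⟩
    rw [e3] at hk
    have hf := h.tree.first k hk
    have hkc := h.tree.lt_first k hk
    rw [← hf] at g3
    have hA' : Agree workRegs workArrs s₀ s' :=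
      hA.trans hag (by decide) (by decide) (by decide) (by decide)
    refine (distributeProg_spec h hA' hk hxk (hsol s' (hag.arr 16 (by decide))
      (hag.arr 17 (by decide)) (hag.arr 18 (by decide))) (g3 k hkc)).conseq ?_
    rintro t s'' ag ⟨T, k1, k2, k3, k4⟩
    have f16 : s''.arr 16 = s'.arr 16 := ag.arr 16 (by decide)
    refine ⟨T, (k3 0 (by omega)).1.trans g1, (k3 0 (by omega)).2.trans g2, fun c hc => ?_,
      fun c hc => ?_⟩
    · rw [Finset.sum_range_succ, ← add_assoc, ← hf] at hc
      rcases lt_or_ge c (s₀.arr 10 k) with hlt | hge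
      · obtain ⟨a1, a2, a3⟩ := g3 c hlt
        obtain ⟨b1, b2⟩ := k3 c hlt
        refine ⟨?_, ?_, ?_⟩ <;> simp only [Mem.setReg_arr, b1, b2, f16] <;> assumption
      · obtain ⟨a1, a2, a3⟩ := k1 (c - s₀.arr 10 k) (by omega)
        rw [Nat.add_sub_cancel' hge] at a1 a2 a3
        exact ⟨a1, a2, a3⟩
    · rcases Nat.lt_succ_iff_lt_or_eq.1 hc with hlt | rfl
      · have hfa := h.tree.first_add hlt hk
        refine (g4 c hlt).congr (fun h0 => k4 _ fun h0' he => ?_) (k3 c (by omega))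
          fun i hi => k3 _ (by omega)
        have := h.tree.disjoint_leaves (by omega) hk h0 h0' (by omega)
        refine Finset.disjoint_left.1 this (h.rep c (by omega)).1 ?_
        rw [he]
        exact (h.rep k hk).1
      · exact ⟨k2.1, k2.2, k2.3⟩
  · rintro t s' _ hag ⟨g1, g2, g3, g4⟩ hT
    rw [e3] at g3 g4 hT
    rw [← h.tree.total] at g3
    refine ⟨hT.trans (Nat.add_le_add_left (Finset.sum_le_sum fun k _ => by omega) _), g1, g2,
      hsol s' (hag.arr 16 (by decide)) (hag.arr 17 (by decide)) (hag.arr 18 (by decide)), g3, g4⟩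


/-! ### The main program -/

variable {n : ℕ} {A : Fin n → Fin n → Prop} {w d : ℕ} {M : ℕ → Finset (Fin n)} {s : Mem}

/-- Prepares the addresses of the rows of values. -/
def baseProg : Cmd :=
  .seq (.assign 20 (.add (.reg 2) (.const 1))) (.seq (.assign 25 (.const 0))
    (forLoop 22 3 (.seq (.write 15 (.reg 22) (.reg 25))
      (.assign 25 (.add (.reg 25) (.reg 20))))))

theorem Ready.congr {R B : List ℕ} {s' : Mem} (h : Ready A w M s) (hA : Agree R B s s')
    (r0 : 0 ∉ R := by decide) (r3 : 3 ∉ R := by decide) (a2 : 2 ∉ B := by decide)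
    (a3 : 3 ∉ B := by decide) (a5 : 5 ∉ B := by decide) (a10 : 10 ∉ B := by decide)
    (a11 : 11 ∉ B := by decide) (a12 : 12 ∉ B := by decide) (a13 : 13 ∉ B := by decide) :
    Ready A w M s' := by
  obtain ⟨h1, h2, h3⟩ := h
  refine ⟨h1.congr hA r0 a2, h2.congr hA a3, ?_⟩
  have e3 := hA.reg 3 r3
  have e5 := hA.arr 5 a5
  have e10 := hA.arr 10 a10
  have e11 := hA.arr 11 a11
  have e12 := hA.arr 12 a12
  have e13 := hA.arr 13 a13
  constructor
  · exact le_rfl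
  · exact h3.root
  · rw [e3, e11]; exact h3.total
  · rw [e3, e10, e11]; exact h3.first
  · rw [e3, e10]; exact h3.lt_first
  · rw [e3, e12]; exact h3.size
  · rw [e3, e13]; exact h3.rep
  · rw [e3, e11]; exact h3.leaf
  · rw [e3, e11]; exact h3.width
  · rw [e3, e10, e11]; exact h3.split
  · rw [e3]; exact h3.nonempty
  · rw [e3, e5]; exact h3.part
  · rw [e3, e5]; exact h3.part_lt
  · rw [e3, e5]; exact h3.count

theorem baseProg_spec (h : Ready A w M s) (hd : s.reg 2 = d) :
    Ends baseProg s fun t s' => t ≤ 20 * (s.reg 3 + 1) ∧ ∃ ρ, Start A w M d ρ s' := by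
  have : Ends baseProg s fun t s' => t ≤ 20 * (s.reg 3 + 1) ∧ s'.reg 20 = d + 1 ∧
      ∀ c < s.reg 3, s'.arr 15 c = c * (d + 1) := by
    rw [baseProg, Ends.seq_iff, Ends.assign_iff, Ends.seq_iff, Ends.assign_iff]
    refine Ends.forLoop_le (fun i s' => s'.reg 25 = i * (d + 1) ∧
      ∀ c < i, s'.arr 15 c = c * (d + 1)) (fun _ => 7) ?_ ?_ ?_
    · simp
    · rintro i s' hi hxi hag ⟨g1, g2⟩
      have g20 : s'.reg 20 = d + 1 := by rw [hag.reg 20 (by decide)]; simp [hd]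
      simp only [Ends.seq_iff, Ends.write_iff, Ends.assign_iff]
      refine ⟨by simp, by simp [g1, g20]; ring, fun c hc => ?_⟩
      simp only [Mem.setReg_arr, Mem.setArr_arr, if_true, Expr.val_reg, hxi, g1]
      by_cases he : c = i
      · rw [he, Function.update_self]
      · rw [Function.update_of_ne he]
        exact g2 c (by omega)
    · rintro t s' _ hag ⟨g1, g2⟩ hT
      simp only [Mem.setReg_reg, Expr.val_add, Expr.val_reg, Expr.val_const] at g2 hT
      norm_num at g2 hT
      refine ⟨?_, ?_, g2⟩
      · simp only [Expr.cost_add, Expr.cost_reg, Expr.cost_const]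
        omega
      · rw [hag.reg 20 (by decide)]; simp [hd]
  refine this.conseq fun t s' ag ⟨T, g1, g2⟩ => ⟨T, ?_⟩
  have hr := h.congr ag
  have e3 : s'.reg 3 = s.reg 3 := ag.reg 3 (by decide)
  obtain ⟨v₀, -⟩ := h.tree.nonempty 0 (by have := h.tree.total; omega)
  have : ∀ c, ∃ v : Fin n, c < s'.reg 3 → v ∈ M c ∧ s'.arr 13 c = v := fun c => by
    by_cases hc : c < s'.reg 3
    · obtain ⟨v, hv⟩ := hr.tree.rep c hc
      exact ⟨v, fun _ => hv⟩
    · exact ⟨v₀, fun h' => absurd h' hc⟩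
  choose ρ hρ using this
  exact ⟨ρ, hr, by rw [ag.reg 2 (by decide), hd], g1, by rw [e3]; exact g2, hρ⟩

/-- Computes a minimum dominating set after the preprocessing. -/
def mainProg : Cmd :=
  .seq baseProg (.seq dpProg (.seq (.write 22 (.const 0) (.reg 2))
    (.seq (.write 21 (.const 0) (.get 16 (.reg 2))) topProg)))

/-- The root is node `0`, so its values start at address `0` and cell `d` of array `16` holds the
value for the full demand. This value is a lower bound for every dominating set, and it is also the
size of the constructed one. -/
theorem mainProg_spec (hd : 0 < d) (h : Ready A w M s) (h2 : s.reg 2 = d)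
    (hirr : ∀ x, ¬ A x x) :
    Ends mainProg s fun t s' =>
      t ≤ 800 * (∑ k ∈ Finset.range (s.reg 3), (s.arr 11 k + 1) * (d + 1) ^ (s.arr 11 k + 1)) ∧
        LocalDom A Finset.univ d (output n s') ∧
        ∀ T, LocalDom A Finset.univ d T → (output n s').card ≤ T.card := by
  have hm : 0 < s.reg 3 := by have := h.tree.total; omega
  rw [mainProg, Ends.seq_iff]
  refine (baseProg_spec h h2).conseq ?_
  rintro t₁ s₁ a₁ ⟨T₁, ρ, hS⟩
  have e3 : s₁.reg 3 = s.reg 3 := a₁.reg 3 (by decide)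
  have e11 : s₁.arr 11 = s.arr 11 := a₁.arr 11 (by decide)
  rw [Ends.seq_iff]
  refine (dpProg_spec hd hS hirr).conseq ?_
  rintro t₂ s₂ a₂ ⟨T₂, hsol⟩
  simp only [Ends.seq_iff (p := .write 22 _ _), Ends.seq_iff (p := .write 21 _ _), Ends.write_iff]
  have e2 : s₂.reg 2 = d := (a₂.reg 2 (by decide)).trans hS.demand
  simp only [Expr.val_const, Expr.val_reg, Expr.val_get, Mem.setArr_reg, Mem.setArr_arr, e2]
  rw [if_neg (by decide)]
  set s₃ := (s₂.setArr 22 0 d).setArr 21 0 (s₂.arr 16 d) with hs₃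
  have hA : Agree workRegs workArrs s₁ s₃ := by
    refine a₂.trans (R' := []) (A' := [21, 22]) (s'' := s₃) ⟨fun _ _ => rfl, fun a ha => ?_⟩
      (by decide) (by decide) (by decide) (by decide)
    simp only [List.mem_cons, List.not_mem_nil, or_false, not_or] at ha
    simp [hs₃, ha.1, ha.2]
  have e16 : s₃.arr 16 = s₂.arr 16 := by simp [hs₃]
  have e21 : s₃.arr 21 0 = s₂.arr 16 d := by simp [hs₃]
  have e22 : s₃.arr 22 0 = d := by simp [hs₃]
  have hsol₃ : ∀ c < s₁.reg 3, Solved A M d ρ s₁ c s₃ := fun c hc =>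
    (hsol c hc).congr (fun _ _ => by rw [e16]) (fun _ _ _ _ => by rw [e16])
      fun _ _ _ _ => by simp [hs₃]
  have hsol0 := hsol₃ 0 (by omega)
  have hroot := hS.tree.root
  refine (topProg_spec hS hA hsol₃ ⟨e22.le, by rw [e22, e21, e16]; simp, ?_⟩).mono ?_
  · have := hsol0.le_size d le_rfl
    rw [e21, ← e16]
    simpa using this
  rintro t₄ s₄ ⟨T₄, k21, k22, c1, c2, c3⟩
  obtain ⟨q1, q2⟩ := localDom_of_distributed (S := output n s₄) hS hirr c1 c2 c3
    (fun v => by simp [output]) (k := 0) (by omega)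
  rw [k22, e22, hroot] at q2
  rw [k21, e21, hroot, Finset.univ_inter] at q1
  refine ⟨?_, q2, fun T hT => ?_⟩
  · rw [e3, e11] at T₂ T₄
    rw [← Finset.mul_sum] at T₂ T₄
    have h1 : ∑ k ∈ Finset.range (s.reg 3), (s.arr 11 k + 1) + s.reg 3 ≤
        ∑ k ∈ Finset.range (s.reg 3), (s.arr 11 k + 1) * (d + 1) ^ (s.arr 11 k + 1) := by
      have : ∑ k ∈ Finset.range (s.reg 3), (s.arr 11 k + 1 + 1) ≤
          ∑ k ∈ Finset.range (s.reg 3), (s.arr 11 k + 1) * (d + 1) ^ (s.arr 11 k + 1) := by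
        refine Finset.sum_le_sum fun k _ => ?_
        have : 2 ≤ (d + 1) ^ (s.arr 11 k + 1) :=
          (show 2 ≤ d + 1 by omega).trans (Nat.le_self_pow (by omega) _)
        nlinarith
      rw [Finset.sum_add_distrib] at this
      simpa using this
    simp only [Expr.cost_const, Expr.cost_reg, Expr.cost_get]
    omega
  · rw [q1]
    have := hsol0.lower d le_rfl T (by rw [hroot]; exact hT)
    rw [hroot, Finset.univ_inter, e16] at this
    simpa using this

/-- Every node except the root is a child of one node, so the numbers of children add up to less
than the number of nodes, which is at most `2 * n`. Thus the factors `l + 1` add up to at most `4 *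
n`. The remaining excess factor `d + 1` is at most `2 * d`, which yields the constant 8. -/
theorem Ready.sum_le (h : Ready A w M s) (hw : 1 ≤ w) (hd : 0 < d) :
    ∑ k ∈ Finset.range (s.reg 3), (s.arr 11 k + 1) * (d + 1) ^ (s.arr 11 k + 1) ≤
      8 * (n * d * (d + 1) ^ w) := by
  have h1 : ∀ k ∈ Finset.range (s.reg 3), (s.arr 11 k + 1) * (d + 1) ^ (s.arr 11 k + 1) ≤
      (s.arr 11 k + 1) * (d + 1) ^ (w + 1) := fun k hk => by
    refine Nat.mul_le_mul_left _ (Nat.pow_le_pow_right (by omega) ?_)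
    by_cases h0 : s.arr 11 k = 0
    · omega
    · have := (h.tree.width k (Finset.mem_range.1 hk) h0).2
      omega
  have h2 : ∑ k ∈ Finset.range (s.reg 3), (s.arr 11 k + 1) ≤ 4 * n := by
    have h3 := h.tree.total
    have h4 := h.card_le
    rw [Finset.sum_add_distrib]
    simp only [Finset.sum_const, Finset.card_range, smul_eq_mul]
    omega
  calc _ ≤ ∑ k ∈ Finset.range (s.reg 3), (s.arr 11 k + 1) * (d + 1) ^ (w + 1) :=
        Finset.sum_le_sum h1
    _ = (∑ k ∈ Finset.range (s.reg 3), (s.arr 11 k + 1)) * (d + 1) ^ (w + 1) := by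
        rw [Finset.sum_mul]
    _ ≤ (4 * n) * ((d + 1) ^ w * (2 * d)) := by
        rw [pow_succ]
        exact Nat.mul_le_mul h2 (Nat.mul_le_mul_left _ (by omega))
    _ = _ := by ring

/-! ### Correctness and running time -/

theorem isDominating_iff {r : ℕ} {G : SimpleGraph (Fin n)} {S : Finset (Fin n)} :
    IsDominating G d r S ↔ LocalDom (PowAdj G r) Finset.univ d S := by
  classical
  have key : ∀ v, (ball G r v ∩ (S : Set (Fin n))).ncard =
      ((Finset.univ ∩ S).filter (PowAdj G r v)).card := fun v => by
    rw [← Set.ncard_coe_finset]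
    congr 1
    ext u
    simp only [ball, PowAdj, Set.mem_inter_iff, Set.mem_ofPred_eq, Finset.mem_coe,
      Finset.coe_filter, Finset.univ_inter, ne_comm (a := u)]
    tauto
  constructor
  · intro h v _ hv
    have := h v hv
    rw [key] at this
    convert this
  · intro h v hv
    rw [key]
    convert h v (Finset.mem_univ v) hv

theorem mainProg_correct {r : ℕ} {G : SimpleGraph (Fin n)} (hd : 0 < d)
    (h : Ready (PowAdj G r) w M s) (h2 : s.reg 2 = d) (hw : 1 ≤ w) :
    Ends mainProg s fun t s' => t ≤ 6400 * (n * d * (d + 1) ^ w) ∧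
      IsMinDominating G d r (output n s') := by
  refine (mainProg_spec hd h h2 fun x hx => hx.1 rfl).mono fun t s' ⟨T, h1, h3⟩ => ⟨?_, ?_, ?_⟩
  · have := h.sum_le hw hd
    omega
  · exact isDominating_iff.2 h1
  · exact fun T hT => h3 T (isDominating_iff.1 hT)

theorem preProg_correct {r : ℕ} (hn : 0 < n) (hr : 0 < r) (G : SimpleGraph (Fin n)) (d : ℕ) :
    Ends preProg (input G d r) fun _ s' => s'.reg 2 = d ∧
      ∃ M, Ready (PowAdj G r) (modularWidth G) M s' := by
  refine preProg_spec hn (fun u v => ?_) rfl rfl (fun a i ha => ?_) (two_le_modularWidth hn G)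
    (dec_powAdj hn hr G)
  · have e : (∃ u' v' : Fin n, G.Adj u' v' ∧ u.val * n + v.val = u'.val * n + v'.val) ↔
        G.Adj u v := by
      refine ⟨?_, fun h => ⟨u, v, h, rfl⟩⟩
      rintro ⟨u', v', h, e⟩
      obtain ⟨rfl, rfl⟩ := index_inj e
      exact h
    by_cases hG : G.Adj u v <;> simp [input, e, hG, bit]
  · simp [input, ha]

theorem computable_fpt (C : ℕ) : Computable fun k : ℕ => C * (1 + k * (k + 1) ^ k) := by
  have hp : Primrec₂ fun a b : ℕ => a ^ b := by
    refine (Primrec.nat_rec (f := fun _ : ℕ => 1) (g := fun (a : ℕ) (p : ℕ × ℕ) => p.2 * a)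
      (Primrec.const 1) ?_).of_eq fun a b => ?_
    · exact (Primrec.nat_mul.comp (Primrec.snd.comp Primrec.snd) Primrec.fst).to₂
    · induction b with
      | zero => rfl
      | succ b ih => rw [pow_succ, ← ih]
  have h : Primrec fun k : ℕ => C * (1 + k * (k + 1) ^ k) :=
    Primrec.nat_mul.comp (Primrec.const C) (Primrec.nat_add.comp (Primrec.const 1)
      (Primrec.nat_mul.comp Primrec.id (hp.comp Primrec.succ Primrec.id)))
  exact h.to_comp

end DRDomination

theorem mainTheorem1 :
    -- A preprocessing of `(G, r)` in time polynomial in `n`, independent of `d`, and then, for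
    -- every demand `d`, a minimum `(d, r)`-dominating set in time `O(n * d * (d+1)^mw)`.
    (∃ (pre main : DRDomination.Cmd) (C c : ℕ),
      ∀ (n : ℕ) (G : SimpleGraph (Fin n)) (r : ℕ), 0 < n → 0 < r →
        ∃ (t₁ : ℕ) (s₁ : DRDomination.Mem),
          DRDomination.Runs pre (DRDomination.input G 0 r) t₁ s₁ ∧
          t₁ ≤ C * n ^ c ∧
          ∀ d : ℕ, 0 < d →
            ∃ (t₂ : ℕ) (s₂ : DRDomination.Mem),
              DRDomination.Runs main (s₁.setReg DRDomination.demandReg d) t₂ s₂ ∧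
              t₂ ≤ C * (n * d * (d + 1) ^ DRDomination.modularWidth G) ∧
              DRDomination.IsMinDominating G d r (DRDomination.output n s₂)) ∧
    -- A single program on input `(G, d, r)`, its total running time, and the FPT bound.
    (∃ (p : DRDomination.Cmd) (C c c' : ℕ) (f : ℕ → ℕ), Computable f ∧
      ∀ (n : ℕ) (G : SimpleGraph (Fin n)) (d r : ℕ), 0 < n → 0 < d → 0 < r →
        ∃ (t : ℕ) (s : DRDomination.Mem),
          DRDomination.Runs p (DRDomination.input G d r) t s ∧
          t ≤ C * (n ^ c + n * d * (d + 1) ^ DRDomination.modularWidth G) ∧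
          t ≤ f (DRDomination.modularWidth G + d) * n ^ c' ∧
          DRDomination.IsMinDominating G d r (DRDomination.output n s)) := by
  open DRDomination in
  obtain ⟨K, c, hK⟩ := preProg_time
  have hpre : ∀ (n : ℕ) (G : SimpleGraph (Fin n)) (d r : ℕ), 0 < n → 0 < r →
      Ends preProg (input G d r) fun t s => t ≤ K * n ^ c ∧ s.reg 2 = d ∧
        ∃ M, Ready (PowAdj G r) (modularWidth G) M s := fun n G d r hn hr =>
    ((hK n _ hn rfl).and_time (preProg_correct hn hr G d)).mono fun _ _ h => h
  -- The constant 6400 is the bound for `mainProg`, and `K` belongs to the preprocessing. The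
  -- exponent `max c 1` absorbs both `n ^ c` and the linear factor `n`.
  refine ⟨⟨preProg, mainProg, K + 6400, c, fun n G r hn hr => ?_⟩,
    ⟨.seq preProg mainProg, K + 6400, c, max c 1, fun k => (K + 6400) * (1 + k * (k + 1) ^ k),
      computable_fpt _, fun n G d r hn hd hr => ?_⟩⟩
  · obtain ⟨t₁, s₁, hrun, ht, -, M, hM⟩ := hpre n G 0 r hn hr
    refine ⟨t₁, s₁, hrun, ht.trans (Nat.mul_le_mul_right _ (by omega)), fun d hd => ?_⟩
    -- `Ready` does not depend on the demand register, so the demand can be supplied after the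
    -- preprocessing.
    have hA : Agree [2] [] s₁ (s₁.setReg demandReg d) :=
      ⟨fun x hx => by
        rw [Mem.setReg_reg, if_neg]
        simpa [demandReg] using hx, fun _ _ => rfl⟩
    obtain ⟨t₂, s₂, hrun₂, ht₂, hmin⟩ := mainProg_correct hd (hM.congr hA)
      (by simp [demandReg]) (one_le_two.trans (two_le_modularWidth hn G))
    exact ⟨t₂, s₂, hrun₂, ht₂.trans (Nat.mul_le_mul_right _ (by omega)), hmin⟩
  · obtain ⟨t₁, s₁, hrun, ht, h2, M, hM⟩ := hpre n G d r hn hr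
    obtain ⟨t₂, s₂, hrun₂, ht₂, hmin⟩ := mainProg_correct hd hM h2
      (one_le_two.trans (two_le_modularWidth hn G))
    have hC : t₁ + t₂ ≤ (K + 6400) * (n ^ c + n * d * (d + 1) ^ modularWidth G) := by
      rw [mul_add]
      exact Nat.add_le_add (ht.trans (Nat.mul_le_mul_right _ (by omega)))
        (ht₂.trans (Nat.mul_le_mul_right _ (by omega)))
    refine ⟨t₁ + t₂, s₂, .seq hrun hrun₂, hC, hC.trans ?_, hmin⟩
    refine (Nat.mul_le_mul_left _ ?_).trans_eq (mul_assoc _ _ _).symm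
    rw [add_mul, one_mul]
    refine Nat.add_le_add (Nat.pow_le_pow_right hn (le_max_left _ _)) ?_
    have h1 : n ≤ n ^ max c 1 := Nat.le_self_pow (by omega) n
    -- For the parameter `modularWidth G + d`, both the base and the exponent only increase.
    have h3 : (d + 1) ^ modularWidth G ≤ (modularWidth G + d + 1) ^ (modularWidth G + d) :=
      (Nat.pow_le_pow_left (by omega) _).trans (Nat.pow_le_pow_right (by omega) (by omega))
    calc n * d * (d + 1) ^ modularWidth G = d * (d + 1) ^ modularWidth G * n := by ring
      _ ≤ _ := Nat.mul_le_mul (Nat.mul_le_mul (by omega) h3) h1
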